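/- There are a single randomized algorithm $V$ (the verifier) and a universal constant $C>0$ such that the following holds. Let $d\ge 1$, let $A_1,\dots,A_d$ be finite sets with $|A_i|\ge 2$, let $N=\prod_{i=1}^d|A_i|$, and let $0<\sigma\le 1$ and $\varepsilon>0$ be such that $\varepsilon$ is not too small in terms of $N$ and $\sigma$: $$\varepsilon\ \ge\ \min\Bigl\{\frac{1}{N\sigma^{2}},\ \frac{\sigma}{N^{1/4}}\Bigr\}.$$ Then $V$ is the verifier of a non-interactive (one-message, Merlin–Arthur) proof protocol for verifying independence over $A_1\times\dots\times A_d$. In this protocol a prover, who knows the unknown distribution $D$ on $A_1\times\dots\times A_d$, sends one message consisting of numbers in $[0,1]$. Then $V$, which knows the $|A_i|$, $\sigma$ and $\varepsilon$, draws independent samples from $D$ and accepts or rejects. The protocol has these properties. * **Privacy:** it is $\varepsilon$-differentially private. For any prover, any two datasets of samples $X,X'$ that differ in at most one element, and any set $E$ of transcripts (a transcript is the message together with the verifier's decision), the probability that the transcript is in $E$ when $V$ uses $X$ is at most $e^{\varepsilon}$ times the probability when $V$ uses $X'$. * **Sample complexity:** $V$ uses at most $C\left(\frac{\sqrt N}{\sigma\sqrt\varepsilon}+\frac{\sqrt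 N}{\sigma^2}\right)$ samples. * **Verifier runtime:** for every message, dataset and outcome of its coins, $V$ halts within $C\left(\frac{\sqrt N\log N}{\sigma\sqrt\varepsilon}+\frac{\sqrt N\log N}{\sigma^2}\right)$ steps. The model is a real RAM with random access to the message and to the samples, unit-cost arithmetic, $\exp$ and $\log$ on real numbers, unit-cost addition, subtraction and halving on natural numbers, no rounding of real numbers to integers in one step, and an instruction that draws a uniform point of $[0,1]$. * **Communication complexity:** the message consists of at most $C\sum_{i=1}^d|A_i|$ numbers. * **Completeness:** if $D$ is a product distribution and the prover is honest, then $V$ accepts with probability at least $0.75$. * **Soundness:** if $D$ is $\sigma$-far from every product distribution, i.e. of total variation distance at least $\sigma$ from each of them, then $V$ accepts with probability at most $0.25$ for any prover. -/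

import Mathlib

open MeasureTheory

namespace MAIndependence

/-! ## The verifier's machine

A randomized real RAM. It has a memory of natural numbers and a memory of real numbers, both
initially zero and addressed by natural numbers (so indirect addressing is available), unit cost
arithmetic, and an instruction that draws a fresh uniform point of `[0, 1]`. Natural numbers can only
be added, subtracted (truncated at zero) and halved, and a real number can never be rounded
to a natural number in one step. Division by `0` returns `0`. -/

/-- What the machine can read: the number of attributes, the number of values of each attribute,
the parameters `σ` and `ε`, the number of samples and the samples themselves, the message of the
prover, and the tape of random points of `[0, 1]`. -/
structure Input where
  attrs : ℕ
  card : ℕ → ℕ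
  sigma : ℝ
  eps : ℝ
  size : ℕ
  sample : ℕ → ℕ → ℕ
  msg : ℕ → ℝ
  tape : ℕ → ℝ

/-- Memory contents, and the number of random points drawn so far. -/
structure State where
  nat : ℕ → ℕ
  real : ℕ → ℝ
  drawn : ℕ

/-- Expressions with values in the natural numbers. -/
inductive NatExpr where
  | const (c : ℕ)
  | load (a : NatExpr)
  | add (e f : NatExpr)
  | sub (e f : NatExpr)
  | half (e : NatExpr)
  | attrs
  | card (i : NatExpr)
  | size
  | sample (t i : NatExpr)

/-- Expressions with values in the real numbers. -/
inductive RealExpr where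
  | ofNat (e : NatExpr)
  | load (a : NatExpr)
  | msg (a : NatExpr)
  | sigma
  | eps
  | add (e f : RealExpr)
  | sub (e f : RealExpr)
  | mul (e f : RealExpr)
  | div (e f : RealExpr)
  | exp (e : RealExpr)
  | log (e : RealExpr)

/-- Tests. -/
inductive Test where
  | natLt (e f : NatExpr)
  | realLt (e f : RealExpr)

/-- Programs. `draw a` stores the next random point in the real memory cell `a`. -/
inductive Program where
  | skip
  | setNat (a e : NatExpr)
  | setReal (a : NatExpr) (e : RealExpr)
  | draw (a : NatExpr)
  | seq (c c' : Program)
  | ite (b : Test) (c c' : Program)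
  | while (b : Test) (c : Program)

def NatExpr.eval (I : Input) (s : State) : NatExpr → ℕ
  | const c => c
  | load a => s.nat (a.eval I s)
  | add e f => e.eval I s + f.eval I s
  | sub e f => e.eval I s - f.eval I s
  | half e => e.eval I s / 2
  | attrs => I.attrs
  | card i => I.card (i.eval I s)
  | size => I.size
  | sample t i => I.sample (t.eval I s) (i.eval I s)

/-- The time to evaluate an expression: one step for each operation in it. -/
def NatExpr.cost : NatExpr → ℕ
  | const _ => 1
  | load a => a.cost + 1
  | add e f => e.cost + f.cost + 1
  | sub e f => e.cost + f.cost + 1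
  | half e => e.cost + 1
  | attrs => 1
  | card i => i.cost + 1
  | size => 1
  | sample t i => t.cost + i.cost + 1

noncomputable def RealExpr.eval (I : Input) (s : State) : RealExpr → ℝ
  | ofNat e => (e.eval I s : ℝ)
  | load a => s.real (a.eval I s)
  | msg a => I.msg (a.eval I s)
  | sigma => I.sigma
  | eps => I.eps
  | add e f => e.eval I s + f.eval I s
  | sub e f => e.eval I s - f.eval I s
  | mul e f => e.eval I s * f.eval I s
  | div e f => e.eval I s / f.eval I s
  | exp e => Real.exp (e.eval I s)
  | log e => Real.log (e.eval I s)

def RealExpr.cost : RealExpr → ℕ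
  | ofNat e => e.cost + 1
  | load a => a.cost + 1
  | msg a => a.cost + 1
  | sigma => 1
  | eps => 1
  | add e f => e.cost + f.cost + 1
  | sub e f => e.cost + f.cost + 1
  | mul e f => e.cost + f.cost + 1
  | div e f => e.cost + f.cost + 1
  | exp e => e.cost + 1
  | log e => e.cost + 1

def Test.holds (I : Input) (s : State) : Test → Prop
  | natLt e f => e.eval I s < f.eval I s
  | realLt e f => e.eval I s < f.eval I s

def Test.cost : Test → ℕ
  | natLt e f => e.cost + f.cost + 1
  | realLt e f => e.cost + f.cost + 1

/-- `Exec I c s s' t`: on input `I`, the program `c` started in state `s` halts in state `s'` after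
`t` steps. -/
inductive Exec (I : Input) : Program → State → State → ℕ → Prop where
  | skip (s : State) : Exec I .skip s s 1
  | setNat (a e : NatExpr) (s : State) :
      Exec I (.setNat a e) s
        { s with nat := Function.update s.nat (a.eval I s) (e.eval I s) } (a.cost + e.cost + 1)
  | setReal (a : NatExpr) (e : RealExpr) (s : State) :
      Exec I (.setReal a e) s
        { s with real := Function.update s.real (a.eval I s) (e.eval I s) } (a.cost + e.cost + 1)
  | draw (a : NatExpr) (s : State) :
      Exec I (.draw a) s
        { s with
          real := Function.update s.real (a.eval I s) (I.tape s.drawn)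
          drawn := s.drawn + 1 } (a.cost + 1)
  | seq {c c' : Program} {s s' s'' : State} {t t' : ℕ} (h : Exec I c s s' t)
      (h' : Exec I c' s' s'' t') : Exec I (.seq c c') s s'' (t + t')
  | iteTrue {b : Test} {c c' : Program} {s s' : State} {t : ℕ} (hb : b.holds I s)
      (h : Exec I c s s' t) : Exec I (.ite b c c') s s' (b.cost + t)
  | iteFalse {b : Test} {c c' : Program} {s s' : State} {t : ℕ} (hb : ¬ b.holds I s)
      (h : Exec I c' s s' t) : Exec I (.ite b c c') s s' (b.cost + t)
  | whileTrue {b : Test} {c : Program} {s s' s'' : State} {t t' : ℕ} (hb : b.holds I s)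
      (h : Exec I c s s' t) (h' : Exec I (.while b c) s' s'' t') :
      Exec I (.while b c) s s'' (b.cost + t + t')
  | whileFalse {b : Test} {c : Program} {s : State} (hb : ¬ b.holds I s) :
      Exec I (.while b c) s s b.cost

/-- The machine is deterministic once its input (with the random tape) is fixed. -/
theorem Exec.deterministic {I : Input} {c : Program} {s s₁ s₂ : State} {t₁ t₂ : ℕ}
    (h₁ : Exec I c s s₁ t₁) (h₂ : Exec I c s s₂ t₂) : s₁ = s₂ ∧ t₁ = t₂ := by
  induction h₁ generalizing s₂ t₂ with
  | skip s => cases h₂; exact ⟨rfl, rfl⟩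
  | setNat a e s => cases h₂; exact ⟨rfl, rfl⟩
  | setReal a e s => cases h₂; exact ⟨rfl, rfl⟩
  | draw a s => cases h₂; exact ⟨rfl, rfl⟩
  | seq _ _ ih ih' =>
    cases h₂ with
    | seq k k' =>
      obtain ⟨rfl, rfl⟩ := ih k
      obtain ⟨rfl, rfl⟩ := ih' k'
      exact ⟨rfl, rfl⟩
  | iteTrue hb _ ih =>
    cases h₂ with
    | iteTrue _ k => obtain ⟨rfl, rfl⟩ := ih k; exact ⟨rfl, rfl⟩
    | iteFalse hb' _ => exact absurd hb hb'
  | iteFalse hb _ ih =>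
    cases h₂ with
    | iteTrue hb' _ => exact absurd hb' hb
    | iteFalse _ k => obtain ⟨rfl, rfl⟩ := ih k; exact ⟨rfl, rfl⟩
  | whileTrue hb _ _ ih ih' =>
    cases h₂ with
    | whileTrue _ k k' =>
      obtain ⟨rfl, rfl⟩ := ih k
      obtain ⟨rfl, rfl⟩ := ih' k'
      exact ⟨rfl, rfl⟩
    | whileFalse hb' => exact absurd hb hb'
  | whileFalse hb =>
    cases h₂ with
    | whileTrue hb' _ _ => exact absurd hb' hb
    | whileFalse _ => exact ⟨rfl, rfl⟩

/-- The initial state: all memory cells are zero. -/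
def State.init : State where
  nat := fun _ => 0
  real := fun _ => 0
  drawn := 0

/-! ## Distributions -/

/-- The domain `A₁ × ⋯ × A_d`, where `A_i` has `k i` elements. -/
abbrev Domain {d : ℕ} (k : Fin d → ℕ) : Type := (i : Fin d) → Fin (k i)

/-- The domain size `N`. -/
def domainSize {d : ℕ} (k : Fin d → ℕ) : ℕ := ∏ i, k i

/-- `D` is a product of probability distributions on the attributes. -/
def IsProductDist {d : ℕ} {k : Fin d → ℕ} (D : Measure (Domain k)) : Prop :=
  ∃ p : (i : Fin d) → Measure (Fin (k i)),
    (∀ i, IsProbabilityMeasure (p i)) ∧ D = Measure.pi p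

/-- Total variation distance. -/
noncomputable def tvDist {d : ℕ} {k : Fin d → ℕ} (D D' : Measure (Domain k)) : ℝ :=
  (1 / 2) * ∑ x, |D.real {x} - D'.real {x}|

/-- `D` has total variation distance at least `σ` from every product distribution. -/
def IsFarFromProduct {d : ℕ} {k : Fin d → ℕ} (σ : ℝ) (D : Measure (Domain k)) : Prop :=
  ∀ D' : Measure (Domain k), IsProductDist D' → σ ≤ tvDist D D'

/-! ## Protocols -/

/-- A non-interactive (one-message, Merlin–Arthur) proof protocol for a property of distributions
over the domain given by `k`: the prover sends `msgLength` numbers from `[0, 1]`, chosen with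
full knowledge of the distribution; then the verifier draws `sampleSize` samples and runs its
program. -/
structure Protocol {d : ℕ} (k : Fin d → ℕ) where
  sampleSize : ℕ
  msgLength : ℕ
  honest : Measure (Domain k) → (Fin msgLength → unitInterval)
  verifier : Program

/-- Random tapes: independent uniform points of `[0, 1]`. -/
noncomputable def tapeMeasure : Measure (ℕ → unitInterval) :=
  Measure.infinitePi fun _ => (volume : Measure unitInterval)

namespace Protocol

variable {d : ℕ} {k : Fin d → ℕ} (A : Protocol k)

/-- Datasets for the verifier. -/
abbrev Dataset : Type := Fin A.sampleSize → Domain k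

abbrev Message : Type := Fin A.msgLength → unitInterval

/-- The verifier's input. Indices out of range are answered by `0`. -/
def input (σ ε : ℝ) (m : A.Message) (X : A.Dataset) (ω : ℕ → unitInterval) : Input where
  attrs := d
  card := fun i => if h : i < d then k ⟨i, h⟩ else 0
  sigma := σ
  eps := ε
  size := A.sampleSize
  sample := fun t i =>
    if ht : t < A.sampleSize then if hi : i < d then (X ⟨t, ht⟩ ⟨i, hi⟩ : ℕ) else 0 else 0
  msg := fun j => if h : j < A.msgLength then (m ⟨j, h⟩ : ℝ) else 0
  tape := fun j => (ω j : ℝ)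

/-- The verifier accepts if it halts with the number `1` in the memory cell `0`. -/
def Accepts (σ ε : ℝ) (m : A.Message) (X : A.Dataset) (ω : ℕ → unitInterval) : Prop :=
  ∃ (s : State) (t : ℕ), Exec (A.input σ ε m X ω) A.verifier State.init s t ∧ s.nat 0 = 1

/-- The verifier halts within `T` steps, whatever the message, the dataset and the coins. -/
def RunsInTime (σ ε T : ℝ) : Prop :=
  ∀ (m : A.Message) (X : A.Dataset) (ω : ℕ → unitInterval),
    ∃ (s : State) (t : ℕ), Exec (A.input σ ε m X ω) A.verifier State.init s t ∧ (t : ℝ) ≤ T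

open Classical in
/-- The transcript: the message of the prover and the decision of the verifier. -/
noncomputable def transcript (σ ε : ℝ) (m : A.Message) (X : A.Dataset) (ω : ℕ → unitInterval) :
    A.Message × Bool :=
  (m, decide (A.Accepts σ ε m X ω))

/-- Datasets that differ on the value of at most one element. -/
def Adjacent (X X' : A.Dataset) : Prop :=
  ∃ j, ∀ i, i ≠ j → X i = X' i

/-- `ε`-differential privacy of the transcript, for every (adversarial) prover. -/
def IsDP (σ ε : ℝ) : Prop :=
  ∀ (m : A.Message) (X X' : A.Dataset), A.Adjacent X X' → ∀ E : Set (A.Message × Bool),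
    tapeMeasure.real {ω | A.transcript σ ε m X ω ∈ E} ≤
      Real.exp ε * tapeMeasure.real {ω | A.transcript σ ε m X' ω ∈ E}

/-- The probability that the verifier accepts the message `m`, over independent samples from `D`
and its own coins. -/
noncomputable def acceptProb (σ ε : ℝ) (m : A.Message) (D : Measure (Domain k)) : ℝ :=
  ((Measure.pi fun _ : Fin A.sampleSize => D).prod tapeMeasure).real
    {z | A.Accepts σ ε m z.1 z.2}

end Protocol

end MAIndependence

/-!
# A private Merlin–Arthur protocol for independence

The honest prover describes the marginals of the distribution. The marginal of each attribute is
sent as the conditional splitting probabilities of a balanced binary search tree, so that every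
message, honest or not, describes some product distribution `q`, and the verifier can find the
probability `q x` together with the corresponding cumulative probability in `O(log N)` steps.

*Reduction to uniformity.* Cut the unit interval into pieces indexed by the domain, where the piece of
`x` has the length `(q x + 1 / N) / 2`. Replace each sample, with probability `1 / 2`, by a uniform
point of the domain, take a uniform point of the piece of the result, and record its bin among `M` equal
bins of the unit interval, where `M` is a power of two of the order of `N`. If `D = q`, the bin is
exactly uniform (`sampleBin_law_of_eq`). No piece is shorter than `1 / (2 N)`, so every piece consists
for the most part of full bins, and the `ℓ¹` distance of the law of the bin from uniform is at least a
constant times the distance of `D` from `q` (`l1_sampleBin_law`). It remains to test privately whether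
`n` samples of bins come from the uniform distribution.

*The statistic.* It is the sum over the bins of `cellFun` of the count, a convex function that is quadratic
near the mean count `lam = n / M` and has slopes bounded by `R = 16 √(1 + lam)`. One sample therefore
changes it by at most `2 R` (`abs_stat_sub_le`). Its mean is a sum of binomial means; two derivatives in
the success probability show that it exceeds the uniform mean by at least a sum of Huber functions of the
deviations (`le_gap_of_far`), and the Efron–Stein inequality bounds the variance in terms of `lam` and of
the same excess (`variance_le_gap`). Chebyshev's inequality then separates the two cases.

*The uniform mean.* The machine has no formula for the mean of the statistic of uniform bins. The verifier
subtracts instead the statistic of `n` simulated uniform bins, which costs no privacy and is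
concentrated as well.

*Privacy.* The verifier accepts with probability `1 / (1 + exp (ε / (2 R) * (S - τ)))`, where `S` is the
difference of the statistics and `τ` is half of the least excess that has to be detected. Changing one
sample changes the exponent by at most `ε`, which is differential privacy (`isDP_of_verifier`). The lower
bound for `ε` makes `ε / R` times the excess larger than a constant (`noise_le`), so that the
decision is nearly deterministic on either side.

*The program.* `wp_verifier` computes the outcome and bounds the time of the program, by a calculus
of weakest preconditions. The bin of a point is found digit by digit, and the statistics
are updated with each sample, so that a sample takes `O(log N)` steps.
-/

namespace MAIndependence

/-! ### Binomial expectations -/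

/-- The expectation of `f` under the binomial distribution with `n` trials and success probability
`q`, by recursion on the trials. -/
def binE : ℕ → ℝ → (ℕ → ℝ) → ℝ
  | 0, _, f => f 0
  | n + 1, q, f => (1 - q) * binE n q f + q * binE n q fun j => f (j + 1)

theorem binE_const (n : ℕ) (q c : ℝ) : binE n q (fun _ => c) = c := by
  induction n with
  | zero => rfl
  | succ n ih => simp only [binE, ih]; ring

theorem binE_add (n : ℕ) (q : ℝ) (f h : ℕ → ℝ) :
    binE n q (fun j => f j + h j) = binE n q f + binE n q h := by
  induction n generalizing f h with
  | zero => rfl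
  | succ n ih => simp only [binE, ih]; ring

theorem binE_const_mul (n : ℕ) (q c : ℝ) (f : ℕ → ℝ) :
    binE n q (fun j => c * f j) = c * binE n q f := by
  induction n generalizing f with
  | zero => rfl
  | succ n ih => simp only [binE, ih]; ring

theorem binE_sub (n : ℕ) (q : ℝ) (f h : ℕ → ℝ) :
    binE n q (fun j => f j - h j) = binE n q f - binE n q h := by
  induction n generalizing f h with
  | zero => rfl
  | succ n ih => simp only [binE, ih]; ring

theorem binE_mono (n : ℕ) {q : ℝ} (h0 : 0 ≤ q) (h1 : q ≤ 1) {f h : ℕ → ℝ} (hfh : ∀ j, f j ≤ h j) :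
    binE n q f ≤ binE n q h := by
  induction n generalizing f h with
  | zero => exact hfh 0
  | succ n ih =>
    have a := ih hfh
    have b := ih (f := fun j => f (j + 1)) (h := fun j => h (j + 1)) fun j => hfh _
    simp only [binE]
    have := sub_nonneg.2 h1
    gcongr

/-- The second moment of a binomial variable about any point. -/
theorem binE_sq_sub (n : ℕ) (q c : ℝ) :
    binE n q (fun j => ((j : ℝ) - c) ^ 2) = n * q * (1 - q) + (n * q - c) ^ 2 := by
  induction n generalizing c with
  | zero => simp [binE]
  | succ n ih =>
    have : (fun j : ℕ => (((j + 1 : ℕ) : ℝ) - c) ^ 2) = fun j : ℕ => ((j : ℝ) - (c - 1)) ^ 2 := by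
      funext j; push_cast; ring
    simp only [binE, this, ih]
    push_cast
    ring

/-- The derivative of a binomial mean in the success probability is a binomial mean of the forward
difference. Applied twice, it turns convexity of the cell function into convexity in `q`. -/
theorem hasDerivAt_binE (n : ℕ) (q : ℝ) (f : ℕ → ℝ) :
    HasDerivAt (fun q => binE (n + 1) q f) ((n + 1) * binE n q fun j => f (j + 1) - f j) q := by
  induction n generalizing f with
  | zero =>
    have h : HasDerivAt (fun q : ℝ => (1 - q) * f 0 + q * f 1) ((0 - 1) * f 0 + 1 * f 1) q :=
      ((((hasDerivAt_const q (1 : ℝ)).sub (hasDerivAt_id q)).mul_const (f 0))).add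
        ((hasDerivAt_id q).mul_const (f 1))
    refine HasDerivAt.congr_deriv h ?_
    change _ = (((0 : ℕ) : ℝ) + 1) * (f 1 - f 0)
    push_cast; ring
  | succ n ih =>
    have h : HasDerivAt
        (fun q : ℝ => (1 - q) * binE (n + 1) q f + q * binE (n + 1) q fun j => f (j + 1)) _ q :=
      (((hasDerivAt_const q (1 : ℝ)).sub (hasDerivAt_id q)).mul (ih f)).add
        ((hasDerivAt_id q).mul (ih fun j => f (j + 1)))
    refine HasDerivAt.congr_deriv h ?_
    have e : binE (n + 1) q (fun j => f (j + 1) - f j)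
        = (1 - q) * binE n q (fun j => f (j + 1) - f j)
          + q * binE n q (fun j => f (j + 1 + 1) - f (j + 1)) := rfl
    have e' := binE_sub (n + 1) q (fun j => f (j + 1)) f
    push_cast
    simp only [id, Pi.sub_apply]
    linear_combination -e' - ((n : ℝ) + 1) * e

/-! ### Quadratic growth of functions with a lower bound on the second derivative -/

/-- A function with a monotone derivative lies above its tangents. -/
theorem tangent_le {F F' : ℝ → ℝ} {a b x y : ℝ} (hF : ∀ t, HasDerivAt F (F' t) t)
    (hm : MonotoneOn F' (Set.Icc a b)) (hx : x ∈ Set.Icc a b) (hy : y ∈ Set.Icc a b) :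
    F x + F' x * (y - x) ≤ F y := by
  rcases lt_trichotomy x y with h | rfl | h
  · obtain ⟨c, hc, e⟩ := exists_hasDerivAt_eq_slope F F' h
      (fun t _ => (hF t).continuousAt.continuousWithinAt) fun t _ => hF t
    have : F' x ≤ F' c := hm hx ⟨hx.1.trans hc.1.le, hc.2.le.trans hy.2⟩ hc.1.le
    rw [e, le_div_iff₀ (by linarith)] at this
    linarith
  · simp
  · obtain ⟨c, hc, e⟩ := exists_hasDerivAt_eq_slope F F' h
      (fun t _ => (hF t).continuousAt.continuousWithinAt) fun t _ => hF t
    have : F' c ≤ F' x := hm ⟨hy.1.trans hc.1.le, hc.2.le.trans hx.2⟩ hx hc.2.le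
    rw [e, div_le_iff₀ (by linarith)] at this
    linarith

theorem monotoneOn_of_hasDerivAt {F F' : ℝ → ℝ} {a b : ℝ} (hF : ∀ t, HasDerivAt F (F' t) t)
    (h : ∀ t ∈ Set.Icc a b, 0 ≤ F' t) : MonotoneOn F (Set.Icc a b) := by
  refine monotoneOn_of_deriv_nonneg (convex_Icc a b)
    (fun t _ => (hF t).continuousAt.continuousWithinAt)
    (fun t _ => (hF t).differentiableAt.differentiableWithinAt) fun t ht => ?_
  rw [(hF t).deriv]
  exact h t (interior_subset ht)

/-- A convex function on `[0, 1]` with second derivative at least `A` near `q₀` grows at least like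
a Huber function: beyond the tangent at `q₀`, it grows on either side at least like every line
that touches the parabola `A / 2 * x ^ 2` at a point `s` of the window. -/
theorem huber_growth {G G' G'' : ℝ → ℝ} {A w q₀ s q : ℝ}
    (hG : ∀ t, HasDerivAt G (G' t) t) (hG' : ∀ t, HasDerivAt G' (G'' t) t)
    (h0 : ∀ t ∈ Set.Icc (0 : ℝ) 1, 0 ≤ G'' t)
    (hA : ∀ t ∈ Set.Icc (0 : ℝ) 1, |t - q₀| ≤ w → A ≤ G'' t) (hA0 : 0 ≤ A)
    (hq₀ : q₀ ∈ Set.Icc (0 : ℝ) 1) (hq : q ∈ Set.Icc (0 : ℝ) 1) (hs : 0 ≤ s) (hsw : s ≤ w) :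
    G q₀ + G' q₀ * (q - q₀) + A * (s * |q - q₀| - s ^ 2 / 2) ≤ G q := by
  have hm : MonotoneOn G' (Set.Icc 0 1) := monotoneOn_of_hasDerivAt hG' h0
  -- on the window, `G` minus the parabola is still convex
  set K : ℝ → ℝ := fun t => G t - A / 2 * (t - q₀) ^ 2
  set K' : ℝ → ℝ := fun t => G' t - A * (t - q₀)
  have hK : ∀ t, HasDerivAt K (K' t) t := fun t => by
    have h := (hG t).sub ((((hasDerivAt_id t).sub_const q₀).pow 2).const_mul (A / 2))
    refine HasDerivAt.congr_deriv h ?_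
    simp only [K', id]; push_cast; ring
  have hK' : ∀ t, HasDerivAt K' (G'' t - A) t := fun t => by
    have h := (hG' t).sub ((((hasDerivAt_id t).sub_const q₀)).const_mul A)
    refine HasDerivAt.congr_deriv h ?_
    ring
  have near : ∀ t ∈ Set.Icc (0 : ℝ) 1, |t - q₀| ≤ s →
      G q₀ + G' q₀ * (t - q₀) + A / 2 * (t - q₀) ^ 2 ≤ G t ∧
      (q₀ ≤ t → G' q₀ + A * (t - q₀) ≤ G' t) ∧ (t ≤ q₀ → G' t ≤ G' q₀ + A * (t - q₀)) := by
    intro t ht hts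
    have hmono : MonotoneOn K' (Set.Icc (max 0 (q₀ - s)) (min 1 (q₀ + s))) := by
      refine monotoneOn_of_hasDerivAt hK' fun u hu => ?_
      have h1 := max_le_iff.1 hu.1
      have h2 := le_min_iff.1 hu.2
      have := hA u ⟨h1.1, h2.1⟩ (abs_le.2 ⟨by linarith, by linarith⟩)
      linarith
    have hts' := abs_le.1 hts
    have mq : q₀ ∈ Set.Icc (max 0 (q₀ - s)) (min 1 (q₀ + s)) :=
      ⟨max_le hq₀.1 (by linarith), le_min hq₀.2 (by linarith)⟩
    have mt : t ∈ Set.Icc (max 0 (q₀ - s)) (min 1 (q₀ + s)) :=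
      ⟨max_le ht.1 (by linarith), le_min ht.2 (by linarith)⟩
    have h1 := tangent_le hK hmono mq mt
    simp only [K, K'] at h1
    refine ⟨by nlinarith, fun h => ?_, fun h => ?_⟩
    · have := hmono mq mt h
      simp only [K'] at this
      linarith
    · have := hmono mt mq h
      simp only [K'] at this
      linarith
  rcases le_total |q - q₀| s with h | h
  · have := (near q hq h).1
    have e : (q - q₀) ^ 2 = |q - q₀| ^ 2 := (sq_abs _).symm
    nlinarith [mul_nonneg hA0 (sq_nonneg (s - |q - q₀|))]
  · rcases le_total q₀ q with hle | hle
    · rw [abs_of_nonneg (sub_nonneg.2 hle)] at h ⊢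
      have mr : q₀ + s ∈ Set.Icc (0 : ℝ) 1 := ⟨by linarith [hq₀.1], by linarith [hq.2]⟩
      obtain ⟨h1, h2, -⟩ := near (q₀ + s) mr (by rw [add_sub_cancel_left, abs_of_nonneg hs])
      have h3 := tangent_le hG hm mr hq
      have h4 := h2 (by linarith)
      have h5 : (G' q₀ + A * (q₀ + s - q₀)) * (q - (q₀ + s)) ≤ G' (q₀ + s) * (q - (q₀ + s)) :=
        mul_le_mul_of_nonneg_right h4 (by linarith)
      nlinarith
    · rw [abs_of_nonpos (sub_nonpos.2 hle)] at h ⊢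
      have mr : q₀ - s ∈ Set.Icc (0 : ℝ) 1 := ⟨by linarith [hq.1], by linarith [hq₀.2]⟩
      obtain ⟨h1, -, h2⟩ := near (q₀ - s) mr
        (by rw [show q₀ - s - q₀ = -s by ring, abs_neg, abs_of_nonneg hs])
      have h3 := tangent_le hG hm mr hq
      have h4 := h2 (by linarith)
      have h5 : (G' q₀ + A * (q₀ - s - q₀)) * (q - (q₀ - s)) ≤ G' (q₀ - s) * (q - (q₀ - s)) :=
        mul_le_mul_of_nonpos_right h4 (by linarith)
      nlinarith

/-! ### The clipped statistic -/

/-- The number `x` clipped to `[-R, R]`. -/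
noncomputable def clip (R x : ℝ) : ℝ := max (-R) (min R x)

theorem clip_mono (R : ℝ) : Monotone (clip R) := fun _ _ h =>
  max_le_max le_rfl (min_le_min le_rfl h)

theorem abs_clip_le {R : ℝ} (hR : 0 ≤ R) (x : ℝ) : |clip R x| ≤ R :=
  abs_le.2 ⟨le_max_left _ _, max_le (by linarith) (min_le_left _ _)⟩

theorem clip_of_abs_le {R x : ℝ} (h : |x| ≤ R) : clip R x = x := by
  rw [clip, min_eq_right (abs_le.1 h).2, max_eq_right (abs_le.1 h).1]

theorem clip_sq_le {R : ℝ} (hR : 0 ≤ R) (x : ℝ) : clip R x ^ 2 ≤ min (R ^ 2) (x ^ 2) := by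
  refine le_min (sq_le_sq' (abs_le.1 (abs_clip_le hR x)).1 (abs_le.1 (abs_clip_le hR x)).2) ?_
  rw [sq_le_sq]
  unfold clip
  rcases le_total 0 x with h | h
  · rw [max_eq_right (le_trans (by linarith) (le_min hR h)), abs_of_nonneg (le_min hR h),
      abs_of_nonneg h]
    exact min_le_right _ _
  · rw [min_eq_right (h.trans hR), abs_of_nonpos (max_le (by linarith) h), abs_of_nonpos h]
    linarith [le_max_right (-R) x]

/-- The cell function of the statistic: the discrete primitive of the clipped deviation of a count
from `lam`. It is convex, quadratic near `lam` and of slope at most `R`. -/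
noncomputable def cellFun (lam R : ℝ) (t : ℕ) : ℝ :=
  ∑ j ∈ Finset.range t, clip R ((j : ℝ) - lam)

theorem cellFun_succ_sub (lam R : ℝ) (t : ℕ) :
    cellFun lam R (t + 1) - cellFun lam R t = clip R ((t : ℝ) - lam) := by
  simp [cellFun, Finset.sum_range_succ]

/-- Inside the window, the expected second difference of the cell function is at least `1 / 2`, by
Chebyshev's inequality for the binomial distribution. -/
theorem half_le_binE_diff {n : ℕ} {q lam R : ℝ} (h0 : 0 ≤ q) (h1 : q ≤ 1) (hl : 0 ≤ lam)
    (hR : R = 16 * √(1 + lam)) (hq : |((n : ℝ) + 2) * q - lam| ≤ R / 4) :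
    1 / 2 ≤ binE n q
      fun j => clip R (((j + 1 : ℕ) : ℝ) - lam) - clip R ((j : ℝ) - lam) := by
  have hs1 : 1 ≤ √(1 + lam) := Real.one_le_sqrt.2 (by linarith)
  have hsq : √(1 + lam) ^ 2 = 1 + lam := Real.sq_sqrt (by linarith)
  have hR16 : 16 ≤ R := by linarith
  have hq' := abs_le.1 hq
  set mu := (n : ℝ) * q
  have key : ∀ j : ℕ, 1 + (-(4 / R ^ 2)) * ((j : ℝ) - mu) ^ 2 ≤
      clip R (((j + 1 : ℕ) : ℝ) - lam) - clip R ((j : ℝ) - lam) := by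
    intro j
    have hR2 : 0 < R ^ 2 := by positivity
    rcases le_total |(j : ℝ) - mu| (R / 2) with h | h
    · have h' := abs_le.1 h
      have e1 : |((j + 1 : ℕ) : ℝ) - lam| ≤ R := by
        push_cast
        exact abs_le.2 ⟨by nlinarith, by nlinarith⟩
      have e2 : |(j : ℝ) - lam| ≤ R := abs_le.2 ⟨by nlinarith, by nlinarith⟩
      rw [clip_of_abs_le e1, clip_of_abs_le e2]
      have : 0 ≤ 4 / R ^ 2 * ((j : ℝ) - mu) ^ 2 := by positivity
      push_cast
      linarith
    · have : (R / 2) ^ 2 ≤ ((j : ℝ) - mu) ^ 2 := by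
        rw [← sq_abs ((j : ℝ) - mu)]
        exact pow_le_pow_left₀ (by linarith) h 2
      have h2 : 1 ≤ 4 / R ^ 2 * ((j : ℝ) - mu) ^ 2 := by
        rw [div_mul_eq_mul_div, le_div_iff₀ hR2]
        linarith
      have h3 : clip R ((j : ℝ) - lam) ≤ clip R (((j + 1 : ℕ) : ℝ) - lam) :=
        clip_mono R (by push_cast; linarith)
      linarith
  refine le_trans ?_ (binE_mono n h0 h1 key)
  rw [binE_add, binE_const, binE_const_mul, binE_sq_sub, sub_self]
  have hv : mu * (1 - q) ≤ lam + R / 4 := by nlinarith [mul_nonneg (Nat.cast_nonneg (α := ℝ) n) h0]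
  have : 4 / R ^ 2 * (mu * (1 - q) + 0 ^ 2) ≤ 1 / 2 := by
    rw [div_mul_eq_mul_div, div_le_iff₀ (by positivity)]
    rw [hR] at hv ⊢
    nlinarith
  linarith

/-- The mean of the cell function grows at least like a Huber function around the success
probability `q₀` at which the mean count is `lam`. -/
theorem cellFun_growth {n : ℕ} {q q₀ s lam R : ℝ} (hq₀ : q₀ ∈ Set.Icc (0 : ℝ) 1)
    (hq : q ∈ Set.Icc (0 : ℝ) 1) (hl : lam = ((n : ℝ) + 2) * q₀)
    (hR : R = 16 * √(1 + lam)) (hs : 0 ≤ s) (hsw : ((n : ℝ) + 2) * s ≤ R / 4) :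
    binE (n + 2) q₀ (cellFun lam R) +
        ((n : ℝ) + 2) * binE (n + 1) q₀ (fun j => clip R ((j : ℝ) - lam)) * (q - q₀) +
        ((n : ℝ) + 2) ^ 2 / 4 * (s * |q - q₀| - s ^ 2 / 2) ≤ binE (n + 2) q (cellFun lam R) := by
  have hl0 : 0 ≤ lam := by rw [hl]; have := hq₀.1; positivity
  have hG : ∀ t, HasDerivAt (fun t => binE (n + 2) t (cellFun lam R))
      (((n : ℝ) + 2) * binE (n + 1) t (fun j => clip R ((j : ℝ) - lam))) t := fun t => by
    have h := hasDerivAt_binE (n + 1) t (cellFun lam R)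
    simp only [cellFun_succ_sub] at h
    convert h using 1
    push_cast; ring
  have hG' : ∀ t, HasDerivAt
      (fun t => ((n : ℝ) + 2) * binE (n + 1) t (fun j => clip R ((j : ℝ) - lam)))
      (((n : ℝ) + 2) * (((n : ℝ) + 1) *
        binE n t (fun j => clip R (((j + 1 : ℕ) : ℝ) - lam) - clip R ((j : ℝ) - lam)))) t :=
    fun t => (hasDerivAt_binE n t _).const_mul _
  have pos : 0 < (n : ℝ) + 2 := by positivity
  refine huber_growth (w := R / 4 / ((n : ℝ) + 2)) hG hG' (fun t ht => ?_) (fun t ht htw => ?_)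
    (by positivity) hq₀ hq hs (by rw [le_div_iff₀ pos]; linarith)
  · have : 0 ≤ binE n t
        (fun j => clip R (((j + 1 : ℕ) : ℝ) - lam) - clip R ((j : ℝ) - lam)) := by
      rw [← binE_const n t 0]
      exact binE_mono n ht.1 ht.2 fun j => sub_nonneg.2 (clip_mono R (by push_cast; linarith))
    positivity
  · have hw : |((n : ℝ) + 2) * t - lam| ≤ R / 4 := by
      rw [hl, ← mul_sub, abs_mul, abs_of_pos pos]
      rw [le_div_iff₀ pos] at htw
      linarith
    have := half_le_binE_diff ht.1 ht.2 hl0 hR hw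
    have hn : (0 : ℝ) ≤ n := n.cast_nonneg
    nlinarith [mul_le_mul_of_nonneg_left this (show 0 ≤ ((n : ℝ) + 2) * ((n : ℝ) + 1) by positivity)]

/-! ### Expectations over independent samples from a finite distribution -/

section ProdE

variable {α : Type*} [Fintype α]

/-- The expectation of `h` over `n` independent samples from the weights `p`. -/
def prodE (p : α → ℝ) (n : ℕ) (h : (Fin n → α) → ℝ) : ℝ :=
  ∑ X : Fin n → α, (∏ t, p (X t)) * h X

theorem prodE_insertNth (p : α → ℝ) {n : ℕ} (t : Fin (n + 1)) (h : (Fin (n + 1) → α) → ℝ) :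
    prodE p (n + 1) h = ∑ a, p a * prodE p n fun Y => h (t.insertNth a Y) := by
  rw [prodE, ← (Fin.insertNthEquiv (fun _ => α) t).sum_comp, Fintype.sum_prod_type]
  refine Finset.sum_congr rfl fun a _ => ?_
  rw [prodE, Finset.mul_sum]
  refine Finset.sum_congr rfl fun Y _ => ?_
  rw [← mul_assoc, Fin.prod_univ_succAbove _ t]
  simp only [Fin.insertNthEquiv_apply, Fin.insertNth_apply_same, Fin.insertNth_apply_succAbove]
  rfl

theorem prodE_add (p : α → ℝ) (n : ℕ) (h h' : (Fin n → α) → ℝ) :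
    prodE p n (fun X => h X + h' X) = prodE p n h + prodE p n h' := by
  simp [prodE, mul_add, Finset.sum_add_distrib]

theorem prodE_const_mul (p : α → ℝ) (n : ℕ) (c : ℝ) (h : (Fin n → α) → ℝ) :
    prodE p n (fun X => c * h X) = c * prodE p n h := by
  simp only [prodE, Finset.mul_sum]
  exact Finset.sum_congr rfl fun X _ => by ring

theorem prodE_sum {ι : Type*} (s : Finset ι) (p : α → ℝ) (n : ℕ) (h : ι → (Fin n → α) → ℝ) :
    prodE p n (fun X => ∑ i ∈ s, h i X) = ∑ i ∈ s, prodE p n (h i) := by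
  simp only [prodE, Finset.mul_sum]
  exact Finset.sum_comm

theorem prodE_mono {p : α → ℝ} (hp : ∀ a, 0 ≤ p a) (n : ℕ) {h h' : (Fin n → α) → ℝ}
    (hh : ∀ X, h X ≤ h' X) : prodE p n h ≤ prodE p n h' :=
  Finset.sum_le_sum fun X _ =>
    mul_le_mul_of_nonneg_left (hh X) (Finset.prod_nonneg fun _ _ => hp _)

theorem prodE_const {p : α → ℝ} (hp : ∑ a, p a = 1) (n : ℕ) (c : ℝ) :
    prodE p n (fun _ => c) = c := by
  induction n with
  | zero => simp [prodE]
  | succ n ih => rw [prodE_insertNth p 0]; simp only [ih, ← Finset.sum_mul, hp, one_mul]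

/-- The mean square deviation is least about the mean. -/
theorem prodE_sub_sq {p : α → ℝ} (hp : ∑ a, p a = 1) (n : ℕ) (h : (Fin n → α) → ℝ) (c : ℝ) :
    prodE p n (fun X => (h X - c) ^ 2) =
      prodE p n (fun X => (h X - prodE p n h) ^ 2) + (prodE p n h - c) ^ 2 := by
  have key : ∀ c : ℝ, prodE p n (fun X => (h X - c) ^ 2) =
      prodE p n (fun X => h X ^ 2) + (-2 * c) * prodE p n h + c ^ 2 := fun c => by
    conv_rhs => rw [← prodE_const hp n (c ^ 2), ← prodE_const_mul, ← prodE_add, ← prodE_add]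
    congr 1; funext X; ring
  rw [key, key]; ring

theorem sq_prodE_le {p : α → ℝ} (hp0 : ∀ a, 0 ≤ p a) (hp : ∑ a, p a = 1) (n : ℕ)
    (h : (Fin n → α) → ℝ) : prodE p n h ^ 2 ≤ prodE p n (fun X => h X ^ 2) := by
  have h1 := prodE_sub_sq hp n h 0
  have h2 : 0 ≤ prodE p n (fun X => (h X - prodE p n h) ^ 2) := by
    rw [← prodE_const hp n 0]; exact prodE_mono hp0 n fun X => sq_nonneg _
  simp only [sub_zero] at h1
  linarith

/-- The Efron–Stein inequality: the variance is at most the sum, over the coordinates, of the mean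
square distance to any function that ignores the coordinate. -/
theorem efronStein {p : α → ℝ} (hp0 : ∀ a, 0 ≤ p a) (hp : ∑ a, p a = 1) {n : ℕ}
    (h : (Fin (n + 1) → α) → ℝ) (φ : Fin (n + 1) → (Fin n → α) → ℝ) :
    prodE p (n + 1) (fun X => (h X - prodE p (n + 1) h) ^ 2) ≤
      ∑ t, prodE p (n + 1) fun X => (h X - φ t (t.removeNth X)) ^ 2 := by
  induction n with
  | zero =>
    have := prodE_sub_sq hp 1 h (φ 0 Fin.elim0)
    have e : ∀ X : Fin 1 → α, (Fin.removeNth 0 X : Fin 0 → α) = Fin.elim0 := fun X =>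
      Subsingleton.elim _ _
    rw [Fin.sum_univ_one]
    simp only [e]
    rw [this]
    nlinarith [sq_nonneg (prodE p 1 h - φ 0 Fin.elim0)]
  | succ n ih =>
    set m := prodE p (n + 2) h
    set H : α → ℝ := fun a => prodE p (n + 1) fun Y => h ((0 : Fin (n + 2)).insertNth a Y)
    -- the part of the variance that comes from the coordinates other than the first
    have e1 : prodE p (n + 2) (fun X => (h X - m) ^ 2) =
        (∑ a, p a * prodE p (n + 1)
          fun Y => (h ((0 : Fin (n + 2)).insertNth a Y) - H a) ^ 2) + ∑ a, p a * (H a - m) ^ 2 := by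
      rw [prodE_insertNth p 0, ← Finset.sum_add_distrib]
      refine Finset.sum_congr rfl fun a _ => ?_
      rw [prodE_sub_sq hp (n + 1), mul_add]
    have hm : m = ∑ a, p a * H a := prodE_insertNth p 0 h
    -- the mean over the first coordinate minimizes the mean square distance
    have e2 : ∑ a, p a * (H a - m) ^ 2 ≤
        prodE p (n + 2) fun X => (h X - φ 0 (Fin.removeNth 0 X)) ^ 2 := by
      set c := prodE p (n + 1) (φ 0)
      have s1 : ∑ a, p a * (H a - m) ^ 2 ≤ ∑ a, p a * (H a - c) ^ 2 := by
        have k : ∀ c : ℝ, ∑ a, p a * (H a - c) ^ 2 = ∑ a, p a * H a ^ 2 - 2 * c * m + c ^ 2 := by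
          intro c
          have : c ^ 2 = ∑ a, p a * c ^ 2 := by rw [← Finset.sum_mul, hp, one_mul]
          rw [this, hm, Finset.mul_sum, ← Finset.sum_sub_distrib, ← Finset.sum_add_distrib]
          exact Finset.sum_congr rfl fun a _ => by ring
        rw [k, k]; nlinarith [sq_nonneg (m - c)]
      refine s1.trans ?_
      rw [prodE_insertNth p 0]
      refine Finset.sum_le_sum fun a _ => mul_le_mul_of_nonneg_left ?_ (hp0 a)
      simp only [Fin.removeNth_insertNth]
      have : H a - c = prodE p (n + 1)
          fun Y => h ((0 : Fin (n + 2)).insertNth a Y) + (-1) * φ 0 Y := by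
        rw [prodE_add, prodE_const_mul]; ring
      rw [this]
      refine (sq_prodE_le hp0 hp _ _).trans (le_of_eq ?_)
      congr 1; funext Y; ring
    have e3 : (∑ a, p a * prodE p (n + 1)
          fun Y => (h ((0 : Fin (n + 2)).insertNth a Y) - H a) ^ 2) ≤
        ∑ t : Fin (n + 1), prodE p (n + 2)
          fun X => (h X - φ t.succ (t.succ.removeNth X)) ^ 2 := by
      calc _ ≤ ∑ a, p a * ∑ t : Fin (n + 1), prodE p (n + 1) fun Y =>
            (h ((0 : Fin (n + 2)).insertNth a Y) - φ t.succ (Fin.cons a (t.removeNth Y))) ^ 2 :=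
            Finset.sum_le_sum fun a _ => mul_le_mul_of_nonneg_left
              (ih (fun Y => h ((0 : Fin (n + 2)).insertNth a Y))
                (fun t Z => φ t.succ (Fin.cons a Z))) (hp0 a)
        _ = _ := by
            simp only [Finset.mul_sum]
            rw [Finset.sum_comm]
            refine Finset.sum_congr rfl fun t _ => ?_
            rw [prodE_insertNth p 0]
            refine Finset.sum_congr rfl fun a _ => ?_
            have : ∀ Y : Fin (n + 1) → α,
                (t.succ.removeNth ((0 : Fin (n + 2)).insertNth a Y : Fin (n + 2) → α) :
                  Fin (n + 1) → α) =
                (Fin.cons a (t.removeNth Y) : Fin (n + 1) → α) := by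
              intro Y
              funext i
              refine Fin.cases ?_ (fun i => ?_) i
              · simp [Fin.removeNth]
              · simp [Fin.removeNth, Fin.succ_succAbove_succ]
            simp only [this]
    rw [e1, Fin.sum_univ_succ]
    linarith

theorem chebyshev_prodE {p : α → ℝ} (hp0 : ∀ a, 0 ≤ p a) {n : ℕ}
    (h : (Fin n → α) → ℝ) (m : ℝ) {g : ℝ} (hg : 0 < g) (A : Set (Fin n → α))
    (hA : ∀ X ∈ A, g ≤ |h X - m|) :
    prodE p n (A.indicator 1) ≤ prodE p n (fun X => (h X - m) ^ 2) / g ^ 2 := by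
  rw [div_eq_inv_mul, ← prodE_const_mul]
  refine prodE_mono hp0 n fun X => ?_
  by_cases hX : X ∈ A
  · rw [Set.indicator_of_mem hX, Pi.one_apply, ← div_eq_inv_mul, le_div_iff₀ (by positivity), one_mul,
      ← sq_abs (h X - m)]
    exact pow_le_pow_left₀ hg.le (hA X hX) 2
  · rw [Set.indicator_of_notMem hX]; positivity

/-! ### The statistic of a histogram -/

/-- The number of samples in the cell `x`. -/
def count {β : Type*} [DecidableEq β] {n : ℕ} (X : Fin n → β) (x : β) : ℕ :=
  ∑ t, if X t = x then 1 else 0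

theorem count_insertNth {β : Type*} [DecidableEq β] {n : ℕ} (t : Fin (n + 1)) (a : β)
    (Y : Fin n → β) (x : β) :
    count (t.insertNth a Y) x = (if a = x then 1 else 0) + count Y x := by
  simp [count, Fin.sum_univ_succAbove _ t]

variable [DecidableEq α]

/-- Every count is binomially distributed. -/
theorem prodE_count {p : α → ℝ} (hp : ∑ a, p a = 1) (n : ℕ) (x : α) (f : ℕ → ℝ) :
    prodE p n (fun X => f (count X x)) = binE n (p x) f := by
  induction n generalizing f with
  | zero => simp [prodE, binE, count]
  | succ n ih =>
    rw [prodE_insertNth p 0, ← Finset.add_sum_erase _ _ (Finset.mem_univ x)]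
    have : ∀ a ∈ Finset.univ.erase x,
        p a * (prodE p n fun Y => f (count ((0 : Fin (n + 1)).insertNth a Y) x)) =
          p a * binE n (p x) f := by
      intro a ha
      simp only [count_insertNth, if_neg (Finset.ne_of_mem_erase ha), zero_add, ih]
    rw [Finset.sum_congr rfl this, ← Finset.sum_mul]
    have s : ∑ a ∈ Finset.univ.erase x, p a = 1 - p x := by
      rw [← hp, ← Finset.add_sum_erase _ _ (Finset.mem_univ x)]; ring
    rw [s]
    simp only [count_insertNth, if_true, add_comm 1]
    rw [ih (fun j => f (j + 1)), binE]
    ring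

/-- The statistic: the sum of the cell function over the histogram. -/
noncomputable def stat (lam R : ℝ) {n : ℕ} (X : Fin n → α) : ℝ := ∑ x, cellFun lam R (count X x)

/-- One more sample adds the clipped deviation of the earlier count of its cell. Hence the statistic
can be accumulated sample by sample, and one sample has a bounded influence on it. -/
theorem stat_insertNth (lam R : ℝ) {n : ℕ} (t : Fin (n + 1)) (a : α) (Y : Fin n → α) :
    stat lam R (t.insertNth a Y) = stat lam R Y + clip R ((count Y a : ℝ) - lam) := by
  rw [← sub_eq_iff_eq_add', stat, stat, ← Finset.sum_sub_distrib, Finset.sum_eq_single a]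
  · rw [count_insertNth, if_pos rfl, add_comm 1, cellFun_succ_sub]
  · intro x _ hx
    rw [count_insertNth, if_neg hx.symm, zero_add, sub_self]
  · simp

/-- Changing one sample changes the statistic by at most `2 * R`. -/
theorem abs_stat_sub_le {lam R : ℝ} (hR : 0 ≤ R) {n : ℕ} {X X' : Fin n → α} (j : Fin n)
    (h : ∀ i, i ≠ j → X i = X' i) : |stat lam R X - stat lam R X'| ≤ 2 * R := by
  obtain _ | n := n
  · exact j.elim0
  have e : j.removeNth X = j.removeNth X' := funext fun i => h _ (Fin.succAbove_ne j i)
  rw [← Fin.insertNth_self_removeNth j X, ← Fin.insertNth_self_removeNth j X', stat_insertNth,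
    stat_insertNth, e]
  have h1 := abs_le.1 (abs_clip_le hR ((count (j.removeNth X') (X j) : ℝ) - lam))
  have h2 := abs_le.1 (abs_clip_le hR ((count (j.removeNth X') (X' j) : ℝ) - lam))
  exact abs_le.2 ⟨by linarith, by linarith⟩

theorem prodE_stat {p : α → ℝ} (hp : ∑ a, p a = 1) (lam R : ℝ) (n : ℕ) :
    prodE p n (stat lam R) = ∑ x, binE n (p x) (cellFun lam R) := by
  unfold stat
  rw [prodE_sum]
  exact Finset.sum_congr rfl fun x _ => prodE_count hp n x _

/-- The Efron–Stein bound, where each sample is compared with its removal. -/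
theorem variance_stat_le {p : α → ℝ} (hp0 : ∀ a, 0 ≤ p a) (hp : ∑ a, p a = 1) (lam R : ℝ) (n : ℕ) :
    prodE p (n + 1) (fun X => (stat lam R X - prodE p (n + 1) (stat lam R)) ^ 2) ≤
      ((n : ℝ) + 1) * ∑ a, p a * binE n (p a) fun j => clip R ((j : ℝ) - lam) ^ 2 := by
  refine (efronStein hp0 hp (stat lam R) fun _ Y => stat lam R Y).trans (le_of_eq ?_)
  have : ∀ t : Fin (n + 1), (prodE p (n + 1) fun X =>
      (stat lam R X - stat lam R (t.removeNth X)) ^ 2) =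
      ∑ a, p a * binE n (p a) fun j => clip R ((j : ℝ) - lam) ^ 2 := by
    intro t
    rw [prodE_insertNth p t]
    refine Finset.sum_congr rfl fun a _ => ?_
    simp only [Fin.removeNth_insertNth, stat_insertNth, add_sub_cancel_left]
    rw [prodE_count hp n a (fun j => clip R ((j : ℝ) - lam) ^ 2)]
  simp [this]

end ProdE

/-! ### Mean gap and variance of the statistic -/

section Gap

variable {α : Type*} [Fintype α]

theorem sum_uniform [Nonempty α] : ∑ _a : α, 1 / (Fintype.card α : ℝ) = 1 := by
  have : (Fintype.card α : ℝ) ≠ 0 := Nat.cast_ne_zero.2 Fintype.card_ne_zero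
  simp [this]

variable [DecidableEq α]

/-- The gap between the mean of the statistic under `p` and under the uniform weights. -/
noncomputable def gap (p : α → ℝ) (lam R : ℝ) (n : ℕ) : ℝ :=
  prodE p n (stat lam R) - prodE (fun _ : α => 1 / (Fintype.card α : ℝ)) n (stat lam R)

/-- The growth of the cells adds up to a lower bound for the gap: the linear terms cancel because
both weights have total mass one. The touching points `s` are still free. -/
theorem le_gap [Nonempty α] {p : α → ℝ} (hp0 : ∀ a, 0 ≤ p a) (hp : ∑ a, p a = 1) {lam R : ℝ} {n : ℕ}
    (hn : 2 ≤ n) (hl : lam = n / Fintype.card α) (hR : R = 16 * √(1 + lam)) (s : α → ℝ)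
    (hs : ∀ a, 0 ≤ s a) (hsR : ∀ a, n * s a ≤ R / 4) :
    (n : ℝ) ^ 2 / 4 * ∑ a, (s a * |p a - 1 / (Fintype.card α : ℝ)| - s a ^ 2 / 2) ≤
      gap p lam R n := by
  obtain ⟨k, rfl⟩ := Nat.exists_eq_add_of_le' hn
  have hM : 0 < (Fintype.card α : ℝ) := Nat.cast_pos.2 Fintype.card_pos
  set u : ℝ := 1 / (Fintype.card α : ℝ) with hu
  have hu1 : u ∈ Set.Icc (0 : ℝ) 1 :=
    ⟨by positivity, by rw [hu, div_le_one hM]; exact_mod_cast Fintype.card_pos⟩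
  have hp1 : ∀ a, p a ∈ Set.Icc (0 : ℝ) 1 := fun a =>
    ⟨hp0 a, hp ▸ Finset.single_le_sum (fun a _ => hp0 a) (Finset.mem_univ a)⟩
  push_cast at hl hsR ⊢
  have key := fun a => cellFun_growth (n := k) hu1 (hp1 a) (by rw [hl, hu]; ring) hR (hs a) (hsR a)
  have hsum := Finset.sum_le_sum fun a (_ : a ∈ Finset.univ) => key a
  rw [gap, prodE_stat hp, prodE_stat sum_uniform]
  have hz : ∑ a, (p a - u) = 0 := by rw [Finset.sum_sub_distrib, hp, sum_uniform, sub_self]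
  rw [Finset.sum_add_distrib, Finset.sum_add_distrib, ← Finset.mul_sum, ← Finset.mul_sum, hz,
    mul_zero, add_zero] at hsum
  linarith

/-- The gap of weights at `ℓ¹` distance `σ` from the uniform ones, by the same touching point
`σ / card α` in every cell. -/
theorem le_gap_of_far [Nonempty α] {p : α → ℝ} (hp0 : ∀ a, 0 ≤ p a) (hp : ∑ a, p a = 1)
    {lam R σ : ℝ} {n : ℕ} (hn : 2 ≤ n) (hl : lam = n / Fintype.card α)
    (hR : R = 16 * √(1 + lam)) (hσ : 0 ≤ σ)
    (hfar : σ ≤ ∑ a, |p a - 1 / (Fintype.card α : ℝ)|) (hσR : lam * σ ≤ R / 4) :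
    (n : ℝ) ^ 2 * σ ^ 2 / (8 * Fintype.card α) ≤ gap p lam R n := by
  have hM : 0 < (Fintype.card α : ℝ) := Nat.cast_pos.2 Fintype.card_pos
  refine le_trans ?_ (le_gap hp0 hp hn hl hR (fun _ => σ / Fintype.card α) (fun _ => by positivity)
    fun _ => by rw [hl] at hσR; convert hσR using 1; ring)
  rw [Finset.sum_sub_distrib, ← Finset.mul_sum, Finset.sum_const, Finset.card_univ, nsmul_eq_mul]
  have h1 : σ / Fintype.card α * σ ≤
      σ / Fintype.card α * ∑ a, |p a - 1 / (Fintype.card α : ℝ)| := by gcongr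
  have h2 : (n : ℝ) ^ 2 * σ ^ 2 / (8 * Fintype.card α) = (n : ℝ) ^ 2 / 4 *
      (σ / Fintype.card α * σ - Fintype.card α * ((σ / Fintype.card α) ^ 2 / 2)) := by
    field_simp; ring
  rw [h2]
  gcongr

/-- The gap dominates the Huber functions of all deviations, by the best touching point in every
cell. This controls the variance under weights that are far from uniform. -/
theorem sum_le_gap [Nonempty α] {p : α → ℝ} (hp0 : ∀ a, 0 ≤ p a) (hp : ∑ a, p a = 1) {lam R : ℝ}
    {n : ℕ} (hn : 2 ≤ n) (hl : lam = n / Fintype.card α) (hR : R = 16 * √(1 + lam)) :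
    ∑ a, n * |p a - 1 / (Fintype.card α : ℝ)| * min (n * |p a - 1 / (Fintype.card α : ℝ)|) (R / 4) ≤
      8 * gap p lam R n := by
  have hn0 : 0 < (n : ℝ) := by positivity
  have hR0 : 0 ≤ R := by rw [hR]; positivity
  have h := le_gap hp0 hp hn hl hR
    (fun a => min |p a - 1 / (Fintype.card α : ℝ)| (R / 4 / n)) (fun a => by positivity)
    fun a => by
      calc (n : ℝ) * min |p a - 1 / (Fintype.card α : ℝ)| (R / 4 / n) ≤ n * (R / 4 / n) := by
            gcongr; exact min_le_right _ _
        _ = R / 4 := by field_simp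
  have h2 : ∑ a, n * |p a - 1 / (Fintype.card α : ℝ)| *
      min (n * |p a - 1 / (Fintype.card α : ℝ)|) (R / 4) ≤ 8 * ((n : ℝ) ^ 2 / 4 *
        ∑ a, (min |p a - 1 / (Fintype.card α : ℝ)| (R / 4 / n) * |p a - 1 / (Fintype.card α : ℝ)| -
          min |p a - 1 / (Fintype.card α : ℝ)| (R / 4 / n) ^ 2 / 2)) := by
    rw [Finset.mul_sum, Finset.mul_sum]
    refine Finset.sum_le_sum fun a _ => ?_
    set y := |p a - 1 / (Fintype.card α : ℝ)|
    have hy : 0 ≤ y := abs_nonneg _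
    have e : min (n * y) (R / 4) = n * min y (R / 4 / n) := by
      rw [mul_min_of_nonneg _ _ hn0.le]
      congr 1; field_simp
    rw [e]
    have h3 : min y (R / 4 / n) ≤ y := min_le_left _ _
    have h4 : 0 ≤ min y (R / 4 / n) := by positivity
    nlinarith [mul_nonneg (sq_nonneg (n : ℝ)) (mul_nonneg h4 (sub_nonneg.2 h3))]
  linarith

/-- The mean square of the increment in one cell, where `δ` is the deviation of the mean count. -/
theorem binE_clip_sq_le {n : ℕ} {q lam R δ : ℝ} (h0 : 0 ≤ q) (h1 : q ≤ 1) (hR : 0 ≤ R)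
    (hq : ((n : ℝ) + 1) * q = lam + δ) :
    binE n q (fun j => clip R ((j : ℝ) - lam) ^ 2) ≤
      min (R ^ 2) (3 * ((n : ℝ) + 1) * q + 2 * δ ^ 2) := by
  refine le_min ?_ ?_
  · rw [← binE_const n q (R ^ 2)]
    exact binE_mono n h0 h1 fun j => (clip_sq_le hR _).trans (min_le_left _ _)
  · refine (binE_mono n h0 h1 fun j => (clip_sq_le hR _).trans (min_le_right _ _)).trans ?_
    rw [binE_sq_sub]
    have e : (n : ℝ) * q - lam = δ - q := by linarith
    rw [e]
    have hn : (0 : ℝ) ≤ n * q := by positivity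
    nlinarith [sq_nonneg (δ + q), mul_nonneg hn h0]

theorem variance_uniform_le [Nonempty α] {lam R : ℝ} {n : ℕ} (hn : 1 ≤ n)
    (hl : lam = n / Fintype.card α) (hR : 0 ≤ R) :
    prodE (fun _ : α => 1 / (Fintype.card α : ℝ)) n (fun X =>
      (stat lam R X - prodE (fun _ : α => 1 / (Fintype.card α : ℝ)) n (stat lam R)) ^ 2) ≤
      3 * n * lam := by
  obtain ⟨k, rfl⟩ := Nat.exists_eq_add_of_le' hn
  have hM : 0 < (Fintype.card α : ℝ) := Nat.cast_pos.2 Fintype.card_pos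
  have h1 : 1 / (Fintype.card α : ℝ) ≤ 1 := by
    rw [div_le_one hM]; exact_mod_cast Fintype.card_pos
  refine (variance_stat_le (fun _ => by positivity) sum_uniform lam R k).trans ?_
  rw [← Finset.sum_mul, sum_uniform, one_mul]
  push_cast at hl ⊢
  have h := (binE_clip_sq_le (n := k) (q := 1 / (Fintype.card α : ℝ)) (lam := lam) (δ := 0)
    (by positivity) h1 hR (by rw [hl]; ring)).trans (min_le_right _ _)
  have e : 3 * ((k : ℝ) + 1) * (1 / (Fintype.card α : ℝ)) + 2 * 0 ^ 2 = 3 * lam := by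
    rw [hl]; ring
  rw [e] at h
  calc ((k : ℝ) + 1) * _ ≤ ((k : ℝ) + 1) * (3 * lam) := by gcongr
    _ = _ := by ring

/-- The contribution of one cell to the variance: `z` is its mean count, and `y` the deviation of
`z` from `lam`. -/
theorem cell_variance_le {lam R y z : ℝ} (hl : 0 ≤ lam) (hR : 16 ≤ R) (hy : 0 ≤ y) (hz : 0 ≤ z)
    (hzy : z ≤ lam + y) :
    z * min (R ^ 2) (3 * z + 2 * y ^ 2) ≤
      3 * lam ^ 2 + 6 * (lam * y) + (16 * lam + 4 * R) * (y * min y (R / 4)) := by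
  have h1 : z * min (R ^ 2) (3 * z + 2 * y ^ 2) ≤
      (lam + y) * min (R ^ 2) (3 * (lam + y) + 2 * y ^ 2) := by gcongr
  refine h1.trans ?_
  rcases le_total y (R / 4) with h | h
  · rw [min_eq_left h]
    have h2 : (lam + y) * min (R ^ 2) (3 * (lam + y) + 2 * y ^ 2) ≤
        (lam + y) * (3 * (lam + y) + 2 * y ^ 2) := by gcongr; exact min_le_right _ _
    have h3 : y * (y * y) ≤ R / 4 * (y * y) := by gcongr
    nlinarith [mul_nonneg hl (mul_nonneg hy hy), mul_nonneg (sub_nonneg.2 hR) (mul_nonneg hy hy)]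
  · rw [min_eq_right h]
    have h2 : (lam + y) * min (R ^ 2) (3 * (lam + y) + 2 * y ^ 2) ≤ (lam + y) * R ^ 2 := by
      gcongr; exact min_le_left _ _
    have h3 : lam * (R * R) ≤ lam * (R * (4 * y)) := by gcongr; linarith
    nlinarith [mul_nonneg hl hy, sq_nonneg lam]

/-- Under any weights the variance is bounded by a term of the same order as under the uniform ones,
plus a multiple of the gap. Hence it is small compared with the square of a large gap. -/
theorem variance_le_gap [Nonempty α] {p : α → ℝ} (hp0 : ∀ a, 0 ≤ p a) (hp : ∑ a, p a = 1)
    {lam R : ℝ} {n : ℕ} (hn : 2 ≤ n) (hl : lam = n / Fintype.card α) (hR : R = 16 * √(1 + lam)) :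
    prodE p n (fun X => (stat lam R X - prodE p n (stat lam R)) ^ 2) ≤
      15 * n * lam + (128 * lam + 32 * R) * gap p lam R n := by
  have hgap := sum_le_gap hp0 hp hn hl hR
  obtain ⟨k, rfl⟩ := Nat.exists_eq_add_of_le' (le_trans one_le_two hn)
  have hM : 0 < (Fintype.card α : ℝ) := Nat.cast_pos.2 Fintype.card_pos
  have hl0 : 0 ≤ lam := by rw [hl]; positivity
  have hR16 : 16 ≤ R := by
    have : 1 ≤ √(1 + lam) := Real.one_le_sqrt.2 (by linarith)
    linarith
  have hp1 : ∀ a, p a ≤ 1 := fun a =>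
    hp ▸ Finset.single_le_sum (fun a _ => hp0 a) (Finset.mem_univ a)
  refine (variance_stat_le hp0 hp lam R k).trans ?_
  push_cast at hl hgap ⊢
  set u : ℝ := 1 / (Fintype.card α : ℝ) with hu
  have hlu : lam = ((k : ℝ) + 1) * u := by rw [hl, hu]; ring
  set y : α → ℝ := fun a => ((k : ℝ) + 1) * |p a - u| with hy
  have hy0 : ∀ a, 0 ≤ y a := fun a => by positivity
  have key : ∀ a, ((k : ℝ) + 1) * (p a * binE k (p a) fun j => clip R ((j : ℝ) - lam) ^ 2) ≤
      3 * lam ^ 2 + 6 * (lam * y a) + (16 * lam + 4 * R) * (y a * min (y a) (R / 4)) := by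
    intro a
    have h1 := binE_clip_sq_le (n := k) (lam := lam) (δ := ((k : ℝ) + 1) * (p a - u)) (hp0 a)
      (hp1 a) (by linarith : 0 ≤ R) (by rw [hlu]; ring)
    have h2 : (((k : ℝ) + 1) * (p a - u)) ^ 2 = y a ^ 2 := by
      rw [hy]; simp only [mul_pow, sq_abs]
    rw [h2, mul_assoc 3] at h1
    have h3 : ((k : ℝ) + 1) * p a ≤ lam + y a := by
      rw [hlu, hy, ← mul_add]
      have := le_abs_self (p a - u)
      gcongr; linarith
    have hz : 0 ≤ ((k : ℝ) + 1) * p a := mul_nonneg (by positivity) (hp0 a)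
    rw [← mul_assoc]
    exact (mul_le_mul_of_nonneg_left h1 hz).trans (cell_variance_le hl0 hR16 (hy0 a) hz h3)
  rw [Finset.mul_sum]
  refine (Finset.sum_le_sum fun a _ => key a).trans ?_
  rw [Finset.sum_add_distrib, Finset.sum_add_distrib, ← Finset.mul_sum, ← Finset.mul_sum,
    ← Finset.mul_sum, Finset.sum_const, Finset.card_univ, nsmul_eq_mul]
  have e1 : (Fintype.card α : ℝ) * lam ^ 2 = ((k : ℝ) + 1) * lam := by
    rw [sq]; nth_rewrite 1 [hl]; field_simp
  have e2 : ∑ a, y a ≤ ((k : ℝ) + 1) * 2 := by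
    rw [hy, ← Finset.mul_sum]
    gcongr
    calc ∑ a, |p a - u| ≤ ∑ a, (p a + u) := Finset.sum_le_sum fun a _ => by
          refine abs_le.2 ⟨?_, ?_⟩ <;> have := hp0 a <;>
            have : 0 ≤ u := by positivity
          all_goals linarith
      _ = 2 := by rw [Finset.sum_add_distrib, hp, sum_uniform]; norm_num
  have e3 : (16 * lam + 4 * R) * ∑ a, y a * min (y a) (R / 4) ≤
      (16 * lam + 4 * R) * (8 * gap p lam R (k + 1)) := by gcongr
  have e4 : lam * ∑ a, y a ≤ lam * (((k : ℝ) + 1) * 2) := by gcongr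
  rw [e1, ← Finset.mul_sum Finset.univ fun a => y a * min (y a) (R / 4)]
  linarith

end Gap

/-! ### Search trees of splitting probabilities and the pieces of the unit interval -/

/-- A piece of the unit interval attached to a node of the tree: its left end, the weight `w` of the
node under the claimed distribution and its weight `g` under the uniform distribution. The length of
the piece is the mean of the two weights. -/
structure Piece where
  start : ℝ
  w : ℝ
  g : ℝ

namespace Piece

noncomputable def len (P : Piece) : ℝ := (P.w + P.g) / 2

/-- The left child of a node, which takes the fraction `p` of the claimed weight and the fraction
`r` of the uniform weight. -/
noncomputable def left (P : Piece) (p r : ℝ) : Piece := ⟨P.start, P.w * p, P.g * r⟩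

/-- The right child of a node, whose piece starts where that of the left child ends. -/
noncomputable def right (P : Piece) (p r : ℝ) : Piece :=
  ⟨P.start + (P.w * p + P.g * r) / 2, P.w * (1 - p), P.g * (1 - r)⟩

end Piece

/-- The fraction of the values in `[lo, hi)` that lie below the midpoint. -/
noncomputable def midFrac (lo hi : ℕ) : ℝ :=
  ((((lo + hi) / 2 : ℕ) : ℝ) - lo) / ((hi : ℝ) - lo)

theorem midFrac_mem {lo hi : ℕ} (h : lo + 1 < hi) : midFrac lo hi ∈ Set.Icc (0 : ℝ) 1 := by
  have h1 : (lo : ℝ) ≤ ((lo + hi) / 2 : ℕ) := by exact_mod_cast (by omega : lo ≤ (lo + hi) / 2)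
  have h2 : (((lo + hi) / 2 : ℕ) : ℝ) ≤ hi := by exact_mod_cast (by omega : (lo + hi) / 2 ≤ hi)
  have h3 : (lo : ℝ) < hi := by exact_mod_cast (by omega : lo < hi)
  exact ⟨div_nonneg (by linarith) (by linarith), div_le_one_of_le₀ (by linarith) (by linarith)⟩

/-- The descent in the binary search tree on `[lo, hi)`, whose inner nodes are labelled by their
midpoints, towards the position `z`. The entry `p m` is the conditional probability of the left
child at the node with midpoint `m`. -/
noncomputable def walk (p : ℕ → ℝ) (z : ℝ) (lo hi : ℕ) (P : Piece) : Piece :=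
  if lo + 1 < hi then
    if z < ((lo + hi) / 2 : ℕ) then
      walk p z lo ((lo + hi) / 2) (P.left (p ((lo + hi) / 2)) (midFrac lo hi))
    else walk p z ((lo + hi) / 2) hi (P.right (p ((lo + hi) / 2)) (midFrac lo hi))
  else P
termination_by hi - lo
decreasing_by all_goals omega

theorem walk_of_lt {p : ℕ → ℝ} {z : ℝ} {lo hi : ℕ} {P : Piece} (h : lo + 1 < hi)
    (hz : z < ((lo + hi) / 2 : ℕ)) : walk p z lo hi P =
      walk p z lo ((lo + hi) / 2) (P.left (p ((lo + hi) / 2)) (midFrac lo hi)) := by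
  rw [walk, if_pos h, if_pos hz]

theorem walk_of_le {p : ℕ → ℝ} {z : ℝ} {lo hi : ℕ} {P : Piece} (h : lo + 1 < hi)
    (hz : ¬ z < ((lo + hi) / 2 : ℕ)) : walk p z lo hi P =
      walk p z ((lo + hi) / 2) hi (P.right (p ((lo + hi) / 2)) (midFrac lo hi)) := by
  rw [walk, if_pos h, if_neg hz]

theorem walk_leaf {p : ℕ → ℝ} {z : ℝ} {lo hi : ℕ} {P : Piece} (h : ¬ lo + 1 < hi) :
    walk p z lo hi P = P := by
  rw [walk, if_neg h]

/-- Induction along the descent in the tree. -/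
theorem walk_induction (z : ℝ) (motive : ℕ → ℕ → Prop)
    (leaf : ∀ lo hi, ¬ lo + 1 < hi → motive lo hi)
    (left : ∀ lo hi, lo + 1 < hi → z < ((lo + hi) / 2 : ℕ) → motive lo ((lo + hi) / 2) →
      motive lo hi)
    (right : ∀ lo hi, lo + 1 < hi → ¬ z < ((lo + hi) / 2 : ℕ) → motive ((lo + hi) / 2) hi →
      motive lo hi) (lo hi : ℕ) : motive lo hi := by
  induction h : hi - lo using Nat.strong_induction_on generalizing lo hi with
  | _ n ih =>
    by_cases hlt : lo + 1 < hi
    · by_cases hz : z < ((lo + hi) / 2 : ℕ)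
      · exact left _ _ hlt hz (ih _ (by omega) _ _ rfl)
      · exact right _ _ hlt hz (ih _ (by omega) _ _ rfl)
    · exact leaf _ _ hlt

/-- The descent depends on `z` only through its comparison with the inner points of the interval. -/
theorem walk_congr {p p' : ℕ → ℝ} {z z' : ℝ} {lo hi : ℕ}
    (hp : ∀ m, lo < m → m < hi → p m = p' m)
    (hz : ∀ m : ℕ, lo < m → m < hi → (z < m ↔ z' < m)) (P : Piece) :
    walk p z lo hi P = walk p' z' lo hi P := by
  induction lo, hi using walk_induction z generalizing P with
  | leaf lo hi h => rw [walk_leaf h, walk_leaf h]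
  | left lo hi h hlt ih =>
    rw [walk_of_lt h hlt, walk_of_lt h ((hz _ (by omega) (by omega)).1 hlt),
      hp _ (by omega) (by omega)]
    exact ih (fun m h1 h2 => hp m h1 (by omega)) (fun m h1 h2 => hz m h1 (by omega)) _
  | right lo hi h hlt ih =>
    rw [walk_of_le h hlt, walk_of_le h (mt (hz _ (by omega) (by omega)).2 hlt),
      hp _ (by omega) (by omega)]
    exact ih (fun m h1 h2 => hp m (by omega) h2) (fun m h1 h2 => hz m (by omega) h2) _

/-- The pieces of the leaves below a node form a subdivision of the piece of the node. -/
theorem sum_walk {Ψ : Piece → ℝ} (hΨ : ∀ P p r, Ψ P = Ψ (P.left p r) + Ψ (P.right p r))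
    (p : ℕ → ℝ) {lo hi : ℕ} (h : lo < hi) (P : Piece) :
    ∑ a ∈ Finset.Ico lo hi, Ψ (walk p a lo hi P) = Ψ P := by
  induction hn : hi - lo using Nat.strong_induction_on generalizing lo hi P with
  | _ n ih =>
    by_cases hlt : lo + 1 < hi
    · rw [← Finset.sum_Ico_consecutive _ (by omega : lo ≤ (lo + hi) / 2)
        (by omega : (lo + hi) / 2 ≤ hi), hΨ P (p ((lo + hi) / 2)) (midFrac lo hi),
        ← ih _ (by omega) (by omega : lo < (lo + hi) / 2) _ rfl,
        ← ih _ (by omega) (by omega : (lo + hi) / 2 < hi) _ rfl]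
      congr 1
      · refine Finset.sum_congr rfl fun a ha => ?_
        rw [walk_of_lt hlt (Nat.cast_lt.2 (Finset.mem_Ico.1 ha).2)]
      · refine Finset.sum_congr rfl fun a ha => ?_
        rw [walk_of_le hlt (not_lt.2 (Nat.cast_le.2 (Finset.mem_Ico.1 ha).1))]
    · obtain rfl : hi = lo + 1 := by omega
      rw [Nat.Ico_succ_singleton, Finset.sum_singleton, walk_leaf hlt]

theorem walk_bounds {p : ℕ → ℝ} (hp : ∀ m, p m ∈ Set.Icc (0 : ℝ) 1) (z : ℝ) (lo hi : ℕ) {P : Piece}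
    (hw : 0 ≤ P.w) (hg : 0 ≤ P.g) :
    0 ≤ (walk p z lo hi P).w ∧ P.start ≤ (walk p z lo hi P).start ∧
      (walk p z lo hi P).start + (walk p z lo hi P).len ≤ P.start + P.len := by
  induction lo, hi using walk_induction z generalizing P with
  | leaf lo hi h => rw [walk_leaf h]; exact ⟨hw, le_rfl, le_rfl⟩
  | left lo hi h hlt ih =>
    rw [walk_of_lt h hlt]
    have h1 := hp ((lo + hi) / 2)
    have h2 := midFrac_mem h
    obtain ⟨a, b, c⟩ := ih (P := P.left (p ((lo + hi) / 2)) (midFrac lo hi))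
      (mul_nonneg hw h1.1) (mul_nonneg hg h2.1)
    refine ⟨a, b, c.trans ?_⟩
    simp only [Piece.left, Piece.len]
    nlinarith [mul_nonneg hw (sub_nonneg.2 h1.2), mul_nonneg hg (sub_nonneg.2 h2.2)]
  | right lo hi h hlt ih =>
    rw [walk_of_le h hlt]
    have h1 := hp ((lo + hi) / 2)
    have h2 := midFrac_mem h
    obtain ⟨a, b, c⟩ := ih (P := P.right (p ((lo + hi) / 2)) (midFrac lo hi))
      (mul_nonneg hw (sub_nonneg.2 h1.2)) (mul_nonneg hg (sub_nonneg.2 h2.2))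
    refine ⟨a, le_trans ?_ b, c.trans (le_of_eq ?_)⟩
    · simp only [Piece.right]
      have := mul_nonneg hw h1.1
      have := mul_nonneg hg h2.1
      linarith
    · simp only [Piece.right, Piece.len]
      ring

/-- The probability of the leaf reached from `z`, given the node `[lo, hi)`. -/
noncomputable def leafProb (p : ℕ → ℝ) (z : ℝ) (lo hi : ℕ) : ℝ := (walk p z lo hi ⟨0, 1, 0⟩).w

/-- The claimed weight at the leaf is the weight of the node times a factor that does not depend on
the node. -/
theorem walk_w (p : ℕ → ℝ) (z : ℝ) (lo hi : ℕ) (P : Piece) :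
    (walk p z lo hi P).w = P.w * leafProb p z lo hi := by
  unfold leafProb
  suffices H : ∀ P Q : Piece, (walk p z lo hi P).w * Q.w = P.w * (walk p z lo hi Q).w by
    simpa using H P ⟨0, 1, 0⟩
  induction lo, hi using walk_induction z with
  | leaf lo hi h => intro P Q; rw [walk_leaf h, walk_leaf h]
  | left lo hi h hlt ih =>
    intro P Q
    rw [walk_of_lt h hlt, walk_of_lt h hlt]
    -- a vanishing splitting probability cannot be cancelled, but makes both sides vanish
    by_cases h0 : p ((lo + hi) / 2) = 0
    · have e : ∀ P : Piece, (walk p z lo ((lo + hi) / 2)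
          (P.left (p ((lo + hi) / 2)) (midFrac lo hi))).w = 0 := fun P => by
        simpa [Piece.left, h0] using ih (P.left (p ((lo + hi) / 2)) (midFrac lo hi)) ⟨0, 1, 0⟩
      rw [e, e]; simp
    · have := ih (P.left (p ((lo + hi) / 2)) (midFrac lo hi))
        (Q.left (p ((lo + hi) / 2)) (midFrac lo hi))
      have e : ∀ P : Piece, (P.left (p ((lo + hi) / 2)) (midFrac lo hi)).w =
        P.w * p ((lo + hi) / 2) := fun _ => rfl
      rw [e, e] at this
      exact mul_right_cancel₀ h0 (by linarith)
  | right lo hi h hlt ih =>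
    intro P Q
    rw [walk_of_le h hlt, walk_of_le h hlt]
    by_cases h0 : 1 - p ((lo + hi) / 2) = 0
    · have e : ∀ P : Piece, (walk p z ((lo + hi) / 2) hi
          (P.right (p ((lo + hi) / 2)) (midFrac lo hi))).w = 0 := fun P => by
        simpa [Piece.right, h0] using ih (P.right (p ((lo + hi) / 2)) (midFrac lo hi)) ⟨0, 1, 0⟩
      rw [e, e]; simp
    · have := ih (P.right (p ((lo + hi) / 2)) (midFrac lo hi))
        (Q.right (p ((lo + hi) / 2)) (midFrac lo hi))
      have e : ∀ P : Piece, (P.right (p ((lo + hi) / 2)) (midFrac lo hi)).w =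
        P.w * (1 - p ((lo + hi) / 2)) := fun _ => rfl
      rw [e, e] at this
      exact mul_right_cancel₀ h0 (by linarith)

/-- Whatever the tree, the uniform weight is shared equally among the leaves. -/
theorem walk_g (p : ℕ → ℝ) (z : ℝ) {lo hi : ℕ} (h : lo < hi) (P : Piece) :
    (walk p z lo hi P).g = P.g / ((hi : ℝ) - lo) := by
  induction lo, hi using walk_induction z generalizing P with
  | leaf lo hi h' =>
    obtain rfl : hi = lo + 1 := by omega
    rw [walk_leaf h']; simp
  | left lo hi h' hlt ih =>
    rw [walk_of_lt h' hlt, ih (by omega)]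
    have h1 : (lo : ℝ) < ((lo + hi) / 2 : ℕ) := by exact_mod_cast (by omega : lo < (lo + hi) / 2)
    have h3 : (lo : ℝ) < hi := by exact_mod_cast h
    have := sub_pos.2 h1
    have := sub_pos.2 h3
    simp only [Piece.left, midFrac]
    field_simp
  | right lo hi h' hlt ih =>
    rw [walk_of_le h' hlt, ih (by omega)]
    have h1 : (((lo + hi) / 2 : ℕ) : ℝ) < hi := by exact_mod_cast (by omega : (lo + hi) / 2 < hi)
    have h3 : (lo : ℝ) < hi := by exact_mod_cast h
    have := sub_pos.2 h1
    have := sub_pos.2 h3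
    simp only [Piece.right, midFrac]
    field_simp
    ring

theorem leafProb_nonneg {p : ℕ → ℝ} (hp : ∀ m, p m ∈ Set.Icc (0 : ℝ) 1) (z : ℝ) (lo hi : ℕ) :
    0 ≤ leafProb p z lo hi :=
  (walk_bounds hp z lo hi (P := ⟨0, 1, 0⟩) zero_le_one le_rfl).1

theorem sum_leafProb (p : ℕ → ℝ) {lo hi : ℕ} (h : lo < hi) :
    ∑ a ∈ Finset.Ico lo hi, leafProb p a lo hi = 1 :=
  sum_walk (Ψ := Piece.w) (fun P p r => by simp only [Piece.left, Piece.right]; ring) p h ⟨0, 1, 0⟩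

theorem leafProb_of_lt {p : ℕ → ℝ} {z : ℝ} {lo hi : ℕ} (h : lo + 1 < hi)
    (hz : z < ((lo + hi) / 2 : ℕ)) : leafProb p z lo hi =
      p ((lo + hi) / 2) * leafProb p z lo ((lo + hi) / 2) := by
  rw [leafProb, walk_of_lt h hz, walk_w]
  simp [Piece.left]

theorem leafProb_of_le {p : ℕ → ℝ} {z : ℝ} {lo hi : ℕ} (h : lo + 1 < hi)
    (hz : ¬ z < ((lo + hi) / 2 : ℕ)) : leafProb p z lo hi =
      (1 - p ((lo + hi) / 2)) * leafProb p z ((lo + hi) / 2) hi := by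
  rw [leafProb, walk_of_le h hz, walk_w]
  simp [Piece.right]

theorem leafProb_congr {p p' : ℕ → ℝ} {z : ℝ} {lo hi : ℕ}
    (hp : ∀ m, lo < m → m < hi → p m = p' m) : leafProb p z lo hi = leafProb p' z lo hi := by
  rw [leafProb, leafProb, walk_congr hp fun _ _ _ => Iff.rfl]

/-- Every nonnegative weight function on `[lo, hi)` is given by a tree of splitting
probabilities. -/
theorem exists_splitting (f : ℕ → ℝ) (hf : ∀ a, 0 ≤ f a) {lo hi : ℕ} (h : lo < hi) :
    ∃ p : ℕ → ℝ, (∀ m, p m ∈ Set.Icc (0 : ℝ) 1) ∧ ∀ a ∈ Finset.Ico lo hi,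
      (∑ b ∈ Finset.Ico lo hi, f b) * leafProb p a lo hi = f a := by
  induction hn : hi - lo using Nat.strong_induction_on generalizing lo hi with
  | _ n ih =>
    by_cases hlt : lo + 1 < hi
    · obtain ⟨pl, hpl, hl⟩ := ih _ (by omega) (by omega : lo < (lo + hi) / 2) rfl
      obtain ⟨pr, hpr, hr⟩ := ih _ (by omega) (by omega : (lo + hi) / 2 < hi) rfl
      set mid := (lo + hi) / 2 with hmid
      set sl := ∑ b ∈ Finset.Ico lo mid, f b
      set sr := ∑ b ∈ Finset.Ico mid hi, f b
      have hs : ∑ b ∈ Finset.Ico lo hi, f b = sl + sr :=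
        (Finset.sum_Ico_consecutive _ (by omega) (by omega)).symm
      have hsl : 0 ≤ sl := Finset.sum_nonneg fun b _ => hf b
      have hsr : 0 ≤ sr := Finset.sum_nonneg fun b _ => hf b
      have e1 : (sl + sr) * (sl / (sl + sr)) = sl := by
        rcases eq_or_ne (sl + sr) 0 with h0 | h0
        · rw [h0]; linarith
        · field_simp
      refine ⟨fun m => if m < mid then pl m else if m = mid then sl / (sl + sr) else pr m,
        fun m => ?_, fun a ha => ?_⟩
      · dsimp only
        split_ifs
        · exact hpl m
        · exact ⟨by positivity, div_le_one_of_le₀ (by linarith) (by linarith)⟩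
        · exact hpr m
      · rw [Finset.mem_Ico] at ha
        rw [hs]
        by_cases ham : a < mid
        · rw [leafProb_of_lt hlt (Nat.cast_lt.2 ham), ← hl a (Finset.mem_Ico.2 ⟨ha.1, ham⟩),
            leafProb_congr (p' := pl) (fun m h1 h2 => by simp only [← hmid] at h2; simp [h2])]
          simp only [← hmid, lt_irrefl, if_false, if_true]
          rw [← mul_assoc, e1]
        · rw [leafProb_of_le hlt (by rw [not_lt]; exact Nat.cast_le.2 (not_lt.1 ham)),
            ← hr a (Finset.mem_Ico.2 ⟨not_lt.1 ham, ha.2⟩),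
            leafProb_congr (p' := pr) (fun m h1 h2 => by
              simp only [← hmid] at h1
              simp [not_lt.2 h1.le, h1.ne'])]
          simp only [← hmid, lt_irrefl, if_false, if_true]
          rw [← mul_assoc, mul_sub, e1]
          ring
    · obtain rfl : hi = lo + 1 := by omega
      refine ⟨fun _ => 0, fun _ => ⟨le_rfl, zero_le_one⟩, fun a ha => ?_⟩
      rw [Nat.Ico_succ_singleton, Finset.mem_singleton] at ha
      rw [leafProb, walk_leaf hlt, Nat.Ico_succ_singleton, Finset.sum_singleton, ha, mul_one]

/-- The piece reached after the attributes `0, …, i - 1`, where the attribute `j` has `k j` values,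
the tree `p j` and the position `z j`. -/
noncomputable def attrWalk (k : ℕ → ℕ) (p : ℕ → ℕ → ℝ) (z : ℕ → ℝ) : ℕ → Piece
  | 0 => ⟨0, 1, 1⟩
  | i + 1 => walk (p i) (z i) 0 (k i) (attrWalk k p z i)

theorem attrWalk_congr {k : ℕ → ℕ} {p : ℕ → ℕ → ℝ} {z z' : ℕ → ℝ} {d : ℕ}
    (h : ∀ i < d, ∀ m : ℕ, 0 < m → m < k i → (z i < m ↔ z' i < m)) :
    attrWalk k p z d = attrWalk k p z' d := by
  induction d with
  | zero => rfl
  | succ d ih =>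
    rw [attrWalk, attrWalk, ih fun i hi => h i (by omega)]
    exact walk_congr (fun _ _ _ => rfl) (h d (by omega)) _

theorem attrWalk_bounds {k : ℕ → ℕ} {p : ℕ → ℕ → ℝ} (hp : ∀ i m, p i m ∈ Set.Icc (0 : ℝ) 1)
    (z : ℕ → ℝ) {d : ℕ} (hk : ∀ i < d, 0 < k i) :
    0 ≤ (attrWalk k p z d).w ∧ 0 ≤ (attrWalk k p z d).g ∧ 0 ≤ (attrWalk k p z d).start ∧
      (attrWalk k p z d).start + (attrWalk k p z d).len ≤ 1 := by
  induction d with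
  | zero => simp [attrWalk, Piece.len]
  | succ d ih =>
    obtain ⟨h1, h2, h3, h4⟩ := ih fun i hi => hk i (by omega)
    obtain ⟨a, b, c⟩ := walk_bounds (hp d) (z d) 0 (k d) h1 h2
    refine ⟨a, ?_, h3.trans b, c.trans h4⟩
    rw [attrWalk, walk_g _ _ (hk d d.lt_succ_self)]
    exact div_nonneg h2 (by simp)

/-- The claimed weights form a product distribution. -/
theorem attrWalk_w (k : ℕ → ℕ) (p : ℕ → ℕ → ℝ) (z : ℕ → ℝ) (d : ℕ) :
    (attrWalk k p z d).w = ∏ i ∈ Finset.range d, leafProb (p i) (z i) 0 (k i) := by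
  induction d with
  | zero => rfl
  | succ d ih => rw [attrWalk, walk_w, ih, Finset.prod_range_succ]

theorem attrWalk_g {k : ℕ → ℕ} {d : ℕ} (hk : ∀ i < d, 0 < k i) (p : ℕ → ℕ → ℝ) (z : ℕ → ℝ) :
    (attrWalk k p z d).g = 1 / ∏ i ∈ Finset.range d, (k i : ℝ) := by
  induction d with
  | zero => simp [attrWalk]
  | succ d ih =>
    rw [attrWalk, walk_g _ _ (hk d d.lt_succ_self), ih fun i hi => hk i (by omega), Finset.prod_range_succ, Nat.cast_zero, sub_zero, div_div]

/-- A point of the domain as a sequence of positions, with the value `0` beyond the attributes. -/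
def position {d : ℕ} {k : Fin d → ℕ} (x : Domain k) (i : ℕ) : ℝ :=
  if h : i < d then ((x ⟨i, h⟩ : ℕ) : ℝ) else 0

/-- The pieces of the points of the domain form a subdivision of the unit interval. -/
theorem sum_attrWalk {Ψ : Piece → ℝ} (hΨ : ∀ P p r, Ψ P = Ψ (P.left p r) + Ψ (P.right p r))
    {k : ℕ → ℕ} {d : ℕ} (hk : ∀ i < d, 0 < k i) (p : ℕ → ℕ → ℝ) :
    ∑ x : Domain (fun i : Fin d => k i), Ψ (attrWalk k p (position x) d) = Ψ ⟨0, 1, 1⟩ := by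
  induction d with
  | zero => simp [attrWalk]
  | succ d ih =>
    rw [← (Fin.snocEquiv fun i : Fin (d + 1) => Fin (k i)).sum_comp, Fintype.sum_prod_type_right,
      ← ih fun i hi => hk i (by omega)]
    refine Finset.sum_congr rfl fun x _ => ?_
    rw [← sum_walk hΨ (p d) (hk d d.lt_succ_self), ← Finset.range_eq_Ico, ← Fin.sum_univ_eq_sum_range
      (fun a => Ψ (walk (p d) a 0 (k d) (attrWalk k p (position x) d)))]
    refine Finset.sum_congr rfl fun a _ => ?_
    rw [attrWalk]
    have e1 : attrWalk k p (position
        ((Fin.snocEquiv fun i : Fin (d + 1) => Fin (k i)) (a, x))) d =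
        attrWalk k p (position x) d := by
      refine attrWalk_congr fun i hi m _ _ => ?_
      simp [position, hi, Nat.lt_succ_of_lt hi, Fin.snocEquiv, Fin.snoc]
    have e2 : position ((Fin.snocEquiv fun i : Fin (d + 1) => Fin (k i)) (a, x)) d = (a : ℕ) := by
      simp [position, Fin.snocEquiv, Fin.snoc]
    rw [e1, e2]

/-! ### Cutting the unit interval into bins -/

/-- The index of the bin of `y` among `M` bins of equal length; the last bin is closed. -/
noncomputable def binOf (M : ℕ) (y : ℝ) : ℕ := min ⌊y * M⌋₊ (M - 1)

theorem binOf_lt {M : ℕ} (hM : 0 < M) (y : ℝ) : binOf M y < M :=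
  (min_le_right _ _).trans_lt (by omega)

theorem binOf_eq_iff {M j : ℕ} (hj : j < M) {y : ℝ} (h0 : 0 ≤ y) (h1 : y < 1) :
    binOf M y = j ↔ (j : ℝ) / M ≤ y ∧ y < ((j : ℝ) + 1) / M := by
  have hM : 0 < (M : ℝ) := by exact_mod_cast (by omega : 0 < M)
  have h2 : ⌊y * M⌋₊ < M := (Nat.floor_lt (by positivity)).2 (by nlinarith)
  rw [binOf, min_eq_left (by omega), Nat.floor_eq_iff (by positivity), div_le_iff₀ hM, lt_div_iff₀ hM]

/-- The projection to `[a, b]`. -/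
noncomputable def clamp (a b y : ℝ) : ℝ := max a (min b y)

theorem clamp_mono (a b : ℝ) : Monotone (clamp a b) := fun _ _ h =>
  max_le_max le_rfl (min_le_min le_rfl h)

/-- The fraction of the interval of length `l` from `E` that lies in the bin `j` of `M`. -/
noncomputable def binFrac (M : ℕ) (E l : ℝ) (j : ℕ) : ℝ :=
  (clamp (j / M) ((j + 1) / M) (E + l) - clamp (j / M) ((j + 1) / M) E) / l

theorem binFrac_nonneg (M : ℕ) (E : ℝ) {l : ℝ} (hl : 0 ≤ l) (j : ℕ) : 0 ≤ binFrac M E l j :=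
  div_nonneg (sub_nonneg.2 (clamp_mono _ _ (by linarith))) hl

theorem max_sub_eq_clamp {a b E l : ℝ} (hab : a < b) (hl : 0 < l) :
    max (min l (b - E) - max 0 (a - E)) 0 = clamp a b (E + l) - clamp a b E := by
  unfold clamp
  grind

/-- The position of a uniform point of a piece falls into a bin with probability equal to the
fraction of the piece in the bin. -/
theorem volume_binOf_eq {M j : ℕ} (hj : j < M) {E l : ℝ} (hE : 0 ≤ E) (hl : 0 < l)
    (hEl : E + l ≤ 1) :
    (volume : Measure unitInterval).real {v | binOf M (E + v * l) = j} = binFrac M E l j := by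
  have hM : 0 < (M : ℝ) := by exact_mod_cast (by omega : 0 < M)
  set a : ℝ := (j : ℝ) / M with ha
  set b : ℝ := ((j : ℝ) + 1) / M with hb
  have hab : a < b := by rw [ha, hb]; gcongr; linarith
  have ha0 : 0 ≤ a := by positivity
  have hb1 : b ≤ 1 := by
    rw [hb, div_le_one hM]; exact_mod_cast hj
  set S : Set ℝ := Set.Ico (max 0 ((a - E) / l)) (min 1 ((b - E) / l)) with hS
  have h1 : (volume : Measure unitInterval) {v | binOf M (E + v * l) = j} =
      (volume : Measure unitInterval) (Subtype.val ⁻¹' S) := by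
    refine measure_congr ?_
    have : ∀ᵐ v : unitInterval, v ≠ 1 := by
      rw [ae_iff]; simp
    filter_upwards [this] with v hv
    have hv1 : (v : ℝ) < 1 := lt_of_le_of_ne v.2.2 fun h => hv (Subtype.ext h)
    have hv0 : (0 : ℝ) ≤ v := v.2.1
    refine propext ?_
    change binOf M (E + v * l) = j ↔ (v : ℝ) ∈ S
    rw [binOf_eq_iff hj (by positivity) (by nlinarith), hS, Set.mem_Ico, max_le_iff, lt_min_iff,
      div_le_iff₀ hl, lt_div_iff₀ hl, ← ha, ← hb]
    constructor
    · rintro ⟨h, h'⟩; exact ⟨⟨hv0, by linarith⟩, hv1, by linarith⟩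
    · rintro ⟨⟨-, h⟩, -, h'⟩; exact ⟨by linarith, by linarith⟩
  have h2 : (volume : Measure unitInterval) (Subtype.val ⁻¹' S) = volume S := by
    have hmp : MeasurePreserving (Subtype.val : unitInterval → ℝ) volume
        (volume.restrict (Set.Icc (0 : ℝ) 1)) := measurePreserving_subtype_coe measurableSet_Icc
    rw [hmp.measure_preimage measurableSet_Ico.nullMeasurableSet,
      Measure.restrict_apply measurableSet_Ico, Set.inter_eq_left.2]
    intro v hv
    exact ⟨(le_max_left _ _).trans hv.1, (hv.2.trans_le (min_le_left _ _)).le⟩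
  rw [measureReal_def, h1, h2, hS, Real.volume_Ico, ENNReal.toReal_ofReal', binFrac, eq_div_iff hl.ne',
    ← ha, ← hb, max_mul_of_nonneg _ _ hl.le, zero_mul, sub_mul, min_mul_of_nonneg _ _ hl.le,
    max_mul_of_nonneg _ _ hl.le, div_mul_cancel₀ _ hl.ne', div_mul_cancel₀ _ hl.ne', zero_mul,
    one_mul]
  exact max_sub_eq_clamp hab hl

theorem len_mul_binFrac {M j : ℕ} {P : Piece} (h : 0 < P.len) : P.len * binFrac M P.start P.len j =
    clamp (j / M) ((j + 1) / M) (P.start + P.len) - clamp (j / M) ((j + 1) / M) P.start := by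
  rw [binFrac, mul_div_cancel₀ _ h.ne']

/-- The length of the part of a piece in a bin is additive over the two children. -/
theorem clamp_additive (a b : ℝ) (P : Piece) (p r : ℝ) :
    clamp a b (P.start + P.len) - clamp a b P.start =
      (clamp a b ((P.left p r).start + (P.left p r).len) - clamp a b (P.left p r).start) +
      (clamp a b ((P.right p r).start + (P.right p r).len) - clamp a b (P.right p r).start) := by
  have e1 : (P.left p r).start + (P.left p r).len = (P.right p r).start := by
    simp only [Piece.left, Piece.right, Piece.len]
  have e2 : (P.right p r).start + (P.right p r).len = P.start + P.len := by
    simp only [Piece.right, Piece.len]; ring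
  rw [e1, e2]
  simp [Piece.left]

/-- The root piece is the unit interval, and its part in a bin has the length of the bin. -/
theorem clamp_root {M j : ℕ} (hj : j < M) :
    clamp (j / M) ((j + 1) / M) ((⟨0, 1, 1⟩ : Piece).start + (⟨0, 1, 1⟩ : Piece).len) -
      clamp (j / M) ((j + 1) / M) (⟨0, 1, 1⟩ : Piece).start = 1 / (M : ℝ) := by
  have hM : 0 < (M : ℝ) := by exact_mod_cast (by omega : 0 < M)
  have h1 : ((j : ℝ) + 1) / M ≤ 1 := by rw [div_le_one hM]; exact_mod_cast hj
  have h2 : (j : ℝ) / M ≤ ((j : ℝ) + 1) / M := by gcongr; linarith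
  have h3 : 0 ≤ (j : ℝ) / M := by positivity
  have h4 : 0 ≤ ((j : ℝ) + 1) / M := by positivity
  have e : (0 : ℝ) + (1 + 1) / 2 = 1 := by norm_num
  simp only [Piece.len, clamp, e]
  rw [min_eq_left h1, max_eq_right h2, min_eq_right h4, max_eq_left h3]
  ring

/-- A piece that is longer than four bins contains enough bins to cover half of it. -/
theorem half_len_le_card_full {M : ℕ} (hM : 0 < M) {E l : ℝ} (hE : 0 ≤ E) (hEl : E + l ≤ 1)
    (h4 : 4 ≤ M * l) :
    M * l / 2 ≤ ((Finset.univ.filter fun j : Fin M => binFrac M E l j * l = 1 / M).card : ℝ) := by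
  have hM' : 0 < (M : ℝ) := by exact_mod_cast hM
  have hl : 0 < l := by by_contra h; nlinarith
  set lo := ⌈(M : ℝ) * E⌉₊
  set up := ⌊(M : ℝ) * (E + l)⌋₊
  have hup : up ≤ M := by
    have : ((M : ℝ) * (E + l)) ≤ M := by nlinarith
    exact_mod_cast (Nat.floor_le (by positivity)).trans this
  have hlo : (lo : ℝ) < M * E + 1 := Nat.ceil_lt_add_one (by positivity)
  have hup' : M * (E + l) < (up : ℝ) + 1 := Nat.lt_floor_add_one _
  have hcard : up - lo ≤ (Finset.univ.filter fun j : Fin M => binFrac M E l j * l = 1 / M).card := by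
    rw [← Nat.card_Ico, ← Finset.card_map Fin.valEmbedding]
    refine Finset.card_le_card fun j hj => ?_
    rw [Finset.mem_Ico] at hj
    refine Finset.mem_map.2 ⟨⟨j, by omega⟩, Finset.mem_filter.2 ⟨Finset.mem_univ _, ?_⟩, rfl⟩
    have j1 : E ≤ (j : ℝ) / M := by
      rw [le_div_iff₀ hM']
      have := (Nat.le_ceil ((M : ℝ) * E)).trans (Nat.cast_le.2 hj.1)
      linarith
    have j2 : ((j : ℝ) + 1) / M ≤ E + l := by
      rw [div_le_iff₀ hM']
      have h1 : ((j + 1 : ℕ) : ℝ) ≤ up := Nat.cast_le.2 hj.2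
      have h2 := Nat.floor_le (show 0 ≤ (M : ℝ) * (E + l) by positivity)
      push_cast at h1
      linarith
    have j3 : (j : ℝ) / M ≤ ((j : ℝ) + 1) / M := by gcongr; linarith
    simp only [binFrac, clamp]
    rw [div_mul_cancel₀ _ hl.ne', min_eq_left j2, max_eq_right j3, min_eq_right (j1.trans j3),
      max_eq_left j1]
    ring
  have h5 : (up : ℝ) - lo ≤ ((up - lo : ℕ) : ℝ) := by
    rw [sub_le_iff_le_add]; exact_mod_cast (by omega : up ≤ up - lo + lo)
  have h6 : ((up - lo : ℕ) : ℝ) ≤ _ := Nat.cast_le.2 hcard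
  linarith

/-- If every piece consists for at least one half of full bins, the passage from pieces to bins
keeps at least one half of the `ℓ¹` norm. -/
theorem half_l1_le {X J : Type*} [Fintype X] [Fintype J] {K : X → J → ℝ} {l : X → ℝ} {c : ℝ}
    (hK : ∀ x j, 0 ≤ K x j) (hl : ∀ x, 0 < l x) (hc : 0 < c) (hsum : ∀ j, ∑ x, K x j * l x = c)
    [∀ x, DecidablePred fun j => K x j * l x = c]
    (hfull : ∀ x, l x / 2 ≤ ((Finset.univ.filter fun j => K x j * l x = c).card : ℝ) * c)
    (e : X → ℝ) : (∑ x, |e x|) / 2 ≤ ∑ j, |∑ x, e x * K x j| := by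
  have hcol : ∀ j, ∑ x, |e x| / l x * (if K x j * l x = c then c else 0) ≤
      |∑ x, e x * K x j| := by
    intro j
    by_cases h : ∃ x, K x j * l x = c
    · obtain ⟨x, hx⟩ := h
      -- a bin that is full for `x` does not meet any other piece
      have h0 : ∀ y, y ≠ x → K y j * l y = 0 := by
        intro y hy
        have h1 := hsum j
        have h2 : K x j * l x + K y j * l y ≤ ∑ x, K x j * l x := by
          classical
          rw [← Finset.sum_pair (f := fun x => K x j * l x) hy.symm]
          exact Finset.sum_le_sum_of_subset_of_nonneg (Finset.subset_univ _)
            fun i _ _ => mul_nonneg (hK i j) (hl i).le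
        exact le_antisymm (by linarith) (mul_nonneg (hK y j) (hl y).le)
      rw [Finset.sum_eq_single x, Finset.sum_eq_single x, if_pos hx, abs_mul, abs_of_nonneg (hK x j),
        ← hx]
      · have := (hl x).ne'
        rw [div_mul_eq_mul_div, div_le_iff₀ (hl x), mul_assoc]
      · intro y _ hy
        rw [(mul_eq_zero.1 (h0 y hy)).resolve_right (hl y).ne', mul_zero]
      · simp
      · intro y _ hy
        rw [if_neg (by rw [h0 y hy]; exact hc.ne), mul_zero]
      · simp
    · push Not at h
      simp only [h, if_false, mul_zero, Finset.sum_const_zero]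
      exact abs_nonneg _
  refine le_trans ?_ (Finset.sum_le_sum fun j _ => hcol j)
  rw [Finset.sum_comm, Finset.sum_div]
  refine Finset.sum_le_sum fun x _ => ?_
  rw [← Finset.mul_sum, ← Finset.sum_filter, Finset.sum_const, nsmul_eq_mul]
  have h1 := mul_le_mul_of_nonneg_left (hfull x) (div_nonneg (abs_nonneg (e x)) (hl x).le)
  have h2 : |e x| / l x * (l x / 2) = |e x| / 2 := by have := (hl x).ne'; field_simp
  linarith

/-! ### Weakest preconditions -/

/-- The program halts from `s`, in a final state and after a time that satisfy `Q`. -/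
def WP (I : Input) (c : Program) (s : State) (Q : State → ℕ → Prop) : Prop :=
  ∃ s' t, Exec I c s s' t ∧ Q s' t

section WP

variable {I : Input} {s : State} {Q Q' : State → ℕ → Prop}

theorem WP.mono {c : Program} (h : WP I c s Q) (hQ : ∀ s' t, Q s' t → Q' s' t) : WP I c s Q' := by
  obtain ⟨s', t, h1, h2⟩ := h
  exact ⟨s', t, h1, hQ _ _ h2⟩

theorem wp_skip : WP I .skip s Q ↔ Q s 1 :=
  ⟨fun ⟨_, _, h, hQ⟩ => by cases h; exact hQ, fun h => ⟨_, _, .skip s, h⟩⟩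

theorem wp_setNat {a e : NatExpr} : WP I (.setNat a e) s Q ↔
    Q { s with nat := Function.update s.nat (a.eval I s) (e.eval I s) } (a.cost + e.cost + 1) :=
  ⟨fun ⟨_, _, h, hQ⟩ => by cases h; exact hQ, fun h => ⟨_, _, .setNat a e s, h⟩⟩

theorem wp_setReal {a : NatExpr} {e : RealExpr} : WP I (.setReal a e) s Q ↔
    Q { s with real := Function.update s.real (a.eval I s) (e.eval I s) } (a.cost + e.cost + 1) :=
  ⟨fun ⟨_, _, h, hQ⟩ => by cases h; exact hQ, fun h => ⟨_, _, .setReal a e s, h⟩⟩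

theorem wp_draw {a : NatExpr} : WP I (.draw a) s Q ↔
    Q { s with real := Function.update s.real (a.eval I s) (I.tape s.drawn), drawn := s.drawn + 1 }
      (a.cost + 1) :=
  ⟨fun ⟨_, _, h, hQ⟩ => by cases h; exact hQ, fun h => ⟨_, _, .draw a s, h⟩⟩

theorem wp_seq {c c' : Program} : WP I (.seq c c') s Q ↔
    WP I c s fun s₁ t₁ => WP I c' s₁ fun s₂ t₂ => Q s₂ (t₁ + t₂) :=
  ⟨fun ⟨_, _, h, hQ⟩ => by cases h with | seq h h' => exact ⟨_, _, h, _, _, h', hQ⟩,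
    fun ⟨_, _, h, _, _, h', hQ⟩ => ⟨_, _, .seq h h', hQ⟩⟩

theorem wp_ite_pos {b : Test} {c c' : Program} (hb : b.holds I s) :
    WP I (.ite b c c') s Q ↔ WP I c s fun s' t => Q s' (b.cost + t) :=
  ⟨fun ⟨_, _, h, hQ⟩ => by
    cases h with
    | iteTrue _ h => exact ⟨_, _, h, hQ⟩
    | iteFalse hb' _ => exact absurd hb hb',
    fun ⟨_, _, h, hQ⟩ => ⟨_, _, .iteTrue hb h, hQ⟩⟩

theorem wp_ite_neg {b : Test} {c c' : Program} (hb : ¬ b.holds I s) :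
    WP I (.ite b c c') s Q ↔ WP I c' s fun s' t => Q s' (b.cost + t) :=
  ⟨fun ⟨_, _, h, hQ⟩ => by
    cases h with
    | iteTrue hb' _ => exact absurd hb' hb
    | iteFalse _ h => exact ⟨_, _, h, hQ⟩,
    fun ⟨_, _, h, hQ⟩ => ⟨_, _, .iteFalse hb h, hQ⟩⟩

theorem wp_ite {b : Test} {c c' : Program} : WP I (.ite b c c') s Q ↔
    (b.holds I s → WP I c s fun s' t => Q s' (b.cost + t)) ∧
      (¬ b.holds I s → WP I c' s fun s' t => Q s' (b.cost + t)) := by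
  by_cases hb : b.holds I s
  · simp [wp_ite_pos hb, hb]
  · simp [wp_ite_neg hb, hb]

/-- A loop with a decreasing measure. -/
theorem wp_while_measure {b : Test} {c : Program} (Inv : State → Prop) (μ : State → ℕ) (T : ℕ)
    (h0 : Inv s) (step : ∀ s, Inv s → b.holds I s →
      WP I c s fun s' t => Inv s' ∧ μ s' + 1 ≤ μ s ∧ t ≤ T) :
    WP I (.while b c) s fun s' t => Inv s' ∧ ¬ b.holds I s' ∧ t ≤ μ s * (b.cost + T) + b.cost := by
  induction h : μ s using Nat.strong_induction_on generalizing s with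
  | _ n ih =>
    by_cases hb : b.holds I s
    · obtain ⟨s', t, h1, h2, h3, h4⟩ := step s h0 hb
      obtain ⟨s'', t', h5, h6, h7, h8⟩ := ih (μ s') (by omega) h2 rfl
      refine ⟨s'', _, .whileTrue hb h1 h5, h6, h7, ?_⟩
      have : (μ s' + 1) * (b.cost + T) ≤ n * (b.cost + T) := Nat.mul_le_mul_right _ (by omega)
      rw [add_mul] at this
      omega
    · exact ⟨s, _, .whileFalse hb, h0, hb, by omega⟩

/-- A counting loop, whose time in each round depends on the round. -/
theorem wp_while_count {b : Test} {c : Program} (Inv : ℕ → State → Prop) (n : ℕ) (T : ℕ → ℕ)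
    (h0 : Inv 0 s) (step : ∀ i < n, ∀ s, Inv i s → b.holds I s ∧
      WP I c s fun s' t => Inv (i + 1) s' ∧ t ≤ T i) (hn : ∀ s, Inv n s → ¬ b.holds I s) :
    WP I (.while b c) s fun s' t =>
      Inv n s' ∧ t ≤ (∑ i ∈ Finset.range n, (b.cost + T i)) + b.cost := by
  suffices H : ∀ k ≤ n, ∀ s, Inv (n - k) s → WP I (.while b c) s fun s' t =>
      Inv n s' ∧ t ≤ (∑ i ∈ Finset.Ico (n - k) n, (b.cost + T i)) + b.cost by
    have := H n le_rfl s (by rwa [Nat.sub_self])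
    rwa [Nat.sub_self, ← Finset.range_eq_Ico] at this
  intro k
  induction k with
  | zero =>
    intro _ s hs
    exact ⟨s, _, .whileFalse (hn s hs), hs, by simp⟩
  | succ k ih =>
    intro hk s hs
    obtain ⟨hb, s', t, h1, h2, h3⟩ := step _ (by omega) s hs
    have e : n - (k + 1) + 1 = n - k := by omega
    rw [e] at h2
    obtain ⟨s'', t', h4, h5, h6⟩ := ih (by omega) s' h2
    refine ⟨s'', _, .whileTrue hb h1 h4, h5, ?_⟩
    rw [Finset.sum_eq_sum_Ico_succ_bot (by omega : n - (k + 1) < n), e]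
    omega

end WP

/-- Sequential composition of a list of programs. -/
def block : List Program → Program
  | [] => .skip
  | c :: cs => .seq c (block cs)

/-- The empty block still takes the one step of `skip`. -/
theorem wp_block_nil {I : Input} {s : State} {Q : State → ℕ → Prop} : WP I (block []) s Q ↔ Q s 1 :=
  wp_skip

theorem wp_block_cons {I : Input} {s : State} {Q : State → ℕ → Prop} {c : Program}
    {cs : List Program} : WP I (block (c :: cs)) s Q ↔
      WP I c s fun s₁ t₁ => WP I (block cs) s₁ fun s₂ t₂ => Q s₂ (t₁ + t₂) :=
  wp_seq

/-! ### The verifier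

Natural registers: `0` output, `1` number of the sample, `2` number of the attribute, `3` offset of
the attribute in the message, `4` to `6` the node of the search tree and its midpoint, `7` bin,
`8` number of binary digits of a bin, `9` counter.

Real registers: `0` coin of the decision, `1` domain size, `2` number of bins, `3` mean number of
samples in a bin, `4` clipping bound, `5` difference of the statistics, `6` coin of the sample,
`7` position in the piece, `8` target of the descent, `9` to `11` the current piece, `12` point of
the unit interval, `13` and `14` splitting fractions, `15` sign, `16` increment, and from `20` the
two histograms. -/

/-- The content of the natural register `a`. -/
def nreg (a : ℕ) : NatExpr := .load (.const a)

/-- The content of the real register `a`. -/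
def rreg (a : ℕ) : RealExpr := .load (.const a)

/-- A natural constant as a real number. -/
def rconst (c : ℕ) : RealExpr := .ofNat (.const c)

/-- Store in the natural register `a`. -/
def setN (a : ℕ) (e : NatExpr) : Program := .setNat (.const a) e

/-- Store in the real register `a`. -/
def setR (a : ℕ) (e : RealExpr) : Program := .setReal (.const a) e

/-- Append the first binary digits of the real register `12`, as many as the natural register `8`
says, to the natural register `7`. -/
def digits : Program :=
  .while (.natLt (nreg 9) (nreg 8)) (block
    [setN 7 (.add (nreg 7) (nreg 7)),
     setR 12 (.add (rreg 12) (rreg 12)),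
     .ite (.realLt (rreg 12) (rconst 1)) .skip
       (block [setR 12 (.sub (rreg 12) (rconst 1)), setN 7 (.add (nreg 7) (.const 1))]),
     setN 9 (.add (nreg 9) (.const 1))])

/-- The real memory cell of the histogram that is selected by the natural register `7`. -/
def cell : NatExpr := .add (.const 20) (nreg 7)

/-- Clip the real register `16` to the interval given by the real register `4`. -/
def clipCode : Program := block
  [.ite (.realLt (rreg 4) (rreg 16)) (setR 16 (rreg 4)) .skip,
   .ite (.realLt (rreg 16) (.sub (rconst 0) (rreg 4))) (setR 16 (.sub (rconst 0) (rreg 4))) .skip]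

/-- Put the point in the real register `12` into the histogram, and update the statistic in the real
register `5`, with the sign in the real register `15`. The natural register `7` initially holds `1` or `2`; as the
leading digit of the cell number it keeps the two histograms apart. -/
def insert : Program := block
  [setN 9 (.const 0),
   digits,
   setR 16 (.sub (.load cell) (rreg 3)),
   clipCode,
   setR 5 (.add (rreg 5) (.mul (rreg 15) (rreg 16))),
   .setReal cell (.add (.load cell) (rconst 1))]

/-- The descent in the tree of one attribute towards the position in the real register `8`. -/
def descend : Program :=
  .while (.natLt (.add (nreg 4) (.const 1)) (nreg 5)) (block
    [setN 6 (.half (.add (nreg 4) (nreg 5))),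
     setR 13 (.msg (.add (nreg 3) (nreg 6))),
     setR 14 (.div (.sub (.ofNat (nreg 6)) (.ofNat (nreg 4)))
       (.sub (.ofNat (nreg 5)) (.ofNat (nreg 4)))),
     .ite (.realLt (rreg 8) (.ofNat (nreg 6)))
       (block
         [setR 10 (.mul (rreg 10) (rreg 13)),
          setR 11 (.mul (rreg 11) (rreg 14)),
          setN 5 (nreg 6)])
       (block
         [setR 9 (.add (rreg 9) (.div (.add (.mul (rreg 10) (rreg 13)) (.mul (rreg 11) (rreg 14)))
            (rconst 2))),
          setR 10 (.mul (rreg 10) (.sub (rconst 1) (rreg 13))),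
          setR 11 (.mul (rreg 11) (.sub (rconst 1) (rreg 14))),
          setN 4 (nreg 6)])])

/-- The descent through all attributes, either for the sample with the number in the natural
register `1` or, depending on the coin in the real register `6`, for a uniform point. -/
def locate : Program :=
  .while (.natLt (nreg 2) .attrs) (block
    [.draw (.const 8),
     .ite (.realLt (rreg 6) (.div (rconst 1) (rconst 2)))
       (setR 8 (.ofNat (.sample (nreg 1) (nreg 2))))
       (setR 8 (.mul (rreg 8) (.ofNat (.card (nreg 2))))),
     setN 4 (.const 0),
     setN 5 (.card (nreg 2)),
     descend,
     setN 3 (.add (nreg 3) (.card (nreg 2))),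
     setN 2 (.add (nreg 2) (.const 1))])

/-- Process one sample and one simulated uniform point. -/
def round : Program := block
  [.draw (.const 6),
   .draw (.const 7),
   setN 2 (.const 0),
   setN 3 (.const 0),
   setR 9 (rconst 0),
   setR 10 (rconst 1),
   setR 11 (rconst 1),
   locate,
   setR 12 (.add (rreg 9) (.mul (rreg 7) (.div (.add (rreg 10) (rreg 11)) (rconst 2)))),
   setR 15 (rconst 1),
   setN 7 (.const 1),
   insert,
   .draw (.const 12),
   setR 15 (.sub (rconst 0) (rconst 1)),
   setN 7 (.const 2),
   insert,
   setN 1 (.add (nreg 1) (.const 1))]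

/-- Compute the domain size in the real register `1`. -/
def computeSize : Program :=
  .while (.natLt (nreg 2) .attrs) (block
    [setR 1 (.mul (rreg 1) (.ofNat (.card (nreg 2)))),
     setN 2 (.add (nreg 2) (.const 1))])

/-- The least ratio of the number of bins and the domain size. It is so large that the
average deviation of a mean count that has to be detected lies within the clipping range. -/
def binRatio : ℕ := 2 ^ 50

/-- Compute the number of bins in the real register `2`, and its logarithm in the natural
register `8`. -/
def computeBins : Program :=
  .while (.realLt (rreg 2) (.mul (rconst binRatio) (rreg 1))) (block
    [setR 2 (.add (rreg 2) (rreg 2)),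
     setN 8 (.add (nreg 8) (.const 1))])

/-- The acceptance probability as a function of the statistic in the real register `5`. -/
def acceptExpr : RealExpr :=
  .div (rconst 1) (.add (rconst 1) (.exp (.mul (.div .eps (.mul (rconst 2) (rreg 4)))
    (.sub (rreg 5) (.div (.mul (.mul (.ofNat .size) (.ofNat .size)) (.mul .sigma .sigma))
      (.mul (rconst 64) (rreg 2)))))))

/-- The verifier. -/
def verifier : Program := block
  [.draw (.const 0),
   setR 1 (rconst 1),
   computeSize,
   setR 2 (rconst 1),
   computeBins,
   setR 3 (.div (.ofNat .size) (rreg 2)),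
   setR 4 (.mul (rconst 16) (.exp (.div (.log (.add (rconst 1) (rreg 3))) (rconst 2)))),
   .while (.natLt (nreg 1) .size) round,
   .ite (.realLt (rreg 0) acceptExpr) (setN 0 (.const 1)) .skip]

/-! ### Correctness of the verifier's program -/

/-- The two states agree outside the natural registers `A` and the real registers `B`. -/
def Agree (A B : List ℕ) (s s' : State) : Prop :=
  (∀ j, j ∉ A → s'.nat j = s.nat j) ∧ ∀ j, j ∉ B → s'.real j = s.real j

theorem Agree.refl (A B : List ℕ) (s : State) : Agree A B s s := ⟨fun _ _ => rfl, fun _ _ => rfl⟩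

theorem Agree.trans {A B : List ℕ} {s s' s'' : State} (h : Agree A B s s') (h' : Agree A B s' s'') :
    Agree A B s s'' :=
  ⟨fun j hj => (h'.1 j hj).trans (h.1 j hj), fun j hj => (h'.2 j hj).trans (h.2 j hj)⟩

theorem binOf_eq_of_le {M b : ℕ} {y : ℝ} (hb : b < M) (h1 : (b : ℝ) ≤ y * M)
    (h2 : y * M < b + 1 ∨ b + 1 = M) : binOf M y = b := by
  have hf : b ≤ ⌊y * M⌋₊ := Nat.le_floor h1
  have h0 : 0 ≤ y * M := (Nat.cast_nonneg b).trans h1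
  rw [binOf]
  rcases h2 with h2 | h2
  · have : ⌊y * M⌋₊ < b + 1 := (Nat.floor_lt h0).2 (by push_cast; exact h2)
    omega
  · omega

theorem wp_digits {I : Input} {s : State} {m c : ℕ} {y : ℝ} (h9 : s.nat 9 = 0) (h8 : s.nat 8 = m)
    (h7 : s.nat 7 = c) (hr : s.real 12 = y) (hy0 : 0 ≤ y) :
    WP I digits s fun s' t => s'.nat 7 = c * 2 ^ m + binOf (2 ^ m) y ∧ Agree [7, 9] [12] s s' ∧
      s'.drawn = s.drawn ∧ t ≤ 50 * m + 5 := by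
  refine (wp_while_count (fun j s' => s'.nat 9 = j ∧ s'.nat 8 = m ∧ s'.drawn = s.drawn ∧
    Agree [7, 9] [12] s s' ∧ ∃ b : ℕ, s'.nat 7 = c * 2 ^ j + b ∧ b < 2 ^ j ∧
      s'.real 12 = y * 2 ^ j - b ∧ (b : ℝ) ≤ y * 2 ^ j ∧ (y * 2 ^ j < b + 1 ∨ b + 1 = 2 ^ j))
    m (fun _ => 45) ⟨h9, h8, rfl, Agree.refl _ _ _, 0, ?_⟩ ?_ ?_).mono ?_
  · simp [h7, hr, hy0]
  · rintro j hj s' ⟨e9, e8, ed, ha, b, e7, hb, er, hb1, hb2⟩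
    refine ⟨by simp [Test.holds, NatExpr.eval, nreg, e9, e8, hj], ?_⟩
    have hpow : (2 : ℝ) ^ (j + 1) = 2 * 2 ^ j := by ring
    by_cases hlt : s'.real 12 + s'.real 12 < 1
    · rw [wp_block_cons, setN, wp_setNat, wp_block_cons, setR, wp_setReal, wp_block_cons,
        wp_ite_pos (by simpa [Test.holds, RealExpr.eval, NatExpr.eval, rreg, rconst] using hlt),
        wp_skip, wp_block_cons, setN, wp_setNat, wp_block_nil]
      refine ⟨⟨?_, ?_, ?_, ?_, 2 * b, ?_, ?_, ?_, ?_, ?_⟩, ?_⟩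
      · simp [NatExpr.eval, nreg, e9]
      · simp [e8, NatExpr.eval]
      · simp [ed]
      · refine ha.trans ⟨fun i hi => ?_, fun i hi => ?_⟩
        · simp only [List.mem_cons, List.not_mem_nil, not_or] at hi
          simp [NatExpr.eval, hi]
        · simp only [List.mem_cons, List.not_mem_nil, not_or] at hi
          simp [NatExpr.eval, hi]
      · simp [NatExpr.eval, nreg, e7]; ring
      · rw [pow_succ]; omega
      · simp [NatExpr.eval, RealExpr.eval, rreg, er, hpow]; ring
      · push_cast; rw [hpow]; linarith
      · left; rw [er] at hlt; push_cast; rw [hpow]; linarith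
      · simp [NatExpr.cost, RealExpr.cost, Test.cost, nreg, rreg, rconst]
    · rw [wp_block_cons, setN, wp_setNat, wp_block_cons, setR, wp_setReal, wp_block_cons,
        wp_ite_neg (by simpa [Test.holds, RealExpr.eval, NatExpr.eval, rreg, rconst] using hlt),
        wp_block_cons, setR, wp_setReal, wp_block_cons, setN, wp_setNat, wp_block_nil,
        wp_block_cons, setN, wp_setNat, wp_block_nil]
      refine ⟨⟨?_, ?_, ?_, ?_, 2 * b + 1, ?_, ?_, ?_, ?_, ?_⟩, ?_⟩
      · simp [NatExpr.eval, nreg, e9]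
      · simp [e8, NatExpr.eval]
      · simp [ed]
      · refine ha.trans ⟨fun i hi => ?_, fun i hi => ?_⟩
        · simp only [List.mem_cons, List.not_mem_nil, not_or] at hi
          simp [NatExpr.eval, hi]
        · simp only [List.mem_cons, List.not_mem_nil, not_or] at hi
          simp [NatExpr.eval, hi]
      · simp [NatExpr.eval, nreg, e7]; ring
      · rw [pow_succ]; omega
      · simp [NatExpr.eval, RealExpr.eval, rreg, rconst, er, hpow]; ring
      · rw [er] at hlt; push_cast; rw [hpow]; linarith
      · rcases hb2 with h | h
        · left; push_cast; rw [hpow]; linarith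
        · right; rw [pow_succ]; omega
      · simp [NatExpr.cost, RealExpr.cost, Test.cost, nreg, rreg, rconst]
  · rintro s' ⟨e9, e8, -⟩
    simp [Test.holds, NatExpr.eval, nreg, e9, e8]
  · rintro s' t ⟨⟨e9, e8, ed, ha, b, e7, hb, er, hb1, hb2⟩, ht⟩
    refine ⟨?_, ha, ed, ?_⟩
    · rw [e7, binOf_eq_of_le hb (by push_cast; exact hb1) (by push_cast; exact hb2)]
    · simp [Test.cost, NatExpr.cost, nreg] at ht
      omega

theorem wp_clipCode {I : Input} {s : State} (hR : 0 ≤ s.real 4) :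
    WP I clipCode s fun s' t => s'.real 16 = clip (s.real 4) (s.real 16) ∧ Agree [] [16] s s' ∧
      s'.drawn = s.drawn ∧ t ≤ 50 := by
  simp only [clipCode, wp_block_cons, wp_block_nil, wp_ite, wp_skip, setR, wp_setReal, Test.holds,
    RealExpr.eval, NatExpr.eval, rreg, rconst, clip]
  refine ⟨fun h => ⟨fun h' => ⟨?_, ⟨?_, ?_⟩, ?_, ?_⟩, fun h' => ⟨?_, ⟨?_, ?_⟩, ?_, ?_⟩⟩,
    fun h => ⟨fun h' => ⟨?_, ⟨?_, ?_⟩, ?_, ?_⟩, fun h' => ⟨?_, ⟨?_, ?_⟩, ?_, ?_⟩⟩⟩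
  any_goals
    solve
    | simp [Test.cost, RealExpr.cost, NatExpr.cost]
    | (intro j hj; rw [List.mem_singleton] at hj; simp [hj])
    | rfl
  · simp at h'; linarith
  · simp; rw [min_eq_left h.le, max_eq_right (by linarith)]
  · simp at h' ⊢; exact Or.inr h'.le
  · simp at h'; rw [min_eq_right (by linarith), max_eq_right h']

theorem wp_insert {I : Input} {s : State} {m c : ℕ} {y lam R : ℝ} (h8 : s.nat 8 = m)
    (h7 : s.nat 7 = c) (hr : s.real 12 = y) (hy0 : 0 ≤ y) (h3 : s.real 3 = lam)
    (h4 : s.real 4 = R) (hR : 0 ≤ R) :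
    WP I insert s fun s' t =>
      s'.real 5 = s.real 5 +
        s.real 15 * clip R (s.real (20 + (c * 2 ^ m + binOf (2 ^ m) y)) - lam) ∧
      s'.real (20 + (c * 2 ^ m + binOf (2 ^ m) y)) =
        s.real (20 + (c * 2 ^ m + binOf (2 ^ m) y)) + 1 ∧
      Agree [7, 9] [5, 12, 16, 20 + (c * 2 ^ m + binOf (2 ^ m) y)] s s' ∧
      s'.drawn = s.drawn ∧ t ≤ 50 * m + 100 := by
  set b := c * 2 ^ m + binOf (2 ^ m) y
  rw [insert, wp_block_cons, setN, wp_setNat, wp_block_cons]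
  refine (wp_digits (m := m) (c := c) (y := y) (by simp [NatExpr.eval])
    (by simp [NatExpr.eval, h8]) (by simp [NatExpr.eval, h7]) (by exact hr) hy0).mono ?_
  rintro s₁ t₁ ⟨e7, ⟨ea, eb⟩, ed, ht₁⟩
  have e7' : s₁.nat 7 = b := e7
  rw [wp_block_cons, setR, wp_setReal, wp_block_cons]
  refine (wp_clipCode (by simp [NatExpr.eval, eb, h4, hR])).mono ?_
  rintro s₂ t₂ ⟨f16, ⟨fa, fb⟩, fd, ht₂⟩
  have c1 : s₁.real (20 + b) = s.real (20 + b) := eb _ (by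
    simp only [List.mem_cons, List.not_mem_nil, not_or, not_false_eq_true, and_true]; omega)
  have g7 : s₂.nat 7 = b := by rw [fa _ (by simp)]; exact e7'
  have greal : ∀ j, j ∉ [12, 16] → s₂.real j = s.real j := by
    intro j hj
    simp only [List.mem_cons, List.not_mem_nil, not_or] at hj
    rw [fb j (by simp [hj])]
    simp [NatExpr.eval, hj, eb]
  have c2 : s₂.real (20 + b) = s.real (20 + b) := greal _ (by
    simp only [List.mem_cons, List.not_mem_nil, not_or, not_false_eq_true, and_true]; omega)
  have gnat : ∀ j, j ∉ [7, 9] → s₂.nat j = s.nat j := by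
    intro j hj
    rw [fa _ (by simp)]
    change s₁.nat j = _
    rw [ea j hj]
    simp only [List.mem_cons, List.not_mem_nil, not_or] at hj
    simp [NatExpr.eval, hj]
  have g16 : s₂.real 16 = clip R (s.real (20 + b) - lam) := by
    rw [f16]
    simp [NatExpr.eval, RealExpr.eval, cell, nreg, rreg, e7', c1, eb, h3, h4]
  simp only [wp_block_cons, wp_block_nil, setR, wp_setReal]
  refine ⟨?_, ?_, ⟨?_, ?_⟩, ?_, ?_⟩
  · have : (5 : ℕ) ≠ 20 + b := by omega
    simp [NatExpr.eval, RealExpr.eval, cell, nreg, rreg, this, g7, g16, greal]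
  · have : 20 + b ≠ 5 := by omega
    simp [NatExpr.eval, RealExpr.eval, cell, nreg, rreg, rconst, this, g7, c2]
  · exact gnat
  · intro j hj
    simp only [List.mem_cons, List.not_mem_nil, not_or] at hj
    have h1 : j ≠ 20 + b := hj.2.2.2.1
    simp [NatExpr.eval, RealExpr.eval, cell, nreg, rreg, rconst, g7, h1, hj.1]
    exact greal j (by simp [hj])
  · rw [fd]; exact ed
  · simp [NatExpr.cost, RealExpr.cost, cell, nreg, rreg, rconst]
    omega

/-- The piece of the current node. -/
def pieceOf (s : State) : Piece := ⟨s.real 9, s.real 10, s.real 11⟩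

theorem clog_half {n n' : ℕ} (hn : 2 ≤ n) (h : n' ≤ (n + 1) / 2) :
    Nat.clog 2 n' + 1 ≤ Nat.clog 2 n := by
  rw [Nat.clog_of_two_le one_lt_two hn]
  exact Nat.succ_le_succ (Nat.clog_mono_right 2 (by omega))

theorem wp_descend {I : Input} {s : State} {lo hi : ℕ} (h4 : s.nat 4 = lo) (h5 : s.nat 5 = hi) :
    WP I descend s fun s' t =>
      pieceOf s' = walk (fun m => I.msg (s.nat 3 + m)) (s.real 8) lo hi (pieceOf s) ∧
      Agree [4, 5, 6] [9, 10, 11, 13, 14] s s' ∧ s'.drawn = s.drawn ∧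
      t ≤ 150 * Nat.clog 2 (hi - lo) + 10 := by
  refine (wp_while_measure (fun s' => walk (fun m => I.msg (s.nat 3 + m)) (s.real 8) (s'.nat 4)
    (s'.nat 5) (pieceOf s') = walk (fun m => I.msg (s.nat 3 + m)) (s.real 8) lo hi (pieceOf s) ∧
      Agree [4, 5, 6] [9, 10, 11, 13, 14] s s' ∧ s'.drawn = s.drawn)
    (fun s' => Nat.clog 2 (s'.nat 5 - s'.nat 4)) 140 ?_ ?_).mono ?_
  · exact ⟨by rw [h4, h5], Agree.refl _ _ _, rfl⟩
  · rintro s' ⟨hw, ⟨ha, hb⟩, hd⟩ hlt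
    simp only [Test.holds, NatExpr.eval, nreg] at hlt
    have e8 : s'.real 8 = s.real 8 := hb 8 (by simp)
    have e3 : s'.nat 3 = s.nat 3 := ha 3 (by simp)
    set lo' := s'.nat 4 with hlo
    set hi' := s'.nat 5 with hhi
    simp only [wp_block_cons, wp_block_nil, setN, wp_setNat, setR, wp_setReal, wp_ite]
    refine ⟨fun hz => ⟨⟨?_, ⟨?_, ?_⟩, ?_⟩, ?_, ?_⟩, fun hz => ⟨⟨?_, ⟨?_, ?_⟩, ?_⟩, ?_, ?_⟩⟩
    · simp [Test.holds, NatExpr.eval, RealExpr.eval, nreg, rreg, ← hlo, ← hhi, e8] at hz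
      rw [← hw, walk_of_lt hlt hz]
      simp [NatExpr.eval, RealExpr.eval, nreg, rreg, ← hlo, ← hhi, e3, pieceOf, Piece.left, midFrac]
    · intro j hj
      rw [← ha j hj]
      simp only [List.mem_cons, List.not_mem_nil, not_or] at hj
      simp [NatExpr.eval, hj]
    · intro j hj
      rw [← hb j hj]
      simp only [List.mem_cons, List.not_mem_nil, not_or] at hj
      simp [NatExpr.eval, hj]
    · exact hd
    · refine clog_half (by omega) ?_
      simp [NatExpr.eval, nreg, ← hlo, ← hhi]
      omega
    · simp [Test.cost, NatExpr.cost, RealExpr.cost, nreg, rreg]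
    · simp [Test.holds, NatExpr.eval, RealExpr.eval, nreg, rreg, ← hlo, ← hhi, e8] at hz
      rw [← hw, walk_of_le hlt (not_lt.2 hz)]
      simp [NatExpr.eval, RealExpr.eval, nreg, rreg, rconst, ← hlo, ← hhi, e3, pieceOf, Piece.right,
        midFrac]
    · intro j hj
      rw [← ha j hj]
      simp only [List.mem_cons, List.not_mem_nil, not_or] at hj
      simp [NatExpr.eval, hj]
    · intro j hj
      rw [← hb j hj]
      simp only [List.mem_cons, List.not_mem_nil, not_or] at hj
      simp [NatExpr.eval, hj]
    · exact hd
    · refine clog_half (by omega) ?_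
      simp [NatExpr.eval, nreg, ← hlo, ← hhi]
      omega
    · simp [Test.cost, NatExpr.cost, RealExpr.cost, nreg, rreg, rconst]
  · rintro s' t ⟨⟨hw, ha, hd⟩, hlt, ht⟩
    simp only [Test.holds, NatExpr.eval, nreg] at hlt
    rw [walk_leaf hlt] at hw
    refine ⟨hw, ha, hd, ?_⟩
    simp [Test.cost, NatExpr.cost, nreg, h4, h5] at ht
    omega

theorem wp_locate {I : Input} {s : State} (h2 : s.nat 2 = 0) (h3 : s.nat 3 = 0)
    (hP : pieceOf s = ⟨0, 1, 1⟩) :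
    WP I locate s fun s' t =>
      pieceOf s' = attrWalk I.card (fun i m => I.msg (∑ j ∈ Finset.range i, I.card j + m))
        (fun i => if s.real 6 < 1 / 2 then (I.sample (s.nat 1) i : ℝ)
          else I.tape (s.drawn + i) * I.card i) I.attrs ∧
      Agree [2, 3, 4, 5, 6] [8, 9, 10, 11, 13, 14] s s' ∧ s'.drawn = s.drawn + I.attrs ∧
      t ≤ ∑ i ∈ Finset.range I.attrs, (150 * Nat.clog 2 (I.card i) + 100) + 4 := by
  set p : ℕ → ℕ → ℝ := fun i m => I.msg (∑ j ∈ Finset.range i, I.card j + m) with hp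
  set z : ℕ → ℝ := fun i => if s.real 6 < 1 / 2 then (I.sample (s.nat 1) i : ℝ)
    else I.tape (s.drawn + i) * I.card i with hz
  refine (wp_while_count (fun i s' => s'.nat 2 = i ∧ s'.nat 3 = ∑ j ∈ Finset.range i, I.card j ∧
    pieceOf s' = attrWalk I.card p z i ∧
      Agree [2, 3, 4, 5, 6] [8, 9, 10, 11, 13, 14] s s' ∧ s'.drawn = s.drawn + i)
    I.attrs (fun i => 150 * Nat.clog 2 (I.card i) + 90) ?_ ?_ ?_).mono ?_
  · exact ⟨h2, by simp [h3], hP, Agree.refl _ _ _, rfl⟩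
  · rintro i hi s' ⟨e2, e3, eP, ⟨ha, hb⟩, ed⟩
    refine ⟨by simp [Test.holds, NatExpr.eval, nreg, e2, hi], ?_⟩
    have e6 : s'.real 6 = s.real 6 := hb 6 (by simp)
    have e1 : s'.nat 1 = s.nat 1 := ha 1 (by simp)
    rw [wp_block_cons, wp_draw, wp_block_cons]
    have hsel : ∀ s₁ : State, s₁ = { s' with
          real := Function.update s'.real 8 (I.tape s'.drawn), drawn := s'.drawn + 1 } →
        WP I (.ite (.realLt (rreg 6) (.div (rconst 1) (rconst 2)))
          (setR 8 (.ofNat (.sample (nreg 1) (nreg 2))))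
          (setR 8 (.mul (rreg 8) (.ofNat (.card (nreg 2)))))) s₁ fun s'' t =>
          s''.real 8 = z i ∧ s''.nat = s'.nat ∧ (∀ j, j ≠ 8 → s''.real j = s'.real j) ∧
            s''.drawn = s'.drawn + 1 ∧ t ≤ 20 := by
      rintro s₁ rfl
      simp only [wp_ite, setR, wp_setReal]
      refine ⟨fun h => ⟨?_, ?_, ?_, ?_, ?_⟩, fun h => ⟨?_, ?_, ?_, ?_, ?_⟩⟩
      · simp [Test.holds, NatExpr.eval, RealExpr.eval, rreg, rconst, e6] at h
        simp [NatExpr.eval, RealExpr.eval, nreg, hz, h, e1, e2]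
      · trivial
      · intro j hj
        simp [NatExpr.eval, hj]
      · trivial
      · simp [Test.cost, NatExpr.cost, RealExpr.cost, nreg, rreg, rconst]
      · simp [Test.holds, NatExpr.eval, RealExpr.eval, rreg, rconst, e6] at h
        simp [NatExpr.eval, RealExpr.eval, nreg, rreg, hz, not_lt.2 h, e2, ed]
      · trivial
      · intro j hj
        simp [NatExpr.eval, hj]
      · trivial
      · simp [Test.cost, NatExpr.cost, RealExpr.cost, nreg, rreg, rconst]
    refine (hsel _ rfl).mono ?_
    rintro s₂ t₂ ⟨f8, fn, fr, fd, ht₂⟩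
    rw [wp_block_cons, setN, wp_setNat, wp_block_cons, setN, wp_setNat, wp_block_cons]
    refine (wp_descend (lo := 0) (hi := I.card i) (by simp [NatExpr.eval])
      (by simp [NatExpr.eval, nreg, fn, e2])).mono ?_
    rintro s₃ t₃ ⟨gP, ⟨ga, gb⟩, gd, ht₃⟩
    have gn : ∀ j, j ∉ [4, 5, 6] → s₃.nat j = s'.nat j := by
      intro j hj
      rw [ga j hj]
      simp only [List.mem_cons, List.not_mem_nil, not_or] at hj
      simp [NatExpr.eval, hj, fn]
    simp only [wp_block_cons, wp_block_nil, setN, wp_setNat]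
    refine ⟨⟨?_, ?_, ?_, ⟨?_, ?_⟩, ?_⟩, ?_⟩
    · simp [NatExpr.eval, nreg, gn, e2]
    · simp [NatExpr.eval, nreg, gn, e2, e3, Finset.sum_range_succ]
    · change pieceOf s₃ = _
      rw [gP, attrWalk, ← eP]
      simp [NatExpr.eval, fn, f8, e3, hp, pieceOf, fr]
    · intro j hj
      simp only [List.mem_cons, List.not_mem_nil, not_or] at hj
      rw [← ha j (by simp [hj]), ← gn j (by simp [hj])]
      simp [NatExpr.eval, hj]
    · intro j hj
      rw [← hb j hj]
      simp only [List.mem_cons, List.not_mem_nil, not_or] at hj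
      change s₃.real j = _
      rw [gb j (by simp [hj]), ← fr j (by simp [hj])]
    · rw [gd]
      change s₂.drawn = _
      omega
    · simp [NatExpr.cost, nreg] at ht₃ ⊢
      omega
  · rintro s' ⟨e2, -⟩
    simp [Test.holds, NatExpr.eval, nreg, e2]
  · rintro s' t ⟨⟨-, -, eP, ha, ed⟩, ht⟩
    refine ⟨eP, ha, ed, ht.trans ?_⟩
    simp only [Test.cost, NatExpr.cost, nreg]
    refine Nat.add_le_add_right (Finset.sum_le_sum fun i _ => ?_) _
    omega

namespace Input

variable (I : Input)

/-- The first cell of the random tape that is used for the sample `t`. -/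
def blockStart (t : ℕ) : ℕ := 1 + t * (I.attrs + 3)

/-- The positions towards which the descent for the sample `t` goes: those of the sample or, with
probability `1 / 2`, those of a uniform point of the domain. -/
noncomputable def target (t i : ℕ) : ℝ :=
  if I.tape (I.blockStart t) < 1 / 2 then (I.sample t i : ℝ)
  else I.tape (I.blockStart t + 2 + i) * I.card i

/-- The splitting probabilities that the message claims for the attribute `i`. -/
noncomputable def split (i m : ℕ) : ℝ := I.msg (∑ j ∈ Finset.range i, I.card j + m)

/-- The piece of the leaf that is selected for the sample `t`. -/
noncomputable def piece (t : ℕ) : Piece := attrWalk I.card I.split (I.target t) I.attrs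

/-- The point of the unit interval made from the sample `t`. -/
noncomputable def realPoint (t : ℕ) : ℝ :=
  (I.piece t).start + I.tape (I.blockStart t + 1) * (I.piece t).len

/-- The uniform point of the unit interval that is drawn along with the sample `t`. -/
noncomputable def fakePoint (t : ℕ) : ℝ := I.tape (I.blockStart t + 2 + I.attrs)

/-- The domain size. -/
def domSize : ℕ := ∏ i ∈ Finset.range I.attrs, I.card i

/-- The number of binary digits of a bin. The number of bins is a power of two, so that the machine,
which cannot round, finds the bin of a point by repeated doubling. -/
def bits : ℕ := Nat.clog 2 (binRatio * I.domSize)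

/-- The mean number of samples in a bin. -/
noncomputable def lam : ℝ := I.size / 2 ^ I.bits

/-- The bound at which the increments of the statistic are clipped. -/
noncomputable def clipBound : ℝ := 16 * √(1 + I.lam)

noncomputable def realBin (t : ℕ) : ℕ := binOf (2 ^ I.bits) (I.realPoint t)

noncomputable def fakeBin (t : ℕ) : ℕ := binOf (2 ^ I.bits) (I.fakePoint t)

/-- The inputs that occur in the protocols. -/
structure Valid : Prop where
  card_pos : ∀ i < I.attrs, 0 < I.card i
  msg_mem : ∀ j, I.msg j ∈ Set.Icc (0 : ℝ) 1
  tape_mem : ∀ j, I.tape j ∈ Set.Icc (0 : ℝ) 1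

end Input

/-- The number of indices below `t` at which the sequence `a` takes the value `x`. -/
def runCount (a : ℕ → ℕ) (t x : ℕ) : ℕ := ∑ u ∈ Finset.range t, if a u = x then 1 else 0

/-- The statistic of the first `t` terms of a sequence, accumulated term by term. -/
noncomputable def runStat (lam R : ℝ) (a : ℕ → ℕ) (t : ℕ) : ℝ :=
  ∑ u ∈ Finset.range t, clip R ((runCount a u (a u) : ℝ) - lam)

namespace Input

variable {I : Input}

theorem Valid.realPoint_mem (h : I.Valid) (t : ℕ) : I.realPoint t ∈ Set.Icc (0 : ℝ) 1 := by
  obtain ⟨h1, h2, h3, h4⟩ := attrWalk_bounds (p := I.split) (fun i m => h.msg_mem _) (I.target t)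
    h.card_pos
  have h5 := h.tape_mem (I.blockStart t + 1)
  have h6 : 0 ≤ (I.piece t).len := div_nonneg (add_nonneg h1 h2) zero_le_two
  refine ⟨add_nonneg h3 (mul_nonneg h5.1 h6), le_trans ?_ h4⟩
  exact add_le_add le_rfl (mul_le_of_le_one_left h6 h5.2)

theorem clipBound_pos (I : Input) : 0 < I.clipBound := by
  have : 0 ≤ I.lam := by unfold lam; positivity
  unfold clipBound
  positivity

/-- The state before the round `t`. -/
structure RoundInv (I : Input) (t : ℕ) (s : State) : Prop where
  out : s.nat 0 = 0
  idx : s.nat 1 = t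
  bits : s.nat 8 = I.bits
  coin : s.real 0 = I.tape 0
  bins : s.real 2 = 2 ^ I.bits
  lam : s.real 3 = I.lam
  clip : s.real 4 = I.clipBound
  stat : s.real 5 = runStat I.lam I.clipBound I.realBin t - runStat I.lam I.clipBound I.fakeBin t
  drawn : s.drawn = I.blockStart t
  realHist : ∀ x < 2 ^ I.bits, s.real (20 + (1 * 2 ^ I.bits + x)) = runCount I.realBin t x
  fakeHist : ∀ x < 2 ^ I.bits, s.real (20 + (2 * 2 ^ I.bits + x)) = runCount I.fakeBin t x

end Input

theorem runCount_succ (a : ℕ → ℕ) (t x : ℕ) :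
    runCount a (t + 1) x = runCount a t x + if a t = x then 1 else 0 :=
  Finset.sum_range_succ _ _

theorem runStat_succ (lam R : ℝ) (a : ℕ → ℕ) (t : ℕ) :
    runStat lam R a (t + 1) = runStat lam R a t + clip R ((runCount a t (a t) : ℝ) - lam) :=
  Finset.sum_range_succ _ _

/-- A bound for the time of one round. -/
def roundTime (I : Input) : ℕ :=
  ∑ i ∈ Finset.range I.attrs, (150 * Nat.clog 2 (I.card i) + 100) + 100 * I.bits + 400

set_option maxHeartbeats 800000 in
theorem wp_round {I : Input} (hI : I.Valid) {t : ℕ} {s : State} (h : I.RoundInv t s) :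
    WP I round s fun s' T => I.RoundInv (t + 1) s' ∧ T ≤ roundTime I := by
  have hR := I.clipBound_pos
  have hpow : 0 < 2 ^ I.bits := by positivity
  simp only [round, wp_block_cons, wp_draw, setN, wp_setNat, setR, wp_setReal]
  refine (wp_locate (by simp [NatExpr.eval]) (by simp [NatExpr.eval])
    (by simp [pieceOf, NatExpr.eval, RealExpr.eval, rconst])).mono ?_
  rintro s₁ t₁ ⟨aP, ⟨an, ar⟩, ad, at₁⟩
  have an' : ∀ j, j ∉ [2, 3, 4, 5, 6] → s₁.nat j = s.nat j := by
    intro j hj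
    rw [an j hj]
    simp only [List.mem_cons, List.not_mem_nil, not_or] at hj
    simp [NatExpr.eval, hj]
  have ar' : ∀ j, j ∉ [6, 7, 8, 9, 10, 11, 13, 14] → s₁.real j = s.real j := by
    intro j hj
    simp only [List.mem_cons, List.not_mem_nil, not_or] at hj
    rw [ar j (by simp [hj])]
    simp [NatExpr.eval, hj]
  have a7 : s₁.real 7 = I.tape (I.blockStart t + 1) := by
    rw [ar 7 (by simp)]
    simp [NatExpr.eval, h.drawn]
  have aP' : pieceOf s₁ = I.piece t := by
    rw [aP]
    simp only [NatExpr.eval, Input.piece]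
    congr 1
    funext i
    simp [Input.target, h.drawn, h.idx]
  have ad' : s₁.drawn = I.blockStart t + 2 + I.attrs := by
    rw [ad]
    change s.drawn + 1 + 1 + I.attrs = _
    rw [h.drawn]
  refine (wp_insert (m := I.bits) (c := 1) (y := I.realPoint t) (lam := I.lam) (R := I.clipBound)
    ?_ ?_ ?_ (hI.realPoint_mem t).1 ?_ ?_ hR.le).mono ?_
  · simp [NatExpr.eval, an', h.bits]
  · simp [NatExpr.eval]
  · have e9 : s₁.real 9 = (I.piece t).start := by rw [← aP']; rfl
    have e10 : s₁.real 10 = (I.piece t).w := by rw [← aP']; rfl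
    have e11 : s₁.real 11 = (I.piece t).g := by rw [← aP']; rfl
    simp [NatExpr.eval, RealExpr.eval, rreg, rconst, a7, e9, e10, e11, Input.realPoint, Piece.len]
  · simp [NatExpr.eval, ar', h.lam]
  · simp [NatExpr.eval, ar', h.clip]
  rintro s₂ t₂ ⟨b5, bc, ⟨bn, br⟩, bd, bt₂⟩
  have hxlt : I.realBin t < 2 ^ I.bits := binOf_lt hpow _
  have hylt : I.fakeBin t < 2 ^ I.bits := binOf_lt hpow _
  obtain ⟨X, hX⟩ : ∃ X, X = 20 + (1 * 2 ^ I.bits + I.realBin t) := ⟨_, rfl⟩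
  obtain ⟨Y, hY⟩ : ∃ Y, Y = 20 + (2 * 2 ^ I.bits + I.fakeBin t) := ⟨_, rfl⟩
  have hX' : 20 + (1 * 2 ^ I.bits + binOf (2 ^ I.bits) (I.realPoint t)) = X := hX.symm
  have hX20 : 20 ≤ X := by omega
  have hY20 : 20 ≤ Y := by omega
  have hXY : Y ≠ X := by omega
  rw [hX'] at b5 bc br
  have big : ∀ Z, 20 ≤ Z → Z ≠ 6 ∧ Z ≠ 7 ∧ Z ≠ 8 ∧ Z ≠ 9 ∧ Z ≠ 10 ∧ Z ≠ 11 ∧ Z ≠ 12 ∧ Z ≠ 13 ∧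
      Z ≠ 14 ∧ Z ≠ 15 ∧ Z ≠ 5 ∧ Z ≠ 16 := by omega
  have bX := big X hX20
  have bY := big Y hY20
  have aX : s₁.real X = s.real X := ar' X (by simp [bX])
  have bn' : ∀ j, j ∉ [2, 3, 4, 5, 6, 7, 9] → s₂.nat j = s.nat j := by
    intro j hj
    simp only [List.mem_cons, List.not_mem_nil, not_or] at hj
    rw [bn j (by simp [hj])]
    simp [NatExpr.eval, hj, an']
  have br' : ∀ j, j ∉ [5, 6, 7, 8, 9, 10, 11, 12, 13, 14, 15, 16] → j ≠ X →
      s₂.real j = s.real j := by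
    intro j hj hjX
    simp only [List.mem_cons, List.not_mem_nil, not_or] at hj
    rw [br j (by simp [hj, hjX])]
    simp [NatExpr.eval, hj, ar']
  have b5' : s₂.real 5 = s.real 5 + clip I.clipBound (s.real X - I.lam) := by
    rw [b5]
    simp [NatExpr.eval, RealExpr.eval, rconst, bX, aX, ar']
  have bc' : s₂.real X = s.real X + 1 := by
    rw [bc]
    simp [NatExpr.eval, bX, aX]
  have bd' : s₂.drawn = I.blockStart t + 2 + I.attrs := by rw [bd]; exact ad'
  refine (wp_insert (m := I.bits) (c := 2) (y := I.fakePoint t) (lam := I.lam) (R := I.clipBound)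
    ?_ ?_ ?_ (hI.tape_mem _).1 ?_ ?_ hR.le).mono ?_
  · simp [NatExpr.eval, bn', h.bits]
  · simp [NatExpr.eval]
  · simp [NatExpr.eval, bd', Input.fakePoint]
  · have : 3 ≠ X := by omega
    simp [NatExpr.eval, br', h.lam, this]
  · have : 4 ≠ X := by omega
    simp [NatExpr.eval, br', h.clip, this]
  rintro s₃ t₃ ⟨c5, cc, ⟨cn, cr⟩, cd, ct₃⟩
  have hY' : 20 + (2 * 2 ^ I.bits + binOf (2 ^ I.bits) (I.fakePoint t)) = Y := hY.symm
  rw [hY'] at c5 cc cr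
  have bY' : s₂.real Y = s.real Y := br' Y (by simp [bY]) hXY
  have cn' : ∀ j, j ∉ [2, 3, 4, 5, 6, 7, 9] → s₃.nat j = s.nat j := by
    intro j hj
    simp only [List.mem_cons, List.not_mem_nil, not_or] at hj
    rw [cn j (by simp [hj])]
    simp [NatExpr.eval, hj, bn']
  have cr' : ∀ j, j ∉ [5, 6, 7, 8, 9, 10, 11, 12, 13, 14, 15, 16] → j ≠ X → j ≠ Y →
      s₃.real j = s.real j := by
    intro j hj hjX hjY
    simp only [List.mem_cons, List.not_mem_nil, not_or] at hj
    rw [cr j (by simp [hj, hjY])]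
    simp [NatExpr.eval, hj, br', hjX]
  have cX : s₃.real X = s.real X + 1 := by
    rw [cr X (by simp [bX, hXY.symm])]
    simp [NatExpr.eval, bX, bc']
  have cY : s₃.real Y = s.real Y + 1 := by
    rw [cc]
    simp [NatExpr.eval, bY, bY']
  have c5' : s₃.real 5 = s.real 5 + clip I.clipBound (s.real X - I.lam) -
      clip I.clipBound (s.real Y - I.lam) := by
    rw [c5]
    simp [NatExpr.eval, RealExpr.eval, rconst, bY, bY', b5']
    ring
  have regs : ∀ j, j < 5 → s₃.real j = s.real j := fun j hj =>
    cr' j (by simp only [List.mem_cons, List.not_mem_nil, not_or, not_false_eq_true, and_true]; omega) (by omega) (by omega)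
  have hsX : s.real X = runCount I.realBin t (I.realBin t) := by rw [hX, h.realHist _ hxlt]
  have hsY : s.real Y = runCount I.fakeBin t (I.fakeBin t) := by rw [hY, h.fakeHist _ hylt]
  simp only [wp_block_nil]
  refine ⟨⟨?_, ?_, ?_, ?_, ?_, ?_, ?_, ?_, ?_, ?_, ?_⟩, ?_⟩
  · simp [NatExpr.eval, cn', h.out]
  · simp [NatExpr.eval, nreg, cn', h.idx]
  · simp [NatExpr.eval, cn', h.bits]
  · rw [← h.coin, ← regs 0 (by simp)]
  · rw [← h.bins, ← regs 2 (by simp)]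
  · rw [← h.lam, ← regs 3 (by simp)]
  · rw [← h.clip, ← regs 4 (by simp)]
  · rw [runStat_succ, runStat_succ, ← hsX, ← hsY]
    change s₃.real 5 = _
    rw [c5', h.stat]
    ring
  · change s₃.drawn = _
    rw [cd]
    change s₂.drawn + 1 = _
    rw [bd', Input.blockStart, Input.blockStart]
    ring
  · intro x hx
    change s₃.real _ = _
    rw [runCount_succ]
    by_cases hxe : I.realBin t = x
    · rw [if_pos hxe, ← hxe, ← hX, cX, hsX]
      push_cast; ring
    · rw [if_neg hxe, cr' _ (by
        simp only [List.mem_cons, List.not_mem_nil, not_or, not_false_eq_true, and_true]; omega) (by omega) (by omega),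
        h.realHist x hx, add_zero]
  · intro x hx
    change s₃.real _ = _
    rw [runCount_succ]
    by_cases hxe : I.fakeBin t = x
    · rw [if_pos hxe, ← hxe, ← hY, cY, hsY]
      push_cast; ring
    · rw [if_neg hxe, cr' _ (by
        simp only [List.mem_cons, List.not_mem_nil, not_or, not_false_eq_true, and_true]; omega) (by omega) (by omega),
        h.fakeHist x hx, add_zero]
  · simp only [NatExpr.cost, RealExpr.cost, nreg, rreg, rconst, roundTime]
    clear * - at₁ bt₂ ct₃
    omega

/-- The result of the verifier's computation, and a bound for its time. -/
theorem wp_verifier {I : Input} (hI : I.Valid) :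
    WP I verifier State.init fun s t =>
      (s.nat 0 = 1 ↔ I.tape 0 < 1 / (1 + Real.exp (I.eps / (2 * I.clipBound) *
        (runStat I.lam I.clipBound I.realBin I.size - runStat I.lam I.clipBound I.fakeBin I.size -
          I.size * I.size * (I.sigma * I.sigma) / (64 * 2 ^ I.bits))))) ∧
      t ≤ I.size * (roundTime I + 10) + 50 * I.attrs + 50 * I.bits + 200 := by
  have hR := I.clipBound_pos
  simp only [verifier, wp_block_cons, wp_draw, setR, wp_setReal]
  refine (wp_while_count (fun i s => s.nat 2 = i ∧ s.nat 0 = 0 ∧ s.nat 1 = 0 ∧ s.nat 8 = 0 ∧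
      s.real 0 = I.tape 0 ∧ s.real 1 = ∏ j ∈ Finset.range i, (I.card j : ℝ) ∧ s.drawn = 1 ∧
      s.real 5 = 0 ∧ ∀ j, 20 ≤ j → s.real j = 0) I.attrs (fun _ => 20) ?_ ?_ ?_).mono ?_
  · have : ∀ j, 20 ≤ j → j ≠ 0 ∧ j ≠ 1 := by omega
    simp [State.init, NatExpr.eval, RealExpr.eval, rconst, Function.update_apply]
    intro j hj
    simp [this j hj]
  · rintro i hi s ⟨h2, h0, h1, h8, r0, r1, hd, r5, rb⟩
    refine ⟨by simp [Test.holds, NatExpr.eval, nreg, h2, hi], ?_⟩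
    simp only [wp_block_cons, wp_block_nil, setN, setR, wp_setNat, wp_setReal]
    refine ⟨⟨?_, ?_, ?_, ?_, ?_, ?_, ?_, ?_, ?_⟩, ?_⟩
    · simp [NatExpr.eval, nreg, h2]
    · simp [NatExpr.eval, h0]
    · simp [NatExpr.eval, h1]
    · simp [NatExpr.eval, h8]
    · simp [NatExpr.eval, r0]
    · simp [NatExpr.eval, RealExpr.eval, rreg, nreg, r1, h2, Finset.prod_range_succ]
    · exact hd
    · simp [NatExpr.eval, r5]
    · intro j hj
      have : j ≠ 1 := by omega
      simp [NatExpr.eval, this, rb j hj]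
    · simp [NatExpr.cost, RealExpr.cost, rreg, nreg]
  · rintro s ⟨h2, -⟩
    simp [Test.holds, NatExpr.eval, nreg, h2]
  rintro s t ⟨⟨h2, h0, h1, h8, r0, r1, hd, r5, rb⟩, ht⟩
  rw [← Nat.cast_prod] at r1
  change s.real 1 = (I.domSize : ℝ) at r1
  refine (wp_while_count (fun i s => s.nat 0 = 0 ∧ s.nat 1 = 0 ∧ s.nat 8 = i ∧
      s.real 0 = I.tape 0 ∧ s.real 1 = I.domSize ∧ s.real 2 = 2 ^ i ∧ s.drawn = 1 ∧
      s.real 5 = 0 ∧ ∀ j, 20 ≤ j → s.real j = 0) I.bits (fun _ => 20) ?_ ?_ ?_).mono ?_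
  · refine ⟨h0, h1, h8, ?_, ?_, ?_, hd, ?_, ?_⟩
    · simp [NatExpr.eval, r0]
    · simp [NatExpr.eval, r1]
    · simp [NatExpr.eval, RealExpr.eval, rconst]
    · simp [NatExpr.eval, r5]
    · intro j hj
      have : j ≠ 2 := by omega
      simp [NatExpr.eval, this, rb j hj]
  · rintro i hi s ⟨h0, h1, h8, r0, r1, r2, hd, r5, rb⟩
    refine ⟨?_, ?_⟩
    · have : 2 ^ i < binRatio * I.domSize := (Nat.lt_clog_iff_pow_lt one_lt_two).1 hi
      have : ((2 ^ i : ℕ) : ℝ) < ((binRatio * I.domSize : ℕ) : ℝ) := Nat.cast_lt.2 this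
      push_cast at this
      simpa [Test.holds, NatExpr.eval, RealExpr.eval, rreg, rconst, r1, r2] using this
    simp only [wp_block_cons, wp_block_nil, setN, setR, wp_setNat, wp_setReal]
    refine ⟨⟨?_, ?_, ?_, ?_, ?_, ?_, ?_, ?_, ?_⟩, ?_⟩
    · simp [NatExpr.eval, h0]
    · simp [NatExpr.eval, h1]
    · simp [NatExpr.eval, nreg, h8]
    · simp [NatExpr.eval, r0]
    · simp [NatExpr.eval, r1]
    · simp [NatExpr.eval, RealExpr.eval, rreg, r2, pow_succ]; ring
    · exact hd
    · simp [NatExpr.eval, r5]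
    · intro j hj
      have : j ≠ 2 := by omega
      simp [NatExpr.eval, this, rb j hj]
    · simp [NatExpr.cost, RealExpr.cost, rreg, nreg]
  · rintro s ⟨h0, h1, h8, r0, r1, r2, -⟩
    have : binRatio * I.domSize ≤ 2 ^ I.bits := Nat.le_pow_clog one_lt_two _
    have : ((binRatio * I.domSize : ℕ) : ℝ) ≤ ((2 ^ I.bits : ℕ) : ℝ) := Nat.cast_le.2 this
    push_cast at this
    simpa [Test.holds, NatExpr.eval, RealExpr.eval, rreg, rconst, r1, r2] using this
  rintro s' t' ⟨⟨h0, h1, h8, r0, r1, r2, hd, r5, rb⟩, ht'⟩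
  refine (wp_while_count (fun i s => I.RoundInv i s) I.size (fun _ => roundTime I) ?_ ?_ ?_).mono ?_
  · have hlam : (I.size : ℝ) / 2 ^ I.bits = I.lam := rfl
    have hpos : 0 < 1 + I.lam := by have : 0 ≤ I.lam := (by unfold Input.lam; positivity); linarith
    refine ⟨h0, h1, h8, ?_, ?_, ?_, ?_, ?_, ?_, ?_, ?_⟩
    · simp [NatExpr.eval, r0]
    · simp [NatExpr.eval, r2]
    · simp [NatExpr.eval, RealExpr.eval, rreg, r2, hlam]
    · simp [NatExpr.eval, RealExpr.eval, rreg, rconst, r2, hlam, Input.clipBound, Real.exp_half,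
        Real.exp_log hpos]
    · simp [NatExpr.eval, r5, runStat]
    · simp [hd, Input.blockStart]
    · intro x hx
      have h3 : 20 + (1 * 2 ^ I.bits + x) ≠ 3 := by omega
      have h4 : 20 + (1 * 2 ^ I.bits + x) ≠ 4 := by omega
      simp only [NatExpr.eval, Function.update_of_ne h3, Function.update_of_ne h4, rb _
        (Nat.le_add_right _ _)]
      simp [runCount]
    · intro x hx
      have h3 : 20 + (2 * 2 ^ I.bits + x) ≠ 3 := by omega
      have h4 : 20 + (2 * 2 ^ I.bits + x) ≠ 4 := by omega
      simp only [NatExpr.eval, Function.update_of_ne h3, Function.update_of_ne h4, rb _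
        (Nat.le_add_right _ _)]
      simp [runCount]
  · intro i hi s hs
    exact ⟨by simp [Test.holds, NatExpr.eval, nreg, hs.idx, hi], wp_round hI hs⟩
  · intro s hs
    simp [Test.holds, NatExpr.eval, nreg, hs.idx]
  rintro s'' t'' ⟨hs, ht''⟩
  have hacc : acceptExpr.eval I s'' = 1 / (1 + Real.exp (I.eps / (2 * I.clipBound) *
        (runStat I.lam I.clipBound I.realBin I.size - runStat I.lam I.clipBound I.fakeBin I.size -
          I.size * I.size * (I.sigma * I.sigma) / (64 * 2 ^ I.bits)))) := by
    simp [acceptExpr, RealExpr.eval, NatExpr.eval, rreg, rconst, hs.clip, hs.stat, hs.bins]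
  have hcost : t + (t' + t'') ≤ I.size * (roundTime I + 10) + 50 * I.attrs + 50 * I.bits + 50 := by
    simp only [Test.cost, NatExpr.cost, RealExpr.cost, nreg, rreg, rconst, Finset.sum_const,
      Finset.card_range, smul_eq_mul] at ht ht' ht''
    have : I.size * (1 + 1 + 1 + 1 + roundTime I) ≤ I.size * (roundTime I + 10) :=
      Nat.mul_le_mul_left _ (by omega)
    omega
  rw [wp_ite]
  refine ⟨fun hlt => ?_, fun hlt => ?_⟩
  · simp only [Test.holds, hacc] at hlt
    simp only [setN, wp_setNat, wp_block_nil]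
    refine ⟨iff_of_true (by simp [NatExpr.eval]) ?_, ?_⟩
    · simpa [RealExpr.eval, NatExpr.eval, rreg, hs.coin] using hlt
    · simp [Test.cost, NatExpr.cost, RealExpr.cost, rreg, rconst, acceptExpr]
      omega
  · simp only [Test.holds, hacc] at hlt
    simp only [wp_skip, wp_block_nil]
    refine ⟨iff_of_false (by simp [hs.out]) ?_, ?_⟩
    · simpa [RealExpr.eval, NatExpr.eval, rreg, hs.coin] using hlt
    · simp [Test.cost, NatExpr.cost, RealExpr.cost, rreg, rconst, acceptExpr]
      omega

/-! ### The statistic and expectations under product measures -/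

/-- The statistic that is accumulated term by term is the statistic of the whole histogram. -/
theorem runStat_eq_stat (lam R : ℝ) {M n : ℕ} (a : ℕ → ℕ) (X : Fin n → Fin M)
    (h : ∀ t : Fin n, a t = X t) : runStat lam R a n = stat lam R X := by
  induction n with
  | zero => simp [runStat, stat, count, cellFun]
  | succ n ih =>
    have e : X = (Fin.last n).insertNth (X (Fin.last n)) fun t => X t.castSucc := by
      rw [Fin.insertNth_last']
      exact (Fin.snoc_init_self X).symm
    rw [runStat_succ, ih (fun t => X t.castSucc) fun t => h t.castSucc, e, stat_insertNth]
    have h1 : a n = X (Fin.last n) := h (Fin.last n)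
    have h2 : runCount a n (a n) = count (fun t : Fin n => X t.castSucc) (X (Fin.last n)) := by
      rw [runCount, count, ← Fin.sum_univ_eq_sum_range (fun u => if a u = a n then 1 else 0)]
      refine Finset.sum_congr rfl fun t _ => ?_
      rw [h1, show a t = X t.castSucc from h t.castSucc]
      simp only [Fin.val_inj]
    rw [h2]
    simp

theorem pi_real_eq_prodE {α : Type*} [Fintype α] [MeasurableSpace α] [MeasurableSingletonClass α]
    (μ : Measure α) [IsProbabilityMeasure μ] (n : ℕ) (A : Set (Fin n → α)) :
    (Measure.pi fun _ : Fin n => μ).real A = prodE (fun a => μ.real {a}) n (A.indicator 1) := by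
  classical
  have h : A = (Set.toFinset A : Set (Fin n → α)) := by simp
  conv_lhs => rw [h]
  rw [← sum_measureReal_singleton, prodE]
  simp only [Set.indicator_apply, Pi.one_apply, mul_ite, mul_one, mul_zero]
  rw [← Finset.sum_filter]
  refine Finset.sum_congr (by ext; simp) fun X _ => ?_
  rw [measureReal_def, Measure.pi_singleton, ENNReal.toReal_prod]
  rfl

/-! ### The law of the random tape -/

/-- What the verifier draws for one sample: a coin, the position within a piece, the point for the
comparison, and one point for each attribute. -/
abbrev Slot (d : ℕ) : Type := Fin 3 ⊕ Fin d

/-- The place of a slot within the cells of the tape that belong to one sample. -/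
def slotPos (d : ℕ) : Slot d → ℕ
  | .inl a => ![0, 1, 2 + d] a
  | .inr i => 2 + i

/-- The cell of the tape for the sample `t` and a slot. -/
def slotIdx (d t : ℕ) (s : Slot d) : ℕ := 1 + t * (d + 3) + slotPos d s

theorem slotPos_lt (d : ℕ) (s : Slot d) : slotPos d s < d + 3 := by
  rcases s with a | i
  · fin_cases a <;> simp [slotPos]
    omega
  · simp only [slotPos]; omega

theorem slotPos_injective (d : ℕ) : Function.Injective (slotPos d) := by
  rintro (a | i) (b | j) h
  · fin_cases a <;> fin_cases b <;> simp [slotPos] at h ⊢ <;> omega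
  · fin_cases a <;> simp [slotPos] at h <;> omega
  · fin_cases b <;> simp [slotPos] at h <;> omega
  · simp only [slotPos] at h
    rw [Fin.ext (by omega : (i : ℕ) = j)]

theorem slotIdx_injective (d : ℕ) : Function.Injective fun q : ℕ × Slot d => slotIdx d q.1 q.2 := by
  rintro ⟨t, s⟩ ⟨t', s'⟩ h
  have h1 := slotPos_lt d s
  have h2 := slotPos_lt d s'
  have h3 : slotPos d s + (d + 3) * t = slotPos d s' + (d + 3) * t' := by
    simp only [slotIdx] at h
    linarith
  have h4 := congrArg (· % (d + 3)) h3
  simp only [Nat.add_mul_mod_self_left, Nat.mod_eq_of_lt h1, Nat.mod_eq_of_lt h2] at h4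
  rw [h4, Nat.add_left_cancel_iff] at h3
  exact Prod.ext (Nat.eq_of_mul_eq_mul_left (by omega) h3) (slotPos_injective d h4)

instance : IsProbabilityMeasure tapeMeasure := by unfold tapeMeasure; infer_instance

/-- The samples, each with its own part of the tape, are independent and identically distributed. -/
theorem map_samples {Ω : Type*} [MeasurableSpace Ω] (D : Measure Ω) [IsProbabilityMeasure D]
    (d n : ℕ) :
    ((Measure.pi fun _ : Fin n => D).prod tapeMeasure).map
      (fun z t => (z.1 t, fun s => z.2 (slotIdx d t s))) =
    Measure.pi fun _ : Fin n => D.prod (Measure.pi fun _ : Slot d => (volume : Measure unitInterval)) := by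
  have h1 : tapeMeasure.map (fun ω (q : Fin n × Slot d) => ω (slotIdx d q.1 q.2)) =
      Measure.infinitePi fun _ : Fin n × Slot d => (volume : Measure unitInterval) :=
    Measure.map_infinitePi_infinitePi_of_inj (P := fun _ : ℕ => (volume : Measure unitInterval))
      (f := fun q : Fin n × Slot d => slotIdx d q.1 q.2) fun q q' h => by
      have := slotIdx_injective d (a₁ := ((q.1 : ℕ), q.2)) (a₂ := ((q'.1 : ℕ), q'.2)) h
      simp only [Prod.mk.injEq, Fin.val_inj] at this
      exact Prod.ext this.1 this.2
  have h2 : tapeMeasure.map (fun ω (t : Fin n) (s : Slot d) => ω (slotIdx d t s)) =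
      Measure.pi fun _ : Fin n => Measure.pi fun _ : Slot d => (volume : Measure unitInterval) := by
    have := Measure.infinitePi_map_curry fun (_ : Fin n) (_ : Slot d) =>
      (volume : Measure unitInterval)
    rw [← h1, Measure.map_map (by fun_prop) (by fun_prop)] at this
    simp only [Measure.infinitePi_eq_pi] at this
    exact this
  have h3 := (measurePreserving_arrowProdEquivProdArrow Ω (Slot d → unitInterval) (Fin n)
    (fun _ => D) fun _ => Measure.pi fun _ => volume).symm
  rw [← h3.map_eq, ← h2]
  have h4 := Measure.map_prod_map (Measure.pi fun _ : Fin n => D) tapeMeasure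
    (measurable_id) (show Measurable fun (ω : ℕ → unitInterval) (t : Fin n) (s : Slot d) =>
      ω (slotIdx d t s) by fun_prop)
  rw [Measure.map_id] at h4
  rw [h4, Measure.map_map (by fun_prop) (by fun_prop)]
  rfl

/-! ### The law of the bin of one sample -/

@[fun_prop]
theorem measurable_binOf (M : ℕ) : Measurable (binOf M) := by
  unfold binOf
  exact ((Nat.measurable_floor.comp (measurable_id.mul_const _))).min measurable_const

theorem binFrac_unit {M j : ℕ} (hj : j < M) : binFrac M 0 1 j = 1 / M := by
  simpa [binFrac, Piece.len] using clamp_root hj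

theorem volume_binOf_unit {M j : ℕ} (hj : j < M) :
    (volume : Measure unitInterval).real {v | binOf M v = j} = 1 / M := by
  rw [← binFrac_unit hj, ← volume_binOf_eq hj le_rfl one_pos (by norm_num)]
  simp

/-- The uniform law on the coins of one sample. -/
noncomputable abbrev slotMeasure (d : ℕ) : Measure (Slot d → unitInterval) :=
  Measure.pi fun _ => volume

section OneSample

variable {d : ℕ} {k : Fin d → ℕ} (hk : ∀ i, 0 < k i)

/-- The point of the domain that one sample and its coins select: the sample itself or, with
probability `1 / 2`, a uniform point. -/
noncomputable def leafOf (z : Domain k × (Slot d → unitInterval)) : Domain k :=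
  if (z.2 (.inl 0) : ℝ) < 1 / 2 then z.1
  else fun i => ⟨binOf (k i) (z.2 (.inr i)), binOf_lt (hk i) _⟩

theorem measurable_leafOf : Measurable (leafOf hk) := by
  refine Measurable.ite (measurableSet_lt (by fun_prop) measurable_const) measurable_fst ?_
  refine measurable_pi_lambda _ fun i => ?_
  refine measurable_to_countable' fun a => ?_
  have : Measurable fun z : Domain k × (Slot d → unitInterval) => binOf (k i) (z.2 (.inr i)) := by
    fun_prop
  convert this (measurableSet_singleton (a : ℕ)) using 1
  ext z
  simp [Fin.ext_iff]

/-- The selected leaf has the mixture of `D` and the uniform distribution as its law, and is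
independent of the position within the piece. -/
theorem leafOf_rect (D : Measure (Domain k)) [IsProbabilityMeasure D] (x : Domain k)
    {S : Set unitInterval} (hS : MeasurableSet S) :
    (D.prod (slotMeasure d)).real {z | leafOf hk z = x ∧ z.2 (.inl 1) ∈ S} =
      (D.real {x} + 1 / domainSize k) / 2 * (volume : Measure unitInterval).real S := by
  set half : unitInterval := ⟨1 / 2, by norm_num, by norm_num⟩
  have e : {z : Domain k × (Slot d → unitInterval) | leafOf hk z = x ∧ z.2 (.inl 1) ∈ S} =
      ({x} ×ˢ Set.univ.pi (Sum.elim ![Set.Iio half, S, Set.univ] fun _ => Set.univ)) ∪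
      (Set.univ ×ˢ Set.univ.pi (Sum.elim ![Set.Ici half, S, Set.univ]
        fun i => {u | binOf (k i) u = x i})) := by
    ext z
    have h0 : z.2 (.inl 0) < half ↔ (z.2 (.inl 0) : ℝ) < 1 / 2 := Iff.rfl
    have h1 : half ≤ z.2 (.inl 0) ↔ ¬ (z.2 (.inl 0) : ℝ) < 1 / 2 := by rw [← h0, not_lt]
    by_cases h : (z.2 (.inl 0) : ℝ) < 1 / 2 <;>
      simp [leafOf, h, h0, h1, Set.mem_pi, Fin.forall_fin_succ, funext_iff, Fin.ext_iff,
        and_comm, -one_div]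
  have m2 : MeasurableSet ((Set.univ : Set (Domain k)) ×ˢ Set.univ.pi (Sum.elim
      ![Set.Ici half, S, Set.univ] fun i => {u : unitInterval | binOf (k i) u = x i})) := by
    refine MeasurableSet.univ.prod (MeasurableSet.univ_pi ?_)
    rintro (a | i)
    · fin_cases a
      exacts [measurableSet_Ici, hS, .univ]
    · have : Measurable fun u : unitInterval => binOf (k i) u := by fun_prop
      exact this (measurableSet_singleton (x i : ℕ))
  have hd : Disjoint
      (({x} : Set (Domain k)) ×ˢ Set.univ.pi (Sum.elim ![Set.Iio half, S, Set.univ] fun _ : Fin d => Set.univ))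
      (Set.univ ×ˢ Set.univ.pi (Sum.elim ![Set.Ici half, S, Set.univ]
        fun i => {u | binOf (k i) u = x i})) := by
    rw [Set.disjoint_left]
    rintro z ⟨-, h1⟩ ⟨-, h2⟩
    have h1 := h1 (.inl 0) trivial
    have h2 := h2 (.inl 0) trivial
    exact absurd (Set.mem_Ici.1 h2) (not_le.2 (Set.mem_Iio.1 h1))
  rw [e, measureReal_union hd m2, measureReal_prod_prod, measureReal_prod_prod]
  have hhalf : (volume : Measure unitInterval).real (Set.Iio half) = 1 / 2 := by
    simp [measureReal_def, half]
  have hhalf' : (volume : Measure unitInterval).real (Set.Ici half) = 1 / 2 := by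
    simp only [measureReal_def, unitInterval.volume_Ici, half]
    rw [ENNReal.toReal_ofReal (by norm_num)]; norm_num
  have hpi : ∀ (A : Fin 3 → Set unitInterval) (B : Fin d → Set unitInterval),
      (slotMeasure d).real (Set.univ.pi (Sum.elim A B)) =
      (∏ a, (volume : Measure unitInterval).real (A a)) *
        ∏ i, (volume : Measure unitInterval).real (B i) := by
    intro A B
    simp only [measureReal_def, Measure.pi_pi, Fintype.prod_sum_type, ENNReal.toReal_mul,
      ENNReal.toReal_prod, Sum.elim_inl, Sum.elim_inr]
  have hu : ∀ i, (volume : Measure unitInterval).real {u | binOf (k i) u = x i} = 1 / k i :=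
    fun i => volume_binOf_unit (x i).2
  simp only [hpi, Fin.prod_univ_three, hu, Matrix.cons_val, hhalf, hhalf', probReal_univ,
    Finset.prod_const_one, Finset.prod_div_distrib]
  simp only [domainSize, Nat.cast_prod]
  ring

variable (K : ℕ → ℕ) (s : ℕ → ℕ → ℝ) {M : ℕ} (hM : 0 < M)

/-- The piece of a point of the domain. -/
noncomputable def leafPiece (x : Domain k) : Piece := attrWalk K s (position x) d

/-- The bin of the point at the position `v` of the piece of `x`. -/
noncomputable def binAt (x : Domain k) (v : unitInterval) : Fin M :=
  ⟨binOf M ((leafPiece K s x).start + v * (leafPiece K s x).len), binOf_lt hM _⟩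

theorem measurable_binAt (x : Domain k) : Measurable (binAt K s hM x) := by
  refine measurable_to_countable' fun j => ?_
  have : Measurable fun v : unitInterval =>
      binOf M ((leafPiece K s x).start + v * (leafPiece K s x).len) := by fun_prop
  convert this (measurableSet_singleton (j : ℕ)) using 1
  ext z
  simp [binAt, Fin.ext_iff]

/-- The bin of one sample. -/
noncomputable def sampleBin (z : Domain k × (Slot d → unitInterval)) : Fin M :=
  binAt K s hM (leafOf hk z) (z.2 (.inl 1))

/-- The simulated uniform bin that is drawn along with one sample. -/
noncomputable def compareBin (z : Domain k × (Slot d → unitInterval)) : Fin M :=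
  ⟨binOf M (z.2 (.inl 2)), binOf_lt hM _⟩

theorem measurable_binAt_prod :
    Measurable fun q : Domain k × unitInterval => binAt K s hM q.1 q.2 :=
  measurable_from_prod_countable_right fun x => measurable_binAt K s hM x

theorem measurable_leafOf_prod : Measurable fun z : Domain k × (Slot d → unitInterval) =>
    (leafOf hk z, z.2 (.inl 1)) := by
  apply (measurable_leafOf hk).prodMk
  fun_prop

theorem measurable_sampleBin : Measurable (sampleBin hk K s hM) := by
  have e : sampleBin hk K s hM = (fun q : Domain k × unitInterval => binAt K s hM q.1 q.2) ∘
      fun z => (leafOf hk z, z.2 (.inl 1)) := by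
    funext z
    rfl
  rw [e]
  exact (measurable_binAt_prod K s hM).comp (measurable_leafOf_prod hk)

theorem measurable_compareBin : Measurable (compareBin (k := k) hM) := by
  refine measurable_to_countable' fun j => ?_
  have : Measurable fun z : Domain k × (Slot d → unitInterval) => binOf M (z.2 (.inl 2)) := by
    fun_prop
  convert this (measurableSet_singleton (j : ℕ)) using 1
  ext z
  simp [compareBin, Fin.ext_iff]

/-- The simulated bins are uniform. -/
theorem compareBin_law (D : Measure (Domain k)) [IsProbabilityMeasure D] (j : Fin M) :
    ((D.prod (slotMeasure d)).map (compareBin hM)).real {j} = 1 / M := by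
  rw [map_measureReal_apply (measurable_compareBin hM) (measurableSet_singleton j)]
  have : (compareBin (k := k) hM) ⁻¹' {j} = Set.univ ×ˢ ((fun ζ : Slot d → unitInterval =>
      ζ (.inl 2)) ⁻¹' {v | binOf M v = j}) := by
    ext z; simp [compareBin, Fin.ext_iff]
  rw [this, measureReal_prod_prod, probReal_univ, one_mul, ← volume_binOf_unit j.2]
  have hm : Measurable fun v : unitInterval => binOf M v := by fun_prop
  exact (measurePreserving_eval (fun _ : Slot d => (volume : Measure unitInterval))
    (.inl 2)).measureReal_preimage (hm (measurableSet_singleton (j : ℕ))).nullMeasurableSet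

variable {K s} (hK : ∀ i : Fin d, K i = k i)
include hK

include hk in
theorem leafPiece_g (x : Domain k) : (leafPiece K s x).g = 1 / domainSize k := by
  rw [leafPiece, attrWalk_g fun i hi => (hK ⟨i, hi⟩).symm ▸ hk ⟨i, hi⟩, domainSize, Nat.cast_prod,
    ← Fin.prod_univ_eq_prod_range (fun i => (K i : ℝ))]
  simp only [hK]

theorem leafPiece_w (x : Domain k) :
    (leafPiece K s x).w = ∏ i : Fin d, leafProb (s i) ((x i : ℕ) : ℝ) 0 (k i) := by
  rw [leafPiece, attrWalk_w, ← Fin.prod_univ_eq_prod_range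
    (fun i => leafProb (s i) (position x i) 0 (K i))]
  exact Finset.prod_congr rfl fun i _ => by simp [hK, position]

theorem sum_leafPiece (hk : ∀ i, 0 < k i) {Ψ : Piece → ℝ}
    (hΨ : ∀ P p r, Ψ P = Ψ (P.left p r) + Ψ (P.right p r)) :
    ∑ x : Domain k, Ψ (leafPiece K s x) = Ψ ⟨0, 1, 1⟩ := by
  obtain rfl : (fun i : Fin d => K i) = k := funext hK
  exact sum_attrWalk hΨ (fun i hi => hk ⟨i, hi⟩) s

variable (hs : ∀ i m, s i m ∈ Set.Icc (0 : ℝ) 1)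
include hs

include hk in
/-- The pieces lie in the unit interval, and none is shorter than half of the uniform weight, because
the uniform distribution is mixed in. -/
theorem leafPiece_bounds (x : Domain k) : 0 ≤ (leafPiece K s x).start ∧
    (leafPiece K s x).start + (leafPiece K s x).len ≤ 1 ∧
    1 / (2 * domainSize k) ≤ (leafPiece K s x).len ∧ 0 < (leafPiece K s x).len := by
  have hN : 0 < (domainSize k : ℝ) := by
    exact_mod_cast Finset.prod_pos fun i _ => hk i
  obtain ⟨h1, h2, h3, h4⟩ := attrWalk_bounds (d := d) hs (position x)
    fun i hi => (hK ⟨i, hi⟩).symm ▸ hk ⟨i, hi⟩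
  have h5 : 1 / (2 * domainSize k) ≤ (leafPiece K s x).len := by
    rw [Piece.len, leafPiece_g hk hK]
    have : 1 / (2 * (domainSize k : ℝ)) = (0 + 1 / domainSize k) / 2 := by field_simp; ring
    rw [this]
    gcongr
    exact h1
  exact ⟨h3, h4, h5, lt_of_lt_of_le (by positivity) h5⟩

/-- The law of the bin: each piece spreads the weight of its leaf over the bins that it meets. -/
theorem sampleBin_law (D : Measure (Domain k)) [IsProbabilityMeasure D] (j : Fin M) :
    ((D.prod (slotMeasure d)).map (sampleBin hk K s hM)).real {j} =
      ∑ x, (D.real {x} + 1 / domainSize k) / 2 *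
        binFrac M (leafPiece K s x).start (leafPiece K s x).len j := by
  rw [map_measureReal_apply (measurable_sampleBin hk K s hM) (measurableSet_singleton j)]
  have e : sampleBin hk K s hM ⁻¹' {j} = ⋃ x ∈ (Finset.univ : Finset (Domain k)),
      {z | leafOf hk z = x ∧ z.2 (.inl 1) ∈ binAt K s hM x ⁻¹' {j}} := by
    ext z; simp [sampleBin]
  have hS : ∀ x : Domain k, MeasurableSet (binAt K s hM x ⁻¹' {j}) := fun x =>
    measurable_binAt K s hM x (measurableSet_singleton j)
  rw [e, measureReal_biUnion_finset]
  · refine Finset.sum_congr rfl fun x _ => ?_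
    rw [leafOf_rect hk D x (hS x)]
    obtain ⟨h1, h2, -, h4⟩ := leafPiece_bounds hk hK hs x
    rw [← volume_binOf_eq j.2 h1 h4 h2]
    congr 2
    ext v
    simp [binAt, Fin.ext_iff]
  · intro x _ y _ hxy
    rw [Function.onFun, Set.disjoint_left]
    rintro z ⟨h1, -⟩ ⟨h2, -⟩
    exact hxy (h1.symm.trans h2)
  · intro x _
    exact (measurable_leafOf hk (measurableSet_singleton x)).inter
      ((by fun_prop : Measurable fun z : Domain k × (Slot d → unitInterval) => z.2 (.inl 1)) (hS x))

include hk in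
/-- The pieces cover every bin exactly once. -/
theorem sum_len_binFrac (j : Fin M) : ∑ x : Domain k,
    (leafPiece K s x).len * binFrac M (leafPiece K s x).start (leafPiece K s x).len j = 1 / M := by
  rw [← clamp_root j.2, ← sum_leafPiece hK hk (s := s) fun P p r => clamp_additive _ _ P p r]
  exact Finset.sum_congr rfl fun x _ => len_mul_binFrac (leafPiece_bounds hk hK hs x).2.2.2

/-- If the message tells the truth, the bin of a sample is uniform. -/
theorem sampleBin_law_of_eq (D : Measure (Domain k)) [IsProbabilityMeasure D]
    (hD : ∀ x, D.real {x} = (leafPiece K s x).w) (j : Fin M) :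
    ((D.prod (slotMeasure d)).map (sampleBin hk K s hM)).real {j} = 1 / M := by
  rw [sampleBin_law hk hM hK hs, ← sum_len_binFrac hk hK hs j]
  refine Finset.sum_congr rfl fun x _ => ?_
  rw [hD, Piece.len, leafPiece_g hk hK]

/-- The passage to the bins keeps one half of the total variation distance from the distribution
that the message describes. -/
theorem l1_sampleBin_law (hMN : 8 * domainSize k ≤ M) (D : Measure (Domain k))
    [IsProbabilityMeasure D] : (∑ x, |D.real {x} - (leafPiece K s x).w|) / 4 ≤
      ∑ j, |((D.prod (slotMeasure d)).map (sampleBin hk K s hM)).real {j} - 1 / M| := by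
  classical
  have hM' : 0 < (M : ℝ) := by exact_mod_cast hM
  have hN : 0 < (domainSize k : ℝ) := by
    exact_mod_cast Finset.prod_pos fun i _ => hk i
  have hMN' : 8 * (domainSize k : ℝ) ≤ M := by exact_mod_cast hMN
  have h := half_l1_le (X := Domain k) (J := Fin M)
    (K := fun x j => binFrac M (leafPiece K s x).start (leafPiece K s x).len j)
    (l := fun x => (leafPiece K s x).len) (c := 1 / M)
    (fun x j => binFrac_nonneg _ _ (leafPiece_bounds hk hK hs x).2.2.2.le _)
    (fun x => (leafPiece_bounds hk hK hs x).2.2.2) (by positivity)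
    (fun j => by simp only [mul_comm (binFrac _ _ _ _)]; exact sum_len_binFrac hk hK hs j)
    (fun x => by
      obtain ⟨h1, h2, h3, h4⟩ := leafPiece_bounds hk hK hs x
      have h5 : 4 ≤ M * (leafPiece K s x).len := by
        refine le_trans ?_ (mul_le_mul_of_nonneg_left h3 hM'.le)
        rw [mul_one_div, le_div_iff₀ (by positivity)]
        linarith
      have h6 := half_len_le_card_full hM h1 h2 h5
      rw [mul_one_div, le_div_iff₀ hM']
      linarith)
    (fun x => (D.real {x} - (leafPiece K s x).w) / 2)
  refine le_trans (le_of_eq ?_) (h.trans (le_of_eq ?_))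
  · simp only [abs_div, abs_two, ← Finset.sum_div]
    ring
  · refine Finset.sum_congr rfl fun j _ => ?_
    rw [sampleBin_law hk hM hK hs, ← sum_len_binFrac hk hK hs j, ← Finset.sum_sub_distrib]
    congr 1
    refine Finset.sum_congr rfl fun x _ => ?_
    rw [← sub_mul]
    congr 1
    rw [Piece.len, leafPiece_g hk hK]
    ring

end OneSample

/-! ### The decision of the verifier -/

/-- The numbers of values of the attributes, as a sequence. -/
def cards {d : ℕ} (k : Fin d → ℕ) (i : ℕ) : ℕ := if h : i < d then k ⟨i, h⟩ else 0

theorem cards_fin {d : ℕ} (k : Fin d → ℕ) (i : Fin d) : cards k i = k i := by simp [cards]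

theorem prod_cards {d : ℕ} (k : Fin d → ℕ) : ∏ i ∈ Finset.range d, cards k i = domainSize k := by
  rw [← Fin.prod_univ_eq_prod_range]
  exact Finset.prod_congr rfl fun i _ => cards_fin k i

/-- The number of bins: the least power of two that is at least `binRatio` times the domain size. -/
def numBins {d : ℕ} (k : Fin d → ℕ) : ℕ := 2 ^ Nat.clog 2 (binRatio * domainSize k)

theorem numBins_pos {d : ℕ} (k : Fin d → ℕ) : 0 < numBins k := Nat.two_pow_pos _

/-- Descending towards the real position `y * M` or towards its bin is the same. -/
theorem binOf_lt_iff {M j : ℕ} (h : j < M) {y : ℝ} (hy : 0 ≤ y) : binOf M y < j ↔ y * M < j := by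
  rw [binOf, min_lt_iff, Nat.floor_lt (by positivity), or_iff_left (by omega)]

namespace Protocol

variable {d : ℕ} {k : Fin d → ℕ} (A : Protocol k)

/-- The splitting probabilities that a message claims. -/
noncomputable def claim (m : A.Message) (i j : ℕ) : ℝ :=
  if h : ∑ i' ∈ Finset.range i, cards k i' + j < A.msgLength then m ⟨_, h⟩ else 0

theorem claim_mem (m : A.Message) (i j : ℕ) : A.claim m i j ∈ Set.Icc (0 : ℝ) 1 := by
  unfold claim
  split_ifs
  · exact (m _).2
  · simp

/-- The mean number of samples in a bin. -/
noncomputable def load : ℝ := A.sampleSize / numBins k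

/-- The bound at which the increments of the statistic are clipped. -/
noncomputable def bound : ℝ := 16 * √(1 + A.load)

theorem load_nonneg : 0 ≤ A.load := by unfold load; positivity

theorem sixteen_le_bound : 16 ≤ A.bound := by
  have : 1 ≤ √(1 + A.load) := Real.one_le_sqrt.2 (by linarith [A.load_nonneg])
  unfold bound
  linarith

variable (hk : ∀ i, 0 < k i)

/-- The bins of the samples. -/
noncomputable def sampleBins (m : A.Message) (X : A.Dataset) (ω : ℕ → unitInterval) :
    Fin A.sampleSize → Fin (numBins k) :=
  fun t => sampleBin hk (cards k) (A.claim m) (numBins_pos k) (X t, fun s => ω (slotIdx d t s))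

/-- The simulated uniform bins. They do not depend on the samples. -/
noncomputable def compareBins (X : A.Dataset) (ω : ℕ → unitInterval) :
    Fin A.sampleSize → Fin (numBins k) :=
  fun t => compareBin (numBins_pos k) (X t, fun s => ω (slotIdx d t s))

/-- The threshold for the difference of the statistics. -/
noncomputable def threshold (σ : ℝ) : ℝ :=
  (A.sampleSize : ℝ) ^ 2 * σ ^ 2 / (64 * numBins k)

/-- The excess of the difference of the statistics over the threshold. -/
noncomputable def score (σ : ℝ) (m : A.Message) (X : A.Dataset) (ω : ℕ → unitInterval) : ℝ :=
  stat A.load A.bound (A.sampleBins hk m X ω) - stat A.load A.bound (A.compareBins X ω) -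
    A.threshold σ

/-- The probability of acceptance, given the score. -/
noncomputable def acceptance (ε y : ℝ) : ℝ := 1 / (1 + Real.exp (ε / (2 * A.bound) * y))

include hk in
theorem input_valid (σ ε : ℝ) (m : A.Message) (X : A.Dataset) (ω : ℕ → unitInterval) :
    (A.input σ ε m X ω).Valid where
  card_pos i hi := by
    have hi : i < d := hi
    simp [input, hi, hk]
  msg_mem j := by
    simp only [input]
    split_ifs
    · exact (m _).2
    · simp
  tape_mem j := (ω j).2

theorem input_domSize (σ ε : ℝ) (m : A.Message) (X : A.Dataset) (ω : ℕ → unitInterval) :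
    (A.input σ ε m X ω).domSize = domainSize k := prod_cards k

theorem input_bits (σ ε : ℝ) (m : A.Message) (X : A.Dataset) (ω : ℕ → unitInterval) :
    (A.input σ ε m X ω).bits = Nat.clog 2 (binRatio * domainSize k) := by
  rw [Input.bits, input_domSize]

theorem input_two_pow_bits (σ ε : ℝ) (m : A.Message) (X : A.Dataset) (ω : ℕ → unitInterval) :
    2 ^ (A.input σ ε m X ω).bits = numBins k := by
  rw [input_bits, numBins]

theorem input_lam (σ ε : ℝ) (m : A.Message) (X : A.Dataset) (ω : ℕ → unitInterval) :
    (A.input σ ε m X ω).lam = A.load := by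
  rw [Input.lam, load, ← A.input_two_pow_bits σ ε m X ω]
  push_cast
  rfl

theorem input_clipBound (σ ε : ℝ) (m : A.Message) (X : A.Dataset) (ω : ℕ → unitInterval) :
    (A.input σ ε m X ω).clipBound = A.bound := by
  rw [Input.clipBound, bound, input_lam]

theorem input_piece (σ ε : ℝ) (m : A.Message) (X : A.Dataset) (ω : ℕ → unitInterval)
    (t : Fin A.sampleSize) : (A.input σ ε m X ω).piece t =
      leafPiece (cards k) (A.claim m) (leafOf hk (X t, fun s => ω (slotIdx d t s))) := by
  refine attrWalk_congr (k := cards k) (p := A.claim m) (d := d) fun i hi j _ hj => ?_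
  have hj : j < k ⟨i, hi⟩ := by simpa [cards, hi] using hj
  have e0 : (A.input σ ε m X ω).tape ((A.input σ ε m X ω).blockStart t) =
      ω (slotIdx d t (.inl 0)) := rfl
  have e1 : (A.input σ ε m X ω).tape ((A.input σ ε m X ω).blockStart t + 2 + i) =
      ω (slotIdx d t (.inr ⟨i, hi⟩)) := by
    simp only [input, Input.blockStart, slotIdx, slotPos, add_assoc]
  have e2 : (A.input σ ε m X ω).card i = k ⟨i, hi⟩ := by simp [input, hi]
  have e3 : (A.input σ ε m X ω).sample t i = (X t ⟨i, hi⟩ : ℕ) := by simp [input, hi]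
  rw [Input.target, e0, e1, e2, e3]
  by_cases h : (ω (slotIdx d t (.inl 0)) : ℝ) < 1 / 2
  · rw [if_pos h]
    simp only [position, leafOf, dif_pos hi, if_pos h]
  · rw [if_neg h]
    simp only [position, leafOf, dif_pos hi, if_neg h, Nat.cast_lt]
    exact (binOf_lt_iff hj (ω _).2.1).symm

theorem input_realBin (σ ε : ℝ) (m : A.Message) (X : A.Dataset) (ω : ℕ → unitInterval)
    (t : Fin A.sampleSize) : (A.input σ ε m X ω).realBin t = A.sampleBins hk m X ω t := by
  rw [Input.realBin, Input.realPoint, input_piece A hk, input_two_pow_bits]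
  rfl

theorem input_fakeBin (σ ε : ℝ) (m : A.Message) (X : A.Dataset) (ω : ℕ → unitInterval)
    (t : Fin A.sampleSize) : (A.input σ ε m X ω).fakeBin t = A.compareBins X ω t := by
  rw [Input.fakeBin, Input.fakePoint, input_two_pow_bits]
  simp only [input, Input.blockStart, compareBins, compareBin, slotIdx, slotPos, add_assoc,
    Matrix.cons_val]

variable {A} (hA : A.verifier = MAIndependence.verifier)
include hA

/-- The verifier accepts with a probability that is a logistic function of the score. -/
theorem accepts_iff (σ ε : ℝ) (m : A.Message) (X : A.Dataset) (ω : ℕ → unitInterval) :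
    A.Accepts σ ε m X ω ↔ (ω 0 : ℝ) < A.acceptance ε (A.score hk σ m X ω) := by
  obtain ⟨s, t, h1, h2, -⟩ := wp_verifier (A.input_valid hk σ ε m X ω)
  have e : A.Accepts σ ε m X ω ↔ s.nat 0 = 1 := by
    rw [Accepts, hA]
    exact ⟨fun ⟨s', t', h, h'⟩ => (h.deterministic h1).1 ▸ h', fun h => ⟨s, t, h1, h⟩⟩
  have hp : (2 : ℝ) ^ (A.input σ ε m X ω).bits = numBins k := by
    rw [← A.input_two_pow_bits σ ε m X ω]; push_cast; rfl
  have h3 : runStat A.load A.bound (A.input σ ε m X ω).realBin (A.input σ ε m X ω).size = _ :=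
    runStat_eq_stat _ _ _ (A.sampleBins hk m X ω) (A.input_realBin hk σ ε m X ω)
  have h4 : runStat A.load A.bound (A.input σ ε m X ω).fakeBin (A.input σ ε m X ω).size = _ :=
    runStat_eq_stat _ _ _ (A.compareBins X ω) (A.input_fakeBin σ ε m X ω)
  rw [e, h2, input_lam, input_clipBound, hp, h3, h4, acceptance, score, threshold, sq, sq]
  rfl

include hk in
theorem runsInTime_of_le {σ ε T : ℝ}
    (hT : ((A.sampleSize * (∑ i ∈ Finset.range d, (150 * Nat.clog 2 (cards k i) + 100) +
      100 * Nat.clog 2 (binRatio * domainSize k) + 410) + 50 * d +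
      50 * Nat.clog 2 (binRatio * domainSize k) + 200 : ℕ) : ℝ) ≤ T) : A.RunsInTime σ ε T := by
  intro m X ω
  obtain ⟨s, t, h1, -, h2⟩ := wp_verifier (A.input_valid hk σ ε m X ω)
  refine ⟨s, t, hA ▸ h1, le_trans (Nat.cast_le.2 ?_) hT⟩
  rw [roundTime, input_bits] at h2
  exact h2

end Protocol

/-! ### Differential privacy -/

/-- The first cell of the tape is independent of the other ones. -/
theorem map_coin {T : Type*} [Fintype T] {f : T → ℕ} (hf : f.Injective) (h0 : ∀ q, f q ≠ 0) :
    tapeMeasure.map (fun ω => ((fun q => ω (f q)), ω 0)) =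
      (Measure.pi fun _ : T => (volume : Measure unitInterval)).prod volume := by
  have h1 : tapeMeasure.map (fun ω (q : Option T) => ω (q.elim 0 f)) =
      Measure.infinitePi fun _ : Option T => (volume : Measure unitInterval) := by
    refine Measure.map_infinitePi_infinitePi_of_inj
      (P := fun _ : ℕ => (volume : Measure unitInterval)) (f := fun q : Option T => q.elim 0 f) ?_
    rintro (_ | q) (_ | q') h
    · rfl
    · exact absurd h.symm (h0 q')
    · exact absurd h (h0 q)
    · exact congrArg some (hf h)
  rw [Measure.infinitePi_eq_pi, ← Measure.pi_map_piOptionEquivProd,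
    ← MeasurableEquiv.map_apply_eq_iff_map_symm_apply_eq, Measure.map_map (by fun_prop)
      (by rw [measurable_pi_iff]; intro a; fun_prop)] at h1
  exact h1

theorem volume_coe_lt {c : ℝ} (hc : c ∈ Set.Icc (0 : ℝ) 1) :
    (volume : Measure unitInterval) {u | (u : ℝ) < c} = ENNReal.ofReal c :=
  unitInterval.volume_Iio ⟨c, hc⟩

theorem volume_not_coe_lt {c : ℝ} (hc : c ∈ Set.Icc (0 : ℝ) 1) :
    (volume : Measure unitInterval) {u | ¬ (u : ℝ) < c} = ENNReal.ofReal (1 - c) := by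
  rw [← unitInterval.volume_Ici ⟨c, hc⟩]
  congr 1
  ext u
  exact not_lt

/-- Two decisions by the first cell of the tape: if, given the rest of the tape, the probabilities
of each outcome compare up to the factor `c`, then so do the total probabilities. -/
theorem tape_lt_le {T : Type*} [Fintype T] {f : T → ℕ} (hf : f.Injective) (h0 : ∀ q, f q ≠ 0)
    {g g' : (T → unitInterval) → ℝ} (hg : Measurable g) (hg' : Measurable g')
    (h01 : ∀ ζ, g ζ ∈ Set.Icc (0 : ℝ) 1) (h01' : ∀ ζ, g' ζ ∈ Set.Icc (0 : ℝ) 1) {c : ℝ} (hc : 0 ≤ c)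
    (h : ∀ ζ, g ζ ≤ c * g' ζ ∧ 1 - g ζ ≤ c * (1 - g' ζ)) :
    tapeMeasure.real {ω | (ω 0 : ℝ) < g fun q => ω (f q)} ≤
      c * tapeMeasure.real {ω | (ω 0 : ℝ) < g' fun q => ω (f q)} ∧
    tapeMeasure.real {ω | ¬ (ω 0 : ℝ) < g fun q => ω (f q)} ≤
      c * tapeMeasure.real {ω | ¬ (ω 0 : ℝ) < g' fun q => ω (f q)} := by
  have hm : ∀ {g : (T → unitInterval) → ℝ}, Measurable g →
      MeasurableSet {z : (T → unitInterval) × unitInterval | (z.2 : ℝ) < g z.1} :=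
    fun hg => measurableSet_lt (by fun_prop) (by fun_prop)
  have hmap : ∀ S : Set ((T → unitInterval) × unitInterval), MeasurableSet S →
      tapeMeasure {ω | ((fun q => ω (f q)), ω 0) ∈ S} =
        ∫⁻ ζ, volume (Prod.mk ζ ⁻¹' S) ∂(Measure.pi fun _ : T => (volume : Measure unitInterval)) := by
    intro S hS
    rw [← Measure.prod_apply hS, ← map_coin hf h0, Measure.map_apply (by fun_prop) hS]
    rfl
  have h1 : ∀ {g : (T → unitInterval) → ℝ}, Measurable g → (∀ ζ, g ζ ∈ Set.Icc (0 : ℝ) 1) →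
      tapeMeasure {ω | (ω 0 : ℝ) < g fun q => ω (f q)} =
      ∫⁻ ζ, ENNReal.ofReal (g ζ) ∂(Measure.pi fun _ : T => (volume : Measure unitInterval)) :=
    fun hg hg01 => (hmap _ (hm hg)).trans (lintegral_congr fun ζ => volume_coe_lt (hg01 ζ))
  have h2 : ∀ {g : (T → unitInterval) → ℝ}, Measurable g → (∀ ζ, g ζ ∈ Set.Icc (0 : ℝ) 1) →
      tapeMeasure {ω | ¬ (ω 0 : ℝ) < g fun q => ω (f q)} =
      ∫⁻ ζ, ENNReal.ofReal (1 - g ζ) ∂(Measure.pi fun _ : T => (volume : Measure unitInterval)) :=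
    fun hg hg01 => (hmap _ (hm hg).compl).trans
      (lintegral_congr fun ζ => volume_not_coe_lt (hg01 ζ))
  have key : ∀ {S S' : Set (ℕ → unitInterval)}, tapeMeasure S ≤ ENNReal.ofReal c * tapeMeasure S' →
      tapeMeasure.real S ≤ c * tapeMeasure.real S' := by
    intro S S' h
    have := ENNReal.toReal_mono (ENNReal.mul_ne_top ENNReal.ofReal_ne_top (measure_ne_top _ _)) h
    rwa [ENNReal.toReal_mul, ENNReal.toReal_ofReal hc] at this
  constructor
  · refine key ?_
    rw [h1 hg h01, h1 hg' h01', ← lintegral_const_mul _ (by fun_prop)]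
    refine lintegral_mono fun ζ => ?_
    rw [← ENNReal.ofReal_mul hc]
    exact ENNReal.ofReal_le_ofReal (h ζ).1
  · refine key ?_
    rw [h2 hg h01, h2 hg' h01', ← lintegral_const_mul _ (by fun_prop)]
    refine lintegral_mono fun ζ => ?_
    rw [← ENNReal.ofReal_mul hc]
    exact ENNReal.ofReal_le_ofReal (h ζ).2

/-- The logistic function and its complement change at most by the factor `exp c` when the argument
changes by at most `c`. -/
theorem logistic_le {a b c : ℝ} (hc : |a - b| ≤ c) :
    1 / (1 + Real.exp a) ≤ Real.exp c * (1 / (1 + Real.exp b)) ∧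
      1 - 1 / (1 + Real.exp a) ≤ Real.exp c * (1 - 1 / (1 + Real.exp b)) := by
  have ha := Real.exp_pos a
  have hb := Real.exp_pos b
  have hc0 : 1 ≤ Real.exp c := Real.one_le_exp ((abs_nonneg _).trans hc)
  have h1 : Real.exp b ≤ Real.exp c * Real.exp a := by
    rw [← Real.exp_add]; exact Real.exp_le_exp.2 (by linarith [(abs_le.1 hc).1])
  have h2 : Real.exp a ≤ Real.exp c * Real.exp b := by
    rw [← Real.exp_add]; exact Real.exp_le_exp.2 (by linarith [(abs_le.1 hc).2])
  have e : ∀ x : ℝ, 0 < x → 1 - 1 / (1 + x) = x / (1 + x) := fun x hx => by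
    field_simp; ring
  rw [e _ ha, e _ hb, mul_one_div, ← mul_div_assoc]
  constructor
  · rw [div_le_div_iff₀ (by positivity) (by positivity)]
    nlinarith
  · rw [div_le_div_iff₀ (by positivity) (by positivity)]
    nlinarith [mul_pos ha hb]

namespace Protocol

variable {d : ℕ} {k : Fin d → ℕ} {A : Protocol k}

theorem acceptance_mem (ε y : ℝ) : A.acceptance ε y ∈ Set.Icc (0 : ℝ) 1 := by
  have := Real.exp_pos (ε / (2 * A.bound) * y)
  refine ⟨by unfold acceptance; positivity, ?_⟩
  rw [acceptance, div_le_one (by linarith)]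
  linarith

/-- One sample moves the score by at most twice the clipping bound, and the slope of the logistic
function is scaled accordingly. -/
theorem isDP_of_verifier (hk : ∀ i, 0 < k i) (hA : A.verifier = MAIndependence.verifier) {σ ε : ℝ}
    (hε : 0 ≤ ε) : A.IsDP σ ε := by
  intro m X X' hXX' E
  obtain ⟨j, hj⟩ := hXX'
  have hR : 0 < A.bound := lt_of_lt_of_le (by norm_num) A.sixteen_le_bound
  let f : Fin A.sampleSize × Slot d → ℕ := fun q => slotIdx d q.1 q.2
  let bins : A.Dataset → (Fin A.sampleSize × Slot d → unitInterval) →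
      Fin A.sampleSize → Fin (numBins k) := fun X ζ t =>
    sampleBin hk (cards k) (A.claim m) (numBins_pos k) (X t, fun s => ζ (t, s))
  let bins' : A.Dataset → (Fin A.sampleSize × Slot d → unitInterval) →
      Fin A.sampleSize → Fin (numBins k) := fun X ζ t =>
    compareBin (numBins_pos k) (X t, fun s => ζ (t, s))
  let sc : A.Dataset → (Fin A.sampleSize × Slot d → unitInterval) → ℝ := fun X ζ =>
    stat A.load A.bound (bins X ζ) - stat A.load A.bound (bins' X ζ) - A.threshold σ
  have hslot : ∀ (x : Domain k) (t : Fin A.sampleSize),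
      Measurable fun ζ : Fin A.sampleSize × Slot d → unitInterval =>
        (x, fun s : Slot d => ζ (t, s)) := fun x t => by fun_prop
  have hstat : Measurable (stat A.load A.bound :
      (Fin A.sampleSize → Fin (numBins k)) → ℝ) := measurable_of_countable _
  have hsc : ∀ X, Measurable fun ζ => A.acceptance ε (sc X ζ) := by
    intro X
    have m1 : Measurable (bins X) := measurable_pi_lambda _ fun t =>
      (measurable_sampleBin hk (cards k) (A.claim m) (numBins_pos k)).comp (hslot (X t) t)
    have m2 : Measurable (bins' X) := measurable_pi_lambda _ fun t =>
      (measurable_compareBin (numBins_pos k)).comp (hslot (X t) t)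
    have m3 : Measurable (sc X) :=
      ((hstat.comp m1).sub (hstat.comp m2)).sub measurable_const
    unfold acceptance
    fun_prop
  have hdiff : ∀ ζ, |sc X ζ - sc X' ζ| ≤ 2 * A.bound := by
    intro ζ
    have e : sc X ζ - sc X' ζ = stat A.load A.bound (bins X ζ) - stat A.load A.bound (bins X' ζ) := by
      have : bins' X ζ = bins' X' ζ := rfl
      simp only [sc, this]
      ring
    rw [e]
    exact abs_stat_sub_le hR.le j fun i hi => by simp only [bins, hj i hi]
  have hacc : ∀ X ω, A.Accepts σ ε m X ω ↔ (ω 0 : ℝ) < A.acceptance ε (sc X fun q => ω (f q)) :=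
    fun X ω => accepts_iff hk hA σ ε m X ω
  obtain ⟨h1, h2⟩ := tape_lt_le (f := f) (fun q q' h => by
      have := slotIdx_injective d (a₁ := ((q.1 : ℕ), q.2)) (a₂ := ((q'.1 : ℕ), q'.2)) h
      simp only [Prod.mk.injEq, Fin.val_inj] at this
      exact Prod.ext this.1 this.2) (fun q => by simp only [f, slotIdx]; omega)
    (hsc X) (hsc X') (fun ζ => acceptance_mem _ _) (fun ζ => acceptance_mem _ _)
    (Real.exp_pos ε).le (fun ζ => logistic_le (by
      rw [← mul_sub, abs_mul, abs_of_nonneg (by positivity)]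
      refine (mul_le_mul_of_nonneg_left (hdiff ζ) (by positivity)).trans (le_of_eq ?_)
      field_simp))
  have hexp : 1 ≤ Real.exp ε := Real.one_le_exp hε
  simp only [transcript, hacc]
  by_cases ht : (m, true) ∈ E <;> by_cases hf : (m, false) ∈ E
  · have : ∀ b : Bool, (m, b) ∈ E := by rintro (_ | _) <;> assumption
    simpa [this] using hexp
  · have : ∀ b : Bool, (m, b) ∈ E ↔ b = true := by rintro (_ | _) <;> simp [ht, hf]
    simpa only [this, decide_eq_true_eq] using h1
  · have : ∀ b : Bool, (m, b) ∈ E ↔ b = false := by rintro (_ | _) <;> simp [ht, hf]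
    simpa only [this, decide_eq_false_iff_not] using h2
  · have : ∀ b : Bool, (m, b) ∉ E := by rintro (_ | _) <;> assumption
    simp [this]

end Protocol

/-! ### Completeness and soundness -/

section Deviation

variable {α : Type*} [Fintype α] [DecidableEq α] [Nonempty α]

/-- The lower bound `n² σ² / (32 M)` for the gap of the means of the statistic, for bins at `ℓ¹` distance
at least `σ / 2` from uniform. -/
noncomputable def minGap (n : ℕ) (M σ : ℝ) : ℝ := (n : ℝ) ^ 2 * σ ^ 2 / (32 * M)

/-- Chebyshev's inequality for uniform bins. -/
theorem uniform_deviation {n : ℕ} {lam R σ : ℝ} (hn : 1 ≤ n) (hl : lam = n / Fintype.card α)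
    (hR : 0 ≤ R) (hσ : 0 < σ) (h : 2 ^ 24 * √(Fintype.card α) ≤ n * σ ^ 2) :
    prodE (fun _ : α => 1 / (Fintype.card α : ℝ)) n (Set.indicator
      {X | minGap n (Fintype.card α) σ / 8 ≤
        |stat lam R X - prodE (fun _ : α => 1 / (Fintype.card α : ℝ)) n (stat lam R)|} 1) ≤
      1 / 20 := by
  have hM : 0 < (Fintype.card α : ℝ) := Nat.cast_pos.2 Fintype.card_pos
  have hn0 : 0 < (n : ℝ) := by exact_mod_cast hn
  have hg : 0 < minGap n (Fintype.card α) σ / 8 := by unfold minGap; positivity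
  refine (chebyshev_prodE (fun _ => by positivity) _ _ hg _ fun X hX => hX).trans ?_
  rw [div_le_iff₀ (by positivity)]
  refine (variance_uniform_le hn hl hR).trans ?_
  have h2 : (2 ^ 24 * √(Fintype.card α : ℝ)) ^ 2 ≤ (n * σ ^ 2) ^ 2 := by gcongr
  rw [mul_pow, Real.sq_sqrt hM.le] at h2
  have e : 1 / 20 * (minGap n (Fintype.card α) σ / 8) ^ 2 =
      (n : ℝ) ^ 2 * (n * σ ^ 2) ^ 2 / (20 * (256 * Fintype.card α) ^ 2) := by
    unfold minGap; ring
  rw [e, hl, le_div_iff₀ (by positivity)]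
  have e2 : 3 * (n : ℝ) * (n / Fintype.card α) * (20 * (256 * Fintype.card α) ^ 2) =
      n ^ 2 * (3932160 * Fintype.card α) := by field_simp; ring
  rw [e2]
  gcongr
  linarith

/-- Chebyshev's inequality for far bins; the allowed deviation grows with the gap. -/
theorem far_deviation {p : α → ℝ} (hp0 : ∀ a, 0 ≤ p a) (hp : ∑ a, p a = 1) {n : ℕ} {lam R σ : ℝ}
    (hn : 2 ≤ n) (hl : lam = n / Fintype.card α) (hR : R = 16 * √(1 + lam)) (hσ : 0 < σ)
    (hσ1 : σ ≤ 1) (h4 : 4 ≤ Fintype.card α) (h : 2 ^ 24 * √(Fintype.card α) ≤ n * σ ^ 2)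
    (hgap : minGap n (Fintype.card α) σ ≤ gap p lam R n) :
    prodE p n (Set.indicator {X | gap p lam R n / 4 ≤ |stat lam R X - prodE p n (stat lam R)|} 1) ≤
      1 / 20 := by
  have hM : 0 < (Fintype.card α : ℝ) := Nat.cast_pos.2 Fintype.card_pos
  have hn0 : 0 < (n : ℝ) := by exact_mod_cast (by omega : 0 < n)
  have hl0 : 0 ≤ lam := by rw [hl]; positivity
  set Γ := gap p lam R n
  set u : ℝ := n * σ ^ 2 with hu
  have hG0 : 0 < minGap n (Fintype.card α) σ := by unfold minGap; positivity
  have hΓ : 0 < Γ := hG0.trans_le hgap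
  have hu2 : 2 ^ 48 * (Fintype.card α : ℝ) ≤ u ^ 2 := by
    have h2 : (2 ^ 24 * √(Fintype.card α : ℝ)) ^ 2 ≤ u ^ 2 := by gcongr
    rw [mul_pow, Real.sq_sqrt hM.le] at h2
    linarith
  have hu1 : 2 ^ 25 ≤ u := by
    have : 2 ≤ √(Fintype.card α : ℝ) := Real.le_sqrt_of_sq_le (by norm_num; exact_mod_cast h4)
    linarith
  refine (chebyshev_prodE hp0 _ _ (by positivity : 0 < Γ / 4) _ fun X hX => hX).trans ?_
  rw [div_le_iff₀ (by positivity)]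
  refine (variance_le_gap hp0 hp hn hl hR).trans ?_
  -- the part of the variance that is already there under the uniform distribution
  have h1 : 15 * n * lam ≤ Γ ^ 2 / 640 := by
    have hsq : minGap n (Fintype.card α) σ ^ 2 ≤ Γ ^ 2 := by gcongr
    have e : minGap n (Fintype.card α) σ ^ 2 = n ^ 2 * u ^ 2 / (32 * Fintype.card α) ^ 2 := by
      unfold minGap; ring
    have : 15 * n * lam * 640 ≤ minGap n (Fintype.card α) σ ^ 2 := by
      rw [e, hl, le_div_iff₀ (by positivity)]
      have e2 : 15 * (n : ℝ) * (n / Fintype.card α) * 640 * (32 * Fintype.card α) ^ 2 =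
        n ^ 2 * (9830400 * Fintype.card α) := by field_simp; ring
      rw [e2]
      gcongr
      linarith
    linarith
  -- the part of the variance that grows with the gap
  have h2 : 128 * lam + 32 * R ≤ Γ / 640 := by
    have hs : √(1 + lam) ≤ 1 + lam := Real.sqrt_le_self_iff.2 (Or.inr (by linarith))
    have e : minGap n (Fintype.card α) σ = n * u / (32 * Fintype.card α) := by
      unfold minGap; rw [hu]; ring
    have hnu : u ≤ n := by
      rw [hu]; exact mul_le_of_le_one_right hn0.le (pow_le_one₀ hσ.le hσ1)
    have i1 : lam * 819200 ≤ minGap n (Fintype.card α) σ := by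
      rw [e, hl, le_div_iff₀ (by positivity)]
      have e2 : (n : ℝ) / Fintype.card α * 819200 * (32 * Fintype.card α) = n * 26214400 := by
        field_simp; ring
      rw [e2]
      gcongr
      linarith
    have i2 : 655360 ≤ minGap n (Fintype.card α) σ := by
      rw [e, le_div_iff₀ (by positivity)]
      nlinarith
    rw [hR]
    linarith
  have h3 : (128 * lam + 32 * R) * Γ ≤ Γ / 640 * Γ := by gcongr
  nlinarith

end Deviation

theorem one_div_one_add_exp_le {x : ℝ} (hx : 20 ≤ x) : 1 / (1 + Real.exp x) ≤ 1 / 21 := by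
  have := Real.add_one_le_exp x
  gcongr
  linarith

theorem le_one_div_one_add_exp {x : ℝ} (hx : x ≤ -20) : 1 - 1 / 21 ≤ 1 / (1 + Real.exp x) := by
  have h := Real.add_one_le_exp (-x)
  have h1 : Real.exp x * Real.exp (-x) = 1 := by rw [← Real.exp_add]; simp
  have h2 := Real.exp_pos x
  rw [le_div_iff₀ (by positivity)]
  nlinarith

theorem measurableSet_coe_lt (c : ℝ) : MeasurableSet {u : unitInterval | (u : ℝ) < c} :=
  measurableSet_lt (by fun_prop) measurable_const

namespace Protocol

variable {d : ℕ} {k : Fin d → ℕ} {A : Protocol k}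

/-- The law of the samples and of the random tape. -/
noncomputable def law (A : Protocol k) (D : Measure (Domain k)) :
    Measure (A.Dataset × (ℕ → unitInterval)) :=
  (Measure.pi fun _ : Fin A.sampleSize => D).prod tapeMeasure

instance (D : Measure (Domain k)) [IsProbabilityMeasure D] : IsProbabilityMeasure (A.law D) := by
  unfold law; infer_instance

/-- The bins of all samples are independent, with the law of the bin of one sample. -/
theorem law_map_real {D : Measure (Domain k)} [IsProbabilityMeasure D] {M : ℕ}
    {F : Domain k × (Slot d → unitInterval) → Fin M} (hF : Measurable F)
    (S : Set (Fin A.sampleSize → Fin M)) :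
    (A.law D).real {z | (fun t => F (z.1 t, fun s => z.2 (slotIdx d t s))) ∈ S} =
      prodE (fun j => ((D.prod (slotMeasure d)).map F).real {j}) A.sampleSize (S.indicator 1) := by
  have : IsProbabilityMeasure ((D.prod (slotMeasure d)).map F) :=
    Measure.isProbabilityMeasure_map hF.aemeasurable
  have hS : MeasurableSet S := (Set.toFinite S).measurableSet
  have hG : Measurable fun (y : Fin A.sampleSize → Domain k × (Slot d → unitInterval)) t => F (y t) :=
    measurable_pi_lambda _ fun t => hF.comp (measurable_pi_apply t)
  rw [← pi_real_eq_prodE, ← Measure.pi_map_pi fun _ => hF.aemeasurable,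
    map_measureReal_apply hG hS, ← map_samples D d A.sampleSize,
    map_measureReal_apply (by fun_prop) (hG hS)]
  rfl

theorem law_coin (D : Measure (Domain k)) [IsProbabilityMeasure D] {S : Set unitInterval}
    (hS : MeasurableSet S) : (A.law D).real {z | z.2 0 ∈ S} = (volume : Measure unitInterval).real S := by
  have e : {z : A.Dataset × (ℕ → unitInterval) | z.2 0 ∈ S} =
      Set.univ ×ˢ ((fun ω : ℕ → unitInterval => ω 0) ⁻¹' S) := by ext; simp
  rw [e, law, measureReal_prod_prod, probReal_univ, one_mul, tapeMeasure]
  exact (measurePreserving_eval_infinitePi (fun _ : ℕ => (volume : Measure unitInterval))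
    0).measureReal_preimage hS.nullMeasurableSet

variable (A) in
/-- What the number of samples has to satisfy for the test to work: the deviations to be detected lie
in the clipping range, the statistic is concentrated, and the logistic decision is nearly
deterministic at an eighth of the gap. -/
structure Enough (σ ε : ℝ) : Prop where
  two_le : 2 ≤ A.sampleSize
  load_le : A.load * (σ / 2) ≤ A.bound / 4
  accurate : 2 ^ 24 * √(numBins k) ≤ A.sampleSize * σ ^ 2
  decisive : 20 ≤ ε / (2 * A.bound) * (minGap A.sampleSize (numBins k) σ / 8)

/-- The mean of the statistic of uniform bins. -/
noncomputable def uniformMean (A : Protocol k) : ℝ :=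
  prodE (fun _ : Fin (numBins k) => 1 / (numBins k : ℝ)) A.sampleSize (stat A.load A.bound)

theorem threshold_eq (σ : ℝ) : A.threshold σ = minGap A.sampleSize (numBins k) σ / 2 := by
  unfold threshold minGap; ring

/-- The statistic of uniform bins is close to its mean. -/
theorem law_uniform_deviation {σ ε : ℝ} (hσ : 0 < σ) (hE : A.Enough σ ε)
    (D : Measure (Domain k)) [IsProbabilityMeasure D]
    {F : Domain k × (Slot d → unitInterval) → Fin (numBins k)} (hF : Measurable F)
    (hu : ∀ j, ((D.prod (slotMeasure d)).map F).real {j} = 1 / (numBins k : ℝ)) :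
    (A.law D).real {z | minGap A.sampleSize (numBins k) σ / 8 ≤
      |stat A.load A.bound (fun t => F (z.1 t, fun s => z.2 (slotIdx d t s))) - A.uniformMean|} ≤
      1 / 20 := by
  have : Nonempty (Fin (numBins k)) := ⟨⟨0, numBins_pos k⟩⟩
  have h := uniform_deviation (α := Fin (numBins k)) (n := A.sampleSize) (lam := A.load)
    (R := A.bound) (by linarith [hE.two_le]) (by rw [Fintype.card_fin]; rfl)
    (by linarith [A.sixteen_le_bound]) hσ (by rw [Fintype.card_fin]; exact hE.accurate)
  rw [Fintype.card_fin] at h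
  refine le_trans (le_of_eq ?_) h
  have h1 := law_map_real (A := A) (D := D) hF {Y | minGap A.sampleSize (numBins k) σ / 8 ≤
      |stat A.load A.bound Y - A.uniformMean|}
  simp only [hu] at h1
  exact h1

theorem compareBins_deviation {σ ε : ℝ} (hσ : 0 < σ) (hE : A.Enough σ ε)
    (D : Measure (Domain k)) [IsProbabilityMeasure D] :
    (A.law D).real {z | minGap A.sampleSize (numBins k) σ / 8 ≤
      |stat A.load A.bound (A.compareBins z.1 z.2) - A.uniformMean|} ≤ 1 / 20 :=
  law_uniform_deviation hσ hE D (measurable_compareBin (numBins_pos k))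
    (compareBin_law (numBins_pos k) D)

/-- Completeness for a message that describes the distribution. -/
theorem le_acceptProb (hk : ∀ i, 0 < k i) (hA : A.verifier = MAIndependence.verifier) {σ ε : ℝ}
    (hσ : 0 < σ) (hε : 0 ≤ ε) (hE : A.Enough σ ε) (m : A.Message) (D : Measure (Domain k))
    [IsProbabilityMeasure D]
    (hD : ∀ x, D.real {x} = (leafPiece (cards k) (A.claim m) x).w) :
    0.75 ≤ A.acceptProb σ ε m D := by
  have hR : 0 < A.bound := lt_of_lt_of_le (by norm_num) A.sixteen_le_bound
  set G := minGap A.sampleSize (numBins k) σ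
  have h1 := law_uniform_deviation hσ hE D
    (measurable_sampleBin hk (cards k) (A.claim m) (numBins_pos k))
    (sampleBin_law_of_eq hk (numBins_pos k) (cards_fin k) (A.claim_mem m) D hD)
  have h2 := compareBins_deviation hσ hE D
  have h3 : (A.law D).real {z | ¬ (z.2 0 : ℝ) < 1 - 1 / 21} = 1 / 21 := by
    refine (law_coin D (S := {u | ¬ (u : ℝ) < 1 - 1 / 21})
      (measurableSet_coe_lt _).compl).trans ?_
    rw [measureReal_def, volume_not_coe_lt ⟨by norm_num, by norm_num⟩,
      ENNReal.toReal_ofReal (by norm_num)]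
    norm_num
  have hsub : {z : A.Dataset × (ℕ → unitInterval) | A.Accepts σ ε m z.1 z.2}ᶜ ⊆
      ({z | ¬ (z.2 0 : ℝ) < 1 - 1 / 21} ∪
        {z | G / 8 ≤ |stat A.load A.bound (A.sampleBins hk m z.1 z.2) - A.uniformMean|}) ∪
        {z | G / 8 ≤ |stat A.load A.bound (A.compareBins z.1 z.2) - A.uniformMean|} := by
    intro z hz
    by_contra hcon
    simp only [Set.mem_union, Set.mem_ofPred_eq, not_or, not_not, not_le] at hcon
    obtain ⟨⟨c1, c2⟩, c3⟩ := hcon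
    refine hz ((accepts_iff hk hA σ ε m z.1 z.2).2 (c1.trans_le (le_one_div_one_add_exp ?_)))
    rw [abs_lt] at c2 c3
    have hs : A.score hk σ m z.1 z.2 ≤ -(G / 8) := by
      rw [score, threshold_eq]
      linarith
    have := hE.decisive
    have := mul_le_mul_of_nonneg_left hs (by positivity : 0 ≤ ε / (2 * A.bound))
    linarith
  have h4 : (A.law D).real {z | A.Accepts σ ε m z.1 z.2}ᶜ ≤ 1 / 21 + 1 / 20 + 1 / 20 := by
    refine (measureReal_mono hsub).trans ((measureReal_union_le _ _).trans ?_)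
    refine add_le_add ((measureReal_union_le _ _).trans ?_) h2
    exact add_le_add h3.le h1
  have h5 : 1 ≤ A.acceptProb σ ε m D + (A.law D).real {z | A.Accepts σ ε m z.1 z.2}ᶜ := by
    rw [← probReal_univ (μ := A.law D),
      ← Set.union_compl_self {z : A.Dataset × (ℕ → unitInterval) | A.Accepts σ ε m z.1 z.2}]
    exact measureReal_union_le _ _
  norm_num at h4 h5 ⊢
  linarith

/-- Soundness for a message that describes a distant distribution. -/
theorem acceptProb_le (hk : ∀ i, 0 < k i) (hA : A.verifier = MAIndependence.verifier) {σ ε : ℝ}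
    (hσ : 0 < σ) (hσ1 : σ ≤ 1) (hε : 0 ≤ ε) (hE : A.Enough σ ε) (h4 : 4 ≤ numBins k)
    (h8 : 8 * domainSize k ≤ numBins k) (m : A.Message) (D : Measure (Domain k))
    [IsProbabilityMeasure D]
    (hD : 2 * σ ≤ ∑ x, |D.real {x} - (leafPiece (cards k) (A.claim m) x).w|) :
    A.acceptProb σ ε m D ≤ 0.25 := by
  have hR : 0 < A.bound := lt_of_lt_of_le (by norm_num) A.sixteen_le_bound
  have : Nonempty (Fin (numBins k)) := ⟨⟨0, numBins_pos k⟩⟩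
  have hF := measurable_sampleBin hk (cards k) (A.claim m) (numBins_pos k)
  have : IsProbabilityMeasure ((D.prod (slotMeasure d)).map
      (sampleBin hk (cards k) (A.claim m) (numBins_pos k))) :=
    Measure.isProbabilityMeasure_map hF.aemeasurable
  set p : Fin (numBins k) → ℝ := fun j => ((D.prod (slotMeasure d)).map
      (sampleBin hk (cards k) (A.claim m) (numBins_pos k))).real {j} with hp
  have hp0 : ∀ j, 0 ≤ p j := fun j => measureReal_nonneg
  have hp1 : ∑ j, p j = 1 := by
    rw [hp, sum_measureReal_singleton, Finset.coe_univ, probReal_univ]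
  have hl : A.load = A.sampleSize / (Fintype.card (Fin (numBins k)) : ℝ) := by
    rw [Fintype.card_fin]; rfl
  have hfar : σ / 2 ≤ ∑ j, |p j - 1 / (Fintype.card (Fin (numBins k)) : ℝ)| := by
    rw [Fintype.card_fin]
    refine le_trans ?_ (l1_sampleBin_law hk (numBins_pos k) (cards_fin k) (A.claim_mem m) h8 D)
    linarith
  have hgap := le_gap_of_far hp0 hp1 hE.two_le hl rfl (by positivity) hfar hE.load_le
  have hG : minGap A.sampleSize (Fintype.card (Fin (numBins k))) σ ≤
      gap p A.load A.bound A.sampleSize := by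
    refine le_trans (le_of_eq ?_) hgap
    unfold minGap; ring
  have h1 := far_deviation hp0 hp1 hE.two_le hl rfl hσ hσ1 (by rwa [Fintype.card_fin])
    (by rw [Fintype.card_fin]; exact hE.accurate) hG
  rw [← law_map_real (A := A) hF] at h1
  rw [Fintype.card_fin] at hG
  have hΓ : gap p A.load A.bound A.sampleSize =
      prodE p A.sampleSize (stat A.load A.bound) - A.uniformMean := by
    rw [gap, Fintype.card_fin]; rfl
  set Γ := gap p A.load A.bound A.sampleSize
  set G := minGap A.sampleSize (numBins k) σ
  have h2 := compareBins_deviation hσ hE D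
  have h3 : (A.law D).real {z | (z.2 0 : ℝ) < 1 / 21} = 1 / 21 := by
    refine (law_coin D (S := {u | (u : ℝ) < 1 / 21})
      (measurableSet_coe_lt _)).trans ?_
    rw [measureReal_def, volume_coe_lt ⟨by norm_num, by norm_num⟩,
      ENNReal.toReal_ofReal (by norm_num)]
  have hsub : {z : A.Dataset × (ℕ → unitInterval) | A.Accepts σ ε m z.1 z.2} ⊆
      ({z | (z.2 0 : ℝ) < 1 / 21} ∪
        {z | Γ / 4 ≤ |stat A.load A.bound (A.sampleBins hk m z.1 z.2) -
          prodE p A.sampleSize (stat A.load A.bound)|}) ∪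
        {z | G / 8 ≤ |stat A.load A.bound (A.compareBins z.1 z.2) - A.uniformMean|} := by
    intro z hz
    by_contra hcon
    simp only [Set.mem_union, Set.mem_ofPred_eq, not_or, not_le] at hcon
    obtain ⟨⟨c1, c2⟩, c3⟩ := hcon
    refine c1 (((accepts_iff hk hA σ ε m z.1 z.2).1 hz).trans_le (one_div_one_add_exp_le ?_))
    rw [abs_lt] at c2 c3
    have hs : G / 8 ≤ A.score hk σ m z.1 z.2 := by
      rw [score, threshold_eq]
      linarith
    have := hE.decisive
    have := mul_le_mul_of_nonneg_left hs (by positivity : 0 ≤ ε / (2 * A.bound))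
    linarith
  have h5 : (A.law D).real {z | A.Accepts σ ε m z.1 z.2} ≤ 1 / 21 + 1 / 20 + 1 / 20 := by
    refine (measureReal_mono hsub).trans ((measureReal_union_le _ _).trans ?_)
    refine add_le_add ((measureReal_union_le _ _).trans ?_) h2
    exact add_le_add h3.le h1
  refine le_trans h5 (by norm_num)

end Protocol

/-! ### The honest message and the claimed product distribution -/

theorem sum_cards {d : ℕ} (k : Fin d → ℕ) (i : Fin d) :
    ∑ j ∈ Finset.range i, cards k j = ∑ j : Fin i, k (Fin.castLE i.2.le j) := by
  rw [← Fin.sum_univ_eq_sum_range]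
  exact Finset.sum_congr rfl fun j _ => cards_fin k (Fin.castLE i.2.le j)

/-- Weights on the attributes define a product distribution. -/
theorem exists_isProductDist {d : ℕ} {k : Fin d → ℕ} (w : (i : Fin d) → Fin (k i) → ℝ)
    (h0 : ∀ i a, 0 ≤ w i a) (h1 : ∀ i, ∑ a, w i a = 1) :
    ∃ D : Measure (Domain k), IsProductDist D ∧ ∀ x, D.real {x} = ∏ i, w i (x i) := by
  have hs : ∀ i, ∑ a, ENNReal.ofReal (w i a) = 1 := fun i => by
    rw [← ENNReal.ofReal_sum_of_nonneg fun a _ => h0 i a, h1, ENNReal.ofReal_one]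
  let q : (i : Fin d) → PMF (Fin (k i)) := fun i => PMF.ofFintype _ (hs i)
  refine ⟨Measure.pi fun i => (q i).toMeasure, ⟨_, fun i => inferInstance, rfl⟩, fun x => ?_⟩
  rw [measureReal_def, Measure.pi_singleton, ENNReal.toReal_prod]
  refine Finset.prod_congr rfl fun i _ => ?_
  rw [PMF.toMeasure_apply_singleton _ _ (measurableSet_singleton _), PMF.ofFintype_apply,
    ENNReal.toReal_ofReal (h0 i _)]

/-- A message that describes the marginals of `D`. -/
theorem exists_message {d : ℕ} {k : Fin d → ℕ} (hk : ∀ i, 0 < k i) (D : Measure (Domain k))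
    [IsProbabilityMeasure D] : ∃ m : Fin (∑ i, k i) → unitInterval, ∀ i (p : ℕ → ℝ),
      (∀ j : Fin (k i), p j = m (finSigmaFinEquiv ⟨i, j⟩)) → ∀ a : Fin (k i),
        leafProb p ((a : ℕ) : ℝ) 0 (k i) = D.real {x | x i = a} := by
  have h : ∀ i, ∃ p : ℕ → ℝ, (∀ j, p j ∈ Set.Icc (0 : ℝ) 1) ∧ ∀ a : Fin (k i),
      leafProb p ((a : ℕ) : ℝ) 0 (k i) = D.real {x | x i = a} := by
    intro i
    obtain ⟨p, hp, hpa⟩ := exists_splitting (fun a => D.real {x | (x i : ℕ) = a})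
      (fun a => measureReal_nonneg) (hk i)
    refine ⟨p, hp, fun a => ?_⟩
    have hsum : ∑ b ∈ Finset.Ico 0 (k i), D.real {x | (x i : ℕ) = b} = 1 := by
      rw [← measureReal_biUnion_finset, ← probReal_univ (μ := D)]
      · congr 1
        ext x
        simp
      · intro a _ b _ hab
        rw [Function.onFun, Set.disjoint_left]
        exact fun x h1 h2 => hab (h1.symm.trans h2)
      · exact fun b _ => (Set.toFinite _).measurableSet
    have := hpa a (by simp)
    rw [hsum, one_mul] at this
    rw [this]
    simp only [Fin.ext_iff]
  choose p hp hpa using h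
  let g : ((i : Fin d) × Fin (k i)) → unitInterval := fun s => ⟨p s.1 s.2, hp _ _⟩
  refine ⟨fun j => g (finSigmaFinEquiv.symm j), fun i q hq a => ?_⟩
  rw [← hpa i a]
  refine leafProb_congr fun j _ hj => ?_
  have := hq ⟨j, hj⟩
  beta_reduce at this
  rwa [Equiv.symm_apply_apply] at this

namespace Protocol

variable {d : ℕ} {k : Fin d → ℕ} {A : Protocol k}

/-- Every message describes a product distribution. -/
theorem exists_claimed (hk : ∀ i, 0 < k i) (m : A.Message) : ∃ D : Measure (Domain k),
    IsProductDist D ∧ ∀ x, D.real {x} = (leafPiece (cards k) (A.claim m) x).w := by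
  obtain ⟨D, h1, h2⟩ := exists_isProductDist
    (fun i a => leafProb (A.claim m i) ((a : ℕ) : ℝ) 0 (k i))
    (fun i a => leafProb_nonneg (A.claim_mem m i) _ _ _) fun i => by
      rw [Fin.sum_univ_eq_sum_range (fun a : ℕ => leafProb (A.claim m i) (a : ℝ) 0 (k i)),
        Finset.range_eq_Ico, sum_leafProb _ (hk i)]
  exact ⟨D, h1, fun x => by rw [h2, leafPiece_w (cards_fin k)]⟩

end Protocol

/-! ### Parameters -/

theorem le_numBins {d : ℕ} (k : Fin d → ℕ) : 2 ^ 50 * (domainSize k : ℝ) ≤ numBins k := by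
  have : binRatio * domainSize k ≤ numBins k := Nat.le_pow_clog one_lt_two _
  rw [binRatio] at this
  exact_mod_cast this

theorem numBins_le {d : ℕ} {k : Fin d → ℕ} (h : 0 < domainSize k) :
    (numBins k : ℝ) ≤ 2 ^ 51 * domainSize k := by
  have h1 : 1 < binRatio * domainSize k := by rw [binRatio]; omega
  have h2 := Nat.pow_pred_clog_lt_self one_lt_two h1
  have h3 : 0 < Nat.clog 2 (binRatio * domainSize k) := Nat.clog_pos one_lt_two h1
  have h4 : numBins k = 2 * 2 ^ (Nat.clog 2 (binRatio * domainSize k)).pred := by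
    rw [numBins, ← pow_succ', Nat.pred_eq_sub_one, Nat.sub_add_cancel h3]
  have h5 : numBins k ≤ 2 ^ 51 * domainSize k := by
    rw [h4, binRatio] at *
    omega
  exact_mod_cast h5

/-- The two regimes of the privacy parameter, written with square roots: `ε ≥ 1 / (N σ²)`
and `ε ≥ σ / N ^ (1 / 4)`. -/
theorem privacy_cases {N σ ε : ℝ} (hN : 1 ≤ N) (hσ : 0 < σ)
    (h : min (1 / (N * σ ^ 2)) (σ / N ^ (1 / 4 : ℝ)) ≤ ε) :
    1 ≤ √N * σ * √ε ∨ σ ^ 2 ≤ ε ^ 2 * √N := by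
  rcases min_le_iff.1 h with h | h
  · left
    rw [div_le_iff₀ (by positivity)] at h
    rw [← Real.sqrt_sq hσ.le, ← Real.sqrt_mul (by positivity), ← Real.sqrt_mul (by positivity)]
    exact Real.one_le_sqrt.2 (by linarith)
  · right
    have hN4 : 0 < N ^ (1 / 4 : ℝ) := Real.rpow_pos_of_pos (by linarith) _
    rw [div_le_iff₀ hN4] at h
    have e : (N ^ (1 / 4 : ℝ)) ^ 2 = √N := by
      rw [Real.sqrt_eq_rpow, ← Real.rpow_natCast, ← Real.rpow_mul (by linarith)]
      norm_num
    rw [← e, ← mul_pow]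
    gcongr

/-- In both regimes `ε` is at least `σ² / N`. -/
theorem sq_le_mul_of_cases {N σ ε : ℝ} (hN : 1 ≤ N) (hσ : 0 < σ) (hσ1 : σ ≤ 1) (hε : 0 < ε)
    (h : 1 ≤ √N * σ * √ε ∨ σ ^ 2 ≤ ε ^ 2 * √N) : σ ≤ √N * √ε := by
  have hs : 1 ≤ √N := Real.one_le_sqrt.2 hN
  rcases h with h | h
  · have : √N * σ * √ε ≤ √N * √ε := by
      rw [mul_right_comm]; exact mul_le_of_le_one_right (by positivity) hσ1
    linarith
  · by_contra hcon
    push Not at hcon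
    have h1 : (√N * √ε) ^ 2 < σ ^ 2 := by gcongr
    rw [mul_pow, Real.sq_sqrt hε.le] at h1
    have h2 : ε < σ ^ 2 := lt_of_le_of_lt (by nlinarith) h1
    have h3 : ε * √N < 1 := by nlinarith
    nlinarith

/-- The mean number `n / M` of samples in a bin is at most `3 / σ²`. -/
theorem samples_mul_sq_le {N M n σ ε : ℝ} (hN : 1 ≤ N) (hσ : 0 < σ) (hσ1 : σ ≤ 1) (hε : 0 < ε)
    (hM : 2 ^ 50 * N ≤ M) (hle : n ≤ 2 ^ 50 * (√N / (σ * √ε) + √N / σ ^ 2) + 1)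
    (h : σ ≤ √N * √ε) : n * σ ^ 2 ≤ 3 * M := by
  have he : 0 < √ε := Real.sqrt_pos.2 hε
  have hs : √N ≤ N := Real.sqrt_le_self_iff.2 (Or.inr hN)
  have h1 : √N / (σ * √ε) * σ ^ 2 ≤ N := by
    have : √N / (σ * √ε) * σ ^ 2 = √N * σ / √ε := by field_simp
    rw [this, div_le_iff₀ he]
    calc √N * σ ≤ √N * (√N * √ε) := by gcongr
      _ = N * √ε := by rw [← mul_assoc, Real.mul_self_sqrt (by linarith)]
  have h2 : √N / σ ^ 2 * σ ^ 2 = √N := by field_simp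
  have h3 : σ ^ 2 ≤ 1 := pow_le_one₀ hσ.le hσ1
  calc n * σ ^ 2 ≤ (2 ^ 50 * (√N / (σ * √ε) + √N / σ ^ 2) + 1) * σ ^ 2 := by gcongr
    _ = 2 ^ 50 * (√N / (σ * √ε) * σ ^ 2 + √N / σ ^ 2 * σ ^ 2) + σ ^ 2 := by ring
    _ ≤ 3 * M := by rw [h2]; linarith

/-- The number of samples makes up for the noise of the decision. The second lower bound for `n`
suffices in the first regime of the privacy parameter; the second regime needs the first one. -/
theorem noise_le {N M n σ ε : ℝ} (hN : 1 ≤ N) (hσ : 0 < σ) (hε : 0 < ε) (hn : 0 < n)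
    (hM : 2 ^ 50 * N ≤ M) (hx : 2 ^ 24 * √M ≤ n * σ ^ 2) (hy : 2 ^ 24 * √M ≤ n * σ * √ε)
    (h : 1 ≤ √N * σ * √ε ∨ σ ^ 2 ≤ ε ^ 2 * √N) :
    163840 * M * (1 + √(n / M)) ≤ ε * n ^ 2 * σ ^ 2 := by
  have hM0 : 0 < M := by linarith
  have hNM : √N ≤ √M := Real.sqrt_le_sqrt (by linarith)
  have hsN : 1 ≤ √N := Real.one_le_sqrt.2 hN
  have hy2 : 2 ^ 48 * M ≤ ε * n ^ 2 * σ ^ 2 := by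
    have : (2 ^ 24 * √M) ^ 2 ≤ (n * σ * √ε) ^ 2 := by gcongr
    rw [mul_pow, mul_pow, mul_pow, Real.sq_sqrt hM0.le, Real.sq_sqrt hε.le] at this
    linarith
  have hcube : 2 ^ 48 * M ≤ ε ^ 2 * n ^ 3 * σ ^ 4 := by
    rcases h with h | h
    · have h1 : 1 ≤ ε * n * σ ^ 2 := by
        have e : ε * n * σ ^ 2 = (n * σ * √ε) * (σ * √ε) := by
          rw [show (n * σ * √ε) * (σ * √ε) = √ε ^ 2 * n * σ ^ 2 by ring, Real.sq_sqrt hε.le]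
        have h2 : √N * (σ * √ε) ≤ (n * σ * √ε) * (σ * √ε) := by
          gcongr
          linarith [Real.sqrt_nonneg M]
        rw [e]
        linarith
      calc 2 ^ 48 * M ≤ ε * n ^ 2 * σ ^ 2 * 1 := by linarith
        _ ≤ ε * n ^ 2 * σ ^ 2 * (ε * n * σ ^ 2) := by gcongr
        _ = _ := by ring
    · have h1 : (2 ^ 24 * √M) ^ 2 ≤ (n * σ ^ 2) ^ 2 := by gcongr
      rw [mul_pow, Real.sq_sqrt hM0.le] at h1
      have h2 : √N ≤ n * σ ^ 2 := by linarith [Real.sqrt_nonneg M]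
      refine le_of_mul_le_mul_right ?_ (by linarith : 0 < √N)
      calc 2 ^ 48 * M * √N ≤ (n * σ ^ 2) ^ 2 * (n * σ ^ 2) := by
            gcongr
            linarith
        _ = n ^ 3 * σ ^ 4 * σ ^ 2 := by ring
        _ ≤ n ^ 3 * σ ^ 4 * (ε ^ 2 * √N) := by gcongr
        _ = _ := by ring
  have h3 : 327680 * M * √(n / M) ≤ ε * n ^ 2 * σ ^ 2 := by
    refine le_of_sq_le_sq ?_ (by positivity)
    rw [mul_pow, Real.sq_sqrt (by positivity)]
    calc (327680 * M) ^ 2 * (n / M) = 327680 ^ 2 * M * n := by field_simp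
      _ ≤ 2 ^ 48 * M * n := by gcongr; norm_num
      _ ≤ ε ^ 2 * n ^ 3 * σ ^ 4 * n := by gcongr
      _ = _ := by ring
  linarith

namespace Protocol

theorem enough_of_sampleSize {d : ℕ} {k : Fin d → ℕ} {A : Protocol k} {σ ε : ℝ}
    (hN : 1 ≤ domainSize k) (hσ : 0 < σ) (hσ1 : σ ≤ 1) (hε : 0 < ε)
    (h : min (1 / ((domainSize k : ℝ) * σ ^ 2)) (σ / (domainSize k : ℝ) ^ (1 / 4 : ℝ)) ≤ ε)
    (hA : A.sampleSize =
      ⌈2 ^ 50 * (√(domainSize k) / (σ * √ε) + √(domainSize k) / σ ^ 2)⌉₊) : A.Enough σ ε := by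
  have hN' : 1 ≤ (domainSize k : ℝ) := by exact_mod_cast hN
  have hM := le_numBins k
  have hM' := numBins_le (k := k) hN
  set N : ℝ := (domainSize k : ℝ)
  set M : ℝ := (numBins k : ℝ)
  set n : ℝ := (A.sampleSize : ℝ) with hndef
  have hM0 : 0 < M := by linarith
  have he : 0 < √ε := Real.sqrt_pos.2 hε
  have hs : 1 ≤ √N := Real.one_le_sqrt.2 hN'
  have hB : 0 ≤ 2 ^ 50 * (√N / (σ * √ε) + √N / σ ^ 2) := by positivity
  have hn1 : 2 ^ 50 * (√N / (σ * √ε) + √N / σ ^ 2) ≤ n := by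
    rw [hndef, hA]; exact Nat.le_ceil _
  have hn2 : n ≤ 2 ^ 50 * (√N / (σ * √ε) + √N / σ ^ 2) + 1 := by
    rw [hndef, hA]; exact (Nat.ceil_lt_add_one hB).le
  have hsM : 2 ^ 24 * √M ≤ 2 ^ 50 * √N := by
    have : √M ≤ √((2 ^ 26) ^ 2 * N) := Real.sqrt_le_sqrt (by linarith)
    rw [Real.sqrt_mul (by positivity), Real.sqrt_sq (by positivity)] at this
    linarith
  have hx : 2 ^ 24 * √M ≤ n * σ ^ 2 := by
    have h1 : 2 ^ 50 * (√N / σ ^ 2) * σ ^ 2 ≤ n * σ ^ 2 := by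
      gcongr
      have : 0 ≤ √N / (σ * √ε) := by positivity
      linarith
    have h2 : 2 ^ 50 * (√N / σ ^ 2) * σ ^ 2 = 2 ^ 50 * √N := by field_simp
    linarith
  have hy : 2 ^ 24 * √M ≤ n * σ * √ε := by
    have h1 : 2 ^ 50 * (√N / (σ * √ε)) * (σ * √ε) ≤ n * (σ * √ε) := by
      gcongr
      have : 0 ≤ √N / σ ^ 2 := by positivity
      linarith
    have h2 : 2 ^ 50 * (√N / (σ * √ε)) * (σ * √ε) = 2 ^ 50 * √N := by field_simp
    linarith
  have hcases := privacy_cases hN' hσ h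
  have hσs := sq_le_mul_of_cases hN' hσ hσ1 hε hcases
  have hlam : A.load = n / M := rfl
  have hn25 : 2 ≤ n := by
    have : n * σ ^ 2 ≤ n := mul_le_of_le_one_right (Nat.cast_nonneg _) (pow_le_one₀ hσ.le hσ1)
    have : √N ≤ √M := Real.sqrt_le_sqrt (by linarith)
    linarith
  have hn0 : 0 < n := by linarith
  have hl0 := A.load_nonneg
  have hRs : √A.load ≤ √(1 + A.load) := Real.sqrt_le_sqrt (by linarith)
  have hR1 : √(1 + A.load) ≤ 1 + √A.load := by
    refine Real.sqrt_le_iff.2 ⟨by positivity, ?_⟩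
    nlinarith [Real.sq_sqrt hl0, Real.sqrt_nonneg A.load]
  refine ⟨by rw [hndef] at hn25; exact_mod_cast hn25, ?_, hx, ?_⟩
  · have h1 : A.load * σ ^ 2 ≤ 3 := by
      rw [hlam, div_mul_eq_mul_div, div_le_iff₀ hM0]
      exact samples_mul_sq_le hN' hσ hσ1 hε hM hn2 hσs
    have h2 : √A.load * σ ≤ 8 := by
      refine le_of_sq_le_sq ?_ (by norm_num)
      rw [mul_pow, Real.sq_sqrt hl0]
      linarith
    have h3 : A.load * (σ / 2) = √A.load * (√A.load * σ) / 2 := by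
      rw [← mul_assoc, Real.mul_self_sqrt hl0]; ring
    rw [h3, bound]
    have := mul_le_mul_of_nonneg_left h2 (Real.sqrt_nonneg A.load)
    linarith
  · have h1 := noise_le hN' hσ hε hn0 hM hx hy hcases
    have hR0 : 0 < A.bound := lt_of_lt_of_le (by norm_num) A.sixteen_le_bound
    have e : ε / (2 * A.bound) * (minGap A.sampleSize M σ / 8) =
        ε * n ^ 2 * σ ^ 2 / (512 * M * A.bound) := by
      unfold minGap; rw [← hndef]; field_simp; ring
    rw [e, le_div_iff₀ (by positivity)]
    refine le_trans ?_ h1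
    rw [← hlam, bound]
    have := mul_le_mul_of_nonneg_left hR1 hM0.le
    linarith

end Protocol

/-! ### Running time -/

theorem clog_mul_log_two_le {n : ℕ} (hn : 2 ≤ n) :
    (Nat.clog 2 n : ℝ) * Real.log 2 ≤ 2 * Real.log n := by
  have h1 := Nat.pow_pred_clog_lt_self one_lt_two (by omega : 1 < n)
  have h2 : 0 < Nat.clog 2 n := Nat.clog_pos one_lt_two hn
  have h3 : 2 ^ Nat.clog 2 n = 2 * 2 ^ (Nat.clog 2 n).pred := by
    rw [← pow_succ', Nat.pred_eq_sub_one, Nat.sub_add_cancel h2]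
  have h4 : 2 ^ Nat.clog 2 n ≤ n ^ 2 := by
    rw [h3, sq]
    exact Nat.mul_le_mul hn h1.le
  rw [← Real.log_pow, ← Nat.cast_two, ← Real.log_pow]
  exact Real.log_le_log (by positivity) (by exact_mod_cast h4)

theorem clog_binRatio_mul_log_two_le {N : ℕ} (hN : 2 ≤ N) :
    (Nat.clog 2 (binRatio * N) : ℝ) * Real.log 2 ≤ 52 * Real.log N := by
  have h1 : Nat.clog 2 (binRatio * N) ≤ 50 + Nat.clog 2 N := by
    refine Nat.clog_le_of_le_pow ?_
    rw [pow_add, binRatio]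
    exact Nat.mul_le_mul_left _ (Nat.le_pow_clog one_lt_two N)
  have h2 := clog_mul_log_two_le hN
  have h3 : Real.log 2 ≤ Real.log N := Real.log_le_log two_pos (by exact_mod_cast hN)
  have h4 : (Nat.clog 2 (binRatio * N) : ℝ) ≤ 50 + Nat.clog 2 N := by exact_mod_cast h1
  have := mul_le_mul_of_nonneg_right h4 (Real.log_nonneg one_le_two)
  linarith

theorem log_domainSize {d : ℕ} {k : Fin d → ℕ} (hk : ∀ i, 2 ≤ k i) :
    Real.log (domainSize k) = ∑ i, Real.log (k i) := by
  rw [domainSize, Nat.cast_prod, Real.log_prod]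
  intro i _
  have := hk i
  positivity

/-- The number of steps is of the order of the number of samples times `log N`. -/
theorem steps_le {d : ℕ} {k : Fin d → ℕ} (hk : ∀ i, 2 ≤ k i) (hd : 0 < d) {n : ℕ} (hn : 1 ≤ n) :
    ((n * (∑ i ∈ Finset.range d, (150 * Nat.clog 2 (cards k i) + 100) +
      100 * Nat.clog 2 (binRatio * domainSize k) + 410) + 50 * d +
      50 * Nat.clog 2 (binRatio * domainSize k) + 200 : ℕ) : ℝ) ≤
      20000 * (n * Real.log (domainSize k)) := by
  have hlog := log_domainSize hk
  have hl2 : 1 / 2 ≤ Real.log 2 := by linarith [Real.log_two_gt_d9]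
  have hk2 : ∀ i, Real.log 2 ≤ Real.log (k i) := fun i =>
    Real.log_le_log two_pos (by exact_mod_cast hk i)
  have hd2 : d * Real.log 2 ≤ Real.log (domainSize k) := by
    have := Finset.sum_le_sum fun i (_ : i ∈ Finset.univ) => hk2 i
    rw [← hlog] at this
    simpa using this
  have hd1 : (1 : ℝ) ≤ d := by exact_mod_cast hd
  set L := Real.log (domainSize k)
  have hL : Real.log 2 ≤ L := by nlinarith
  have hN : 2 ≤ domainSize k := by
    refine (hk ⟨0, hd⟩).trans (Nat.le_of_dvd (Finset.prod_pos fun i _ => ?_)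
      (Finset.dvd_prod_of_mem _ (Finset.mem_univ _)))
    exact lt_of_lt_of_le two_pos (hk i)
  have hb := clog_binRatio_mul_log_two_le hN
  have hsum : (∑ i ∈ Finset.range d, (150 * (Nat.clog 2 (cards k i) : ℝ) + 100)) * Real.log 2 ≤
      400 * L := by
    rw [← Fin.sum_univ_eq_sum_range (fun i => 150 * (Nat.clog 2 (cards k i) : ℝ) + 100),
      Finset.sum_mul, hlog, Finset.mul_sum]
    refine Finset.sum_le_sum fun i _ => ?_
    rw [cards_fin]
    linarith [clog_mul_log_two_le (hk i), hk2 i]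
  set b : ℝ := (Nat.clog 2 (binRatio * domainSize k) : ℝ)
  have hn' : (1 : ℝ) ≤ n := by exact_mod_cast hn
  push_cast
  set s := ∑ i ∈ Finset.range d, (150 * (Nat.clog 2 (cards k i) : ℝ) + 100)
  have h1 : (s + 100 * b + 410) ≤ 2 * (6010 * L) := by nlinarith
  have h2 : 50 * (d : ℝ) + 50 * b + 200 ≤ 2 * (2850 * L) := by nlinarith
  have h3 := mul_le_mul_of_nonneg_left h1 (by linarith : (0 : ℝ) ≤ n)
  have h4 : L ≤ n * L := le_mul_of_one_le_left (by linarith) hn'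
  nlinarith

/-! ### The protocol -/

open Classical in
/-- The protocol: the honest prover describes the marginals of the distribution. -/
noncomputable def independenceProtocol {d : ℕ} {k : Fin d → ℕ} (hk : ∀ i, 0 < k i) (σ ε : ℝ) :
    Protocol k where
  sampleSize := ⌈2 ^ 50 * (√(domainSize k) / (σ * √ε) + √(domainSize k) / σ ^ 2)⌉₊
  msgLength := ∑ i, k i
  honest D := if _ : IsProbabilityMeasure D then (exists_message hk D).choose else fun _ => 0
  verifier := verifier

/-- The honest message describes the product distribution. -/
theorem honest_spec {d : ℕ} {k : Fin d → ℕ} (hk : ∀ i, 0 < k i) (σ ε : ℝ) (D : Measure (Domain k))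
    [hD : IsProbabilityMeasure D] (hprod : IsProductDist D) (x : Domain k) :
    D.real {x} = (leafPiece (cards k) ((independenceProtocol hk σ ε).claim
      ((independenceProtocol hk σ ε).honest D)) x).w := by
  obtain ⟨p, hp, rfl⟩ := hprod
  have e : (independenceProtocol hk σ ε).honest (Measure.pi p) =
      (exists_message hk (Measure.pi p)).choose := dif_pos hD
  rw [e, leafPiece_w (cards_fin k), measureReal_def, Measure.pi_singleton, ENNReal.toReal_prod]
  refine Finset.prod_congr rfl fun i _ => ?_
  rw [(exists_message hk (Measure.pi p)).choose_spec i _ _ (x i)]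
  · have : {y : Domain k | y i = x i} = (fun y => y i) ⁻¹' {x i} := rfl
    rw [this, (measurePreserving_eval p i).measureReal_preimage
      (measurableSet_singleton _).nullMeasurableSet]
    rfl
  · intro j
    have h : ∑ i' ∈ Finset.range i, cards k i' + (j : ℕ) = finSigmaFinEquiv (n := k) ⟨i, j⟩ := by
      rw [sum_cards, finSigmaFinEquiv_apply]
    have h' : ∑ i' ∈ Finset.range i, cards k i' + (j : ℕ) <
        (independenceProtocol hk σ ε).msgLength := h ▸ (finSigmaFinEquiv (n := k) ⟨i, j⟩).2
    refine (dif_pos h').trans ?_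
    exact congrArg (fun l => (((exists_message hk (Measure.pi p)).choose l : unitInterval) : ℝ))
      (Fin.ext h : (⟨_, h'⟩ : Fin (∑ i, k i)) = finSigmaFinEquiv ⟨i, j⟩)

end MAIndependence

open MAIndependence in
theorem mainTheorem4 :
    ∃ (V : Program) (C : ℝ), ∀ (d : ℕ) (k : Fin d → ℕ) (σ ε : ℝ),
      0 < d → (∀ i, 2 ≤ k i) → 0 < σ → σ ≤ 1 → 0 < ε →
      min (1 / ((domainSize k : ℝ) * σ ^ 2)) (σ / (domainSize k : ℝ) ^ (1 / 4 : ℝ)) ≤ ε →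
      ∃ A : Protocol k, A.verifier = V ∧
        A.IsDP σ ε ∧
        (A.sampleSize : ℝ) ≤
          C * (√(domainSize k) / (σ * √ε) + √(domainSize k) / σ ^ 2) ∧
        A.RunsInTime σ ε
          (C * (√(domainSize k) * Real.log (domainSize k) / (σ * √ε) +
            √(domainSize k) * Real.log (domainSize k) / σ ^ 2)) ∧
        (A.msgLength : ℝ) ≤ C * ∑ i, (k i : ℝ) ∧
        (∀ D : Measure (Domain k), IsProbabilityMeasure D → IsProductDist D →
          0.75 ≤ A.acceptProb σ ε (A.honest D) D) ∧
        (∀ D : Measure (Domain k), IsProbabilityMeasure D → IsFarFromProduct σ D →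
          ∀ m : A.Message, A.acceptProb σ ε m D ≤ 0.25) := by
  refine ⟨verifier, 2 ^ 66, fun d k σ ε hd hk hσ hσ1 hε hmin => ?_⟩
  have hk0 : ∀ i, 0 < k i := fun i => lt_of_lt_of_le two_pos (hk i)
  have hN : 1 ≤ domainSize k := Finset.prod_pos fun i _ => hk0 i
  have hE : (independenceProtocol hk0 σ ε).Enough σ ε :=
    Protocol.enough_of_sampleSize hN hσ hσ1 hε hmin rfl
  have hM : 2 ^ 50 * domainSize k ≤ numBins k := by exact_mod_cast le_numBins k
  set B : ℝ := √(domainSize k) / (σ * √ε) + √(domainSize k) / σ ^ 2 with hB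
  have hB1 : 1 ≤ B := by
    have h1 : 1 ≤ √(domainSize k) := Real.one_le_sqrt.2 (by exact_mod_cast hN)
    have h2 : √(domainSize k : ℝ) ≤ √(domainSize k) / σ ^ 2 := by
      rw [le_div_iff₀ (by positivity)]
      exact mul_le_of_le_one_right (by linarith) (pow_le_one₀ hσ.le hσ1)
    have h3 : 0 ≤ √(domainSize k) / (σ * √ε) := by positivity
    linarith
  have hn : ((independenceProtocol hk0 σ ε).sampleSize : ℝ) ≤ 2 ^ 51 * B := by
    have : ((independenceProtocol hk0 σ ε).sampleSize : ℝ) < 2 ^ 50 * B + 1 :=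
      Nat.ceil_lt_add_one (by positivity)
    linarith
  refine ⟨independenceProtocol hk0 σ ε, rfl, Protocol.isDP_of_verifier hk0 rfl hε.le,
    hn.trans (mul_le_mul_of_nonneg_right (by norm_num) (by linarith)), ?_, ?_, ?_, ?_⟩
  · refine Protocol.runsInTime_of_le hk0 rfl ((steps_le hk hd (by linarith [hE.two_le])).trans ?_)
    have hL : 0 ≤ Real.log (domainSize k) := Real.log_nonneg (by exact_mod_cast hN)
    have e : √(domainSize k) * Real.log (domainSize k) / (σ * √ε) +
        √(domainSize k) * Real.log (domainSize k) / σ ^ 2 = B * Real.log (domainSize k) := by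
      rw [hB]; ring
    rw [e]
    have h1 := mul_le_mul_of_nonneg_right hn hL
    have h2 : 0 ≤ B * Real.log (domainSize k) := by positivity
    linarith
  · change ((∑ i, k i : ℕ) : ℝ) ≤ _
    push_cast
    exact le_mul_of_one_le_left (by positivity) (by norm_num)
  · intro D _ hprod
    exact Protocol.le_acceptProb hk0 rfl hσ hε.le hE _ D (honest_spec hk0 σ ε D hprod)
  · intro D _ hfar m
    obtain ⟨q, hq, hw⟩ := Protocol.exists_claimed hk0 m
    refine Protocol.acceptProb_le hk0 rfl hσ hσ1 hε.le hE (by omega) (by omega) m D ?_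
    have := hfar q hq
    rw [tvDist] at this
    simp only [hw] at this
    linarith
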